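/- Let $d\ge 3$ and let $\mathbb T$ be the infinite rooted tree in which every vertex has exactly $d$ neighbours (so the root $\rho$ has $d$ children and every other vertex has $d-1$ children and one parent). Let $|v|$ be the level of a vertex $v$, i.e. its distance from $\rho$, and write $\overleftarrow v$ for the parent of $v\neq\rho$. Let $X$ be a real random variable such that - $X$ is essentially bounded; - there is $\beta_0>0$ (fixed from now on) with $E[e^{\beta_0X}f(X)]=E[f(-X)]$ for all bounded measurable $f:\mathbb R\to\mathbb R$; - $\inf_{\beta\ge 0}\Lambda(\beta)>0$, where $\Lambda(\beta)=\log E[e^{\beta X}]+\log(d-1)$. Let $h:[0,\infty)\to[0,1]$ be nondecreasing, Lipschitz continuous, continuously differentiable on $(0,1)\cup(1,\infty)$, with $h(0)=0$, $\lim_{x\to\infty}h(x)=1$, and $h(x)=x\,h(1/x)$ for all $x>0$. Attach to the edges $(\overleftarrow v,v)$ of $\mathbb T$ i.i.d. marks $X(\overleftarrow v,v)$ with the law of $X$, set $X(v,\overleftarrow v)=-X(\overleftarrow v,v)$, and call this collection of marks the environment $\omega$. For $\beta\in\mathbb R$ and given $\omega$, let $(V_n)_{n\ge0}$ be the Markov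 chain on the vertices of $\mathbb T$ started at $V_0=\rho$ with transition probabilities $$P_\beta(v,w)=\tfrac1d\,h\bigl(e^{(\beta_0+\beta)X(v,w)}\bigr)\quad (w\sim v),\qquad P_\beta(v,v)=1-\sum_{w\sim v}P_\beta(v,w),$$ and let $\mathbb P_\beta$ be the annealed law, i.e. the joint law of $\omega$ and $(V_n)_{n\ge0}$. Define the level regeneration times by $\tau_0=0$ and $$\tau_{m+1}=\inf\bigl\{k>\tau_m:\ |V_j|\ne|V_k|\ \forall j<k,\ \ |V_{k+1}|=|V_k|+1,\ \ |V_j|\neq|V_k|\ \forall j>k\bigr\}$$ (with $\inf\emptyset=\infty$): the first time after $\tau_m$ at which the chain hits some level for the first time, then immediately jumps to the next level and never gets back to that level. Then for each $K>0$ there are $a=a(K)>0$ and $n_a=n_a(K)>0$ such that for all integers $n>n_a$ and all $\beta\in\mathbb R$ with $|\beta|\le K$, $$\mathbb P_\beta(\tau_1>n)\le e^{-n^a}\qquad\text{and}\qquad \mathbb P_\beta(\tau_2-\tau_1>n)\le e^{-n^a}.$$ -/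

import Mathlib

open MeasureTheory ProbabilityTheory

namespace MetropolisTree

/-! ### The `d`-regular rooted tree -/

/-- The non-root vertices of the `d`-regular rooted tree, identified with the edges
`(parent v, v)`.  The root has `d` children and every other vertex has `d - 1` children (and one
parent).  The pair `(i, [])` is the `i`-th child of the root; `(i, j :: l)` is the `j`-th child of
the vertex `(i, l)`. -/
abbrev Edge (d : ℕ) : Type := Fin d × List (Fin (d - 1))

/-- The vertices of the `d`-regular rooted tree; `none` is the root. -/
abbrev Vertex (d : ℕ) : Type := Option (Edge d)

variable {d : ℕ}

instance : MeasurableSpace (Vertex d) := ⊤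

instance : DiscreteMeasurableSpace (Vertex d) := ⟨fun _ => trivial⟩

/-- The root of the tree. -/
def root : Vertex d := none

/-- The parent of a vertex, with the convention that the root is its own parent. -/
def parent : Vertex d → Vertex d
  | none => none
  | some (_, []) => none
  | some (i, _ :: l) => some (i, l)

/-- The level (depth) of a vertex. -/
def level : Vertex d → ℕ
  | none => 0
  | some (_, l) => l.length + 1

/-- The children of a vertex. -/
def children : Vertex d → Finset (Vertex d)
  | none => Finset.univ.image fun i : Fin d => some (i, [])
  | some (i, l) => Finset.univ.image fun j : Fin (d - 1) => some (i, j :: l)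

/-- The neighbours of a vertex: its children and, unless it is the root, its parent. -/
def neighbors : Vertex d → Finset (Vertex d)
  | none => children none
  | some e => insert (parent (some e)) (children (some e))

theorem mem_children {v w : Vertex d} : w ∈ children v ↔ w ≠ root ∧ parent w = v := by
  rcases v with _ | ⟨i, l⟩ <;> rcases w with _ | ⟨i', _ | ⟨j', l'⟩⟩ <;>
    simp [children, root, parent, eq_comm]

theorem mem_neighbors {v w : Vertex d} :
    w ∈ neighbors v ↔ (w ≠ root ∧ parent w = v) ∨ (v ≠ root ∧ parent v = w) := by
  rcases v with _ | e
  · simp [neighbors, mem_children, root]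
  · simp [neighbors, mem_children, root, or_comm, eq_comm]

theorem card_neighbors (v : Vertex d) : (neighbors v).card = d := by
  rcases v with _ | ⟨i, l⟩
  · simp only [neighbors, children]
    rw [Finset.card_image_of_injective _ (fun a b h => by simpa using h)]
    simp
  · have hd : 0 < d := i.pos
    simp only [neighbors]
    rw [Finset.card_insert_of_notMem]
    · simp only [children]
      rw [Finset.card_image_of_injective _ (fun a b h => by simpa using h)]
      simp
      omega
    · rcases l with _ | ⟨j, l⟩
      · simp [mem_children, root, parent]
      · simp only [mem_children, parent]
        rintro ⟨-, h⟩
        rcases l with _ | ⟨k, l⟩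
        · simp at h
        · have := congrArg level h
          simp [level] at this

theorem notMem_neighbors_self (v : Vertex d) : v ∉ neighbors v := by
  have key : ∀ v : Vertex d, v ≠ root → parent v ≠ v := by
    intro v hv h
    rcases v with _ | ⟨i, _ | ⟨j, l⟩⟩
    · exact hv rfl
    · simp [parent] at h
    · have := congrArg level h
      simp [parent, level] at this
  rw [mem_neighbors]
  rintro (⟨h, h'⟩ | ⟨h, h'⟩) <;> exact key v h h'

/-! ### The environment -/

/-- An environment: a real mark `X(parent v, v)` on every edge `(parent v, v)`. -/
abbrev Env (d : ℕ) : Type := Edge d → ℝ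

/-- The mark `X(v, w)` of the oriented edge from `v` to a neighbour `w`: it is the mark of the
edge if `v` is the parent of `w`, and minus the mark of the edge if `w` is the parent of `v`.
(The value is `0` if `v` and `w` are not neighbours.) -/
def mark (ω : Env d) : Vertex d → Vertex d → ℝ
  | none, none => 0
  | none, some e => if parent (some e) = none then ω e else 0
  | some e, none => if parent (some e) = none then -ω e else 0
  | some e, some e' =>
      if parent (some e') = some e then ω e'
      else if parent (some e) = some e' then -ω e else 0

/-- The law of the environment (of the branching random walk): the marks of the edges
`(parent v, v)` are i.i.d. with law `μ`. -/
noncomputable def envLaw (d : ℕ) (μ : Measure ℝ) [IsProbabilityMeasure μ] : Measure (Env d) :=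
  Measure.infinitePi fun _ : Edge d => μ

instance (μ : Measure ℝ) [IsProbabilityMeasure μ] : IsProbabilityMeasure (envLaw d μ) := by
  unfold envLaw; infer_instance

/-! ### Assumptions on the law of the marks -/

/-- The law `μ` of `X` has compact support: `X` is essentially bounded. -/
def EssBounded (μ : Measure ℝ) : Prop := ∃ M : ℝ, ∀ᵐ x ∂μ, |x| ≤ M

/-- `E[exp (β₀ X) f(X)] = E[f(-X)]` for all bounded measurable functions `f`. -/
def ReversibleAt (μ : Measure ℝ) (β₀ : ℝ) : Prop :=
  ∀ f : ℝ → ℝ, Measurable f → (∃ C : ℝ, ∀ x, |f x| ≤ C) →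
    ∫ x, Real.exp (β₀ * x) * f x ∂μ = ∫ x, f (-x) ∂μ

/-- `Λ(β) = log E[exp (β X)] + log (d - 1)`. -/
noncomputable def logLaplace (d : ℕ) (μ : Measure ℝ) (β : ℝ) : ℝ :=
  Real.log (∫ x, Real.exp (β * x) ∂μ) + Real.log ((d : ℝ) - 1)

/-! ### The Metropolis algorithm -/

/-- The acceptance functions `h : [0, ∞) → [0, 1]` of the Metropolis algorithm.  Only the values
of `h` on `[0, ∞)` matter. -/
structure AcceptanceFunction where
  /-- the underlying function -/
  toFun : ℝ → ℝ
  mem_Icc : ∀ x, 0 ≤ x → toFun x ∈ Set.Icc (0 : ℝ) 1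
  monotoneOn : MonotoneOn toFun (Set.Ici 0)
  map_zero : toFun 0 = 0
  tendsto_one : Filter.Tendsto toFun Filter.atTop (nhds 1)
  lipschitz : ∃ C : NNReal, LipschitzOnWith C toFun (Set.Ici 0)
  contDiffOn : ContDiffOn ℝ 1 toFun (Set.Ioo 0 1 ∪ Set.Ioi 1)
  map_inv : ∀ x, 0 ≤ x → toFun x = x * toFun (1 / x)

variable (h : AcceptanceFunction) (β₀ β : ℝ)

/-- `p_β(x) = h(exp ((β₀ + β) x)) / d`. -/
noncomputable def jumpProb (d : ℕ) (x : ℝ) : ℝ := 1 / d * h.toFun (Real.exp ((β₀ + β) * x))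

/-- The transition probabilities `P_β(v, w)` of the Metropolis algorithm in the environment `ω`. -/
noncomputable def transProb (ω : Env d) (v w : Vertex d) : ℝ :=
  if w ∈ neighbors v then jumpProb h β₀ β d (mark ω v w)
  else if w = v then 1 - ∑ u ∈ neighbors v, jumpProb h β₀ β d (mark ω v u)
  else 0

theorem jumpProb_nonneg (x : ℝ) : 0 ≤ jumpProb h β₀ β d x :=
  mul_nonneg (by positivity) (h.mem_Icc _ (Real.exp_pos _).le).1

theorem jumpProb_le (x : ℝ) : jumpProb h β₀ β d x ≤ 1 / d :=
  mul_le_of_le_one_right (by positivity) (h.mem_Icc _ (Real.exp_pos _).le).2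

theorem sum_jumpProb_le_one (ω : Env d) (v : Vertex d) :
    ∑ u ∈ neighbors v, jumpProb h β₀ β d (mark ω v u) ≤ 1 := by
  calc ∑ u ∈ neighbors v, jumpProb h β₀ β d (mark ω v u)
      ≤ ∑ _u ∈ neighbors v, (1 / d : ℝ) := Finset.sum_le_sum fun u _ => jumpProb_le h β₀ β _
    _ ≤ 1 := by
      rw [Finset.sum_const, card_neighbors, nsmul_eq_mul]
      rcases Nat.eq_zero_or_pos d with rfl | hd
      · simp
      · have : (0 : ℝ) < d := by exact_mod_cast hd
        exact (mul_one_div_cancel this.ne').le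

theorem transProb_nonneg (ω : Env d) (v w : Vertex d) : 0 ≤ transProb h β₀ β ω v w := by
  unfold transProb
  split_ifs
  · exact jumpProb_nonneg h β₀ β _
  · linarith [sum_jumpProb_le_one h β₀ β ω v]
  · exact le_rfl

theorem sum_transProb (ω : Env d) (v : Vertex d) :
    ∑ w ∈ insert v (neighbors v), ENNReal.ofReal (transProb h β₀ β ω v w) = 1 := by
  rw [← ENNReal.ofReal_sum_of_nonneg fun w _ => transProb_nonneg h β₀ β ω v w,
    Finset.sum_insert (notMem_neighbors_self v)]
  have h1 : ∑ w ∈ neighbors v, transProb h β₀ β ω v w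
      = ∑ u ∈ neighbors v, jumpProb h β₀ β d (mark ω v u) :=
    Finset.sum_congr rfl fun w hw => by simp [transProb, hw]
  rw [h1]
  simp [transProb, notMem_neighbors_self]

/-- The law of the next position of the Metropolis algorithm at `v` in the environment `ω`. -/
noncomputable def stepPMF (ω : Env d) (v : Vertex d) : PMF (Vertex d) :=
  PMF.ofFinset (fun w => ENNReal.ofReal (transProb h β₀ β ω v w)) (insert v (neighbors v))
    (sum_transProb h β₀ β ω v) (fun w hw => by
      rw [Finset.mem_insert, not_or] at hw
      simp [transProb, hw.1, hw.2])

/-- The one-step transition kernel of the Metropolis algorithm in the environment `ω`. -/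
noncomputable def stepKernel (ω : Env d) : Kernel (Vertex d) (Vertex d) :=
  Kernel.ofFunOfCountable fun v => (stepPMF h β₀ β ω v).toMeasure

instance (ω : Env d) : IsMarkovKernel (stepKernel h β₀ β ω) :=
  ⟨fun v => PMF.toMeasure.isProbabilityMeasure (stepPMF h β₀ β ω v)⟩

/-- The quenched law of the Metropolis algorithm `(V_n)` in the environment `ω`: the law, on
`ℕ → Vertex d`, of the Markov chain with transition probabilities `transProb h β₀ β ω` started
from the vertex `v`. -/
noncomputable def quenchedLaw (v : Vertex d) (ω : Env d) : Measure (ℕ → Vertex d) :=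
  Kernel.trajMeasure (X := fun _ => Vertex d) (Measure.dirac v) fun n =>
    (stepKernel h β₀ β ω).comap (fun x => x ⟨n, Finset.mem_Iic.2 le_rfl⟩) (measurable_pi_apply _)

instance (v : Vertex d) (ω : Env d) : IsProbabilityMeasure (quenchedLaw h β₀ β v ω) := by
  unfold quenchedLaw; infer_instance

theorem stepKernel_singleton (ω : Env d) (v w : Vertex d) :
    stepKernel h β₀ β ω v {w} = ENNReal.ofReal (transProb h β₀ β ω v w) := by
  change (stepPMF h β₀ β ω v).toMeasure {w} = _
  rw [PMF.toMeasure_apply_singleton _ _ (measurableSet_singleton w)]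
  rfl

/-- The set of trajectories that agree with `x` up to time `n`. -/
def pathCylinder (n : ℕ) (x : ℕ → Vertex d) : Set (ℕ → Vertex d) := {y | ∀ i ≤ n, y i = x i}

theorem frestrictLe_preimage_singleton (n : ℕ) (x : ℕ → Vertex d) :
    Preorder.frestrictLe (π := fun _ => Vertex d) n ⁻¹' {Preorder.frestrictLe n x}
      = pathCylinder n x := by
  ext y
  simp only [Set.mem_preimage, Set.mem_singleton_iff, pathCylinder, Set.mem_ofPred_eq]
  constructor
  · intro hy i hi
    exact congrFun hy ⟨i, Finset.mem_Iic.2 hi⟩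
  · intro hy
    funext i
    exact hy i.1 (Finset.mem_Iic.1 i.2)

theorem quenchedLaw_pathCylinder_zero (v : Vertex d) (ω : Env d) (x : ℕ → Vertex d) :
    quenchedLaw h β₀ β v ω (pathCylinder 0 x) = Measure.dirac v {x 0} := by
  have hm : (quenchedLaw h β₀ β v ω).map (Preorder.frestrictLe (π := fun _ => Vertex d) 0)
      = (Measure.dirac v).map
          (MeasurableEquiv.piUnique (fun _ : Finset.Iic 0 => Vertex d)).symm := by
    rw [quenchedLaw, Kernel.trajMeasure, Measure.map_comp _ _ (by fun_prop),
      Kernel.traj_map_frestrictLe, Kernel.partialTraj_self, Measure.id_comp]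
  rw [← frestrictLe_preimage_singleton, ← Measure.map_apply (by fun_prop)
    (measurableSet_singleton _), hm, Measure.map_apply (MeasurableEquiv.measurable _)
    (measurableSet_singleton _)]
  congr 1
  ext y
  simp only [Set.mem_preimage, Set.mem_singleton_iff]
  constructor
  · intro hy
    exact congrFun hy ⟨0, Finset.mem_Iic.2 le_rfl⟩
  · rintro rfl
    funext i
    obtain ⟨i, hi⟩ := i
    obtain rfl : i = 0 := by simpa using hi
    change x 0 = x 0
    rfl

theorem quenchedLaw_pathCylinder_succ (v : Vertex d) (ω : Env d) (n : ℕ) (x : ℕ → Vertex d) :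
    quenchedLaw h β₀ β v ω (pathCylinder (n + 1) x)
      = quenchedLaw h β₀ β v ω (pathCylinder n x)
        * ENNReal.ofReal (transProb h β₀ β ω (x n) (x (n + 1))) := by
  set κ : (n : ℕ) → Kernel (Finset.Iic n → Vertex d) (Vertex d) := fun n =>
    (stepKernel h β₀ β ω).comap (fun x => x ⟨n, Finset.mem_Iic.2 le_rfl⟩)
      (measurable_pi_apply _) with hκ
  have key := Kernel.map_frestrictLe_trajMeasure_compProd_eq_map_trajMeasure
    (X := fun _ => Vertex d) (κ := κ) (μ₀ := Measure.dirac v) (a := n)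
  have key2 := congrArg
    (fun m => m ({Preorder.frestrictLe n x} ×ˢ {x (n + 1)})) key
  have hset : (fun y : ℕ → Vertex d => (Preorder.frestrictLe (π := fun _ => Vertex d) n y,
      y (n + 1))) ⁻¹' ({Preorder.frestrictLe n x} ×ˢ {x (n + 1)}) = pathCylinder (n + 1) x := by
    ext y
    have := Set.ext_iff.1 (frestrictLe_preimage_singleton n x) y
    simp only [Set.mem_preimage, Set.mem_singleton_iff] at this
    simp only [Set.mem_preimage, Set.mem_prod, Set.mem_singleton_iff, this]
    simp only [pathCylinder, Set.mem_ofPred_eq]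
    constructor
    · rintro ⟨h1, h2⟩ i hi
      rcases Nat.le_succ_iff.1 hi with hi | rfl
      exacts [h1 i hi, h2]
    · intro hy
      exact ⟨fun i hi => hy i (by omega), hy _ le_rfl⟩
  rw [Measure.map_apply (by fun_prop) ((measurableSet_singleton _).prod
      (measurableSet_singleton _)), hset,
    Measure.compProd_apply_prod (measurableSet_singleton _) (measurableSet_singleton _),
    lintegral_singleton, Measure.map_apply (by fun_prop) (measurableSet_singleton _),
    frestrictLe_preimage_singleton] at key2
  have hstep : κ n (Preorder.frestrictLe n x) {x (n + 1)}
      = ENNReal.ofReal (transProb h β₀ β ω (x n) (x (n + 1))) := by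
    rw [hκ]
    exact stepKernel_singleton h β₀ β ω (x n) (x (n + 1))
  rw [hstep, mul_comm] at key2
  exact key2.symm

/-- The finite-dimensional distributions of the Metropolis algorithm. -/
theorem quenchedLaw_pathCylinder (v : Vertex d) (ω : Env d) (n : ℕ) (x : ℕ → Vertex d) :
    quenchedLaw h β₀ β v ω (pathCylinder n x)
      = Measure.dirac v {x 0}
        * ∏ i ∈ Finset.range n, ENNReal.ofReal (transProb h β₀ β ω (x i) (x (i + 1))) := by
  induction n with
  | zero => simp [quenchedLaw_pathCylinder_zero]
  | succ n ih => rw [quenchedLaw_pathCylinder_succ, ih, Finset.prod_range_succ, mul_assoc]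

theorem measurable_mark (v w : Vertex d) : Measurable fun ω : Env d => mark ω v w := by
  rcases v with _ | e <;> rcases w with _ | e' <;> simp only [mark] <;>
    (try split_ifs) <;> fun_prop

theorem measurable_jumpProb : Measurable (jumpProb h β₀ β d) := by
  have h1 : Monotone fun y : ℝ => h.toFun (Real.exp y) := fun a b hab =>
    h.monotoneOn (Real.exp_pos a).le (Real.exp_pos b).le (Real.exp_le_exp.2 hab)
  exact (h1.measurable.comp (measurable_const_mul (β₀ + β))).const_mul (1 / d : ℝ)

theorem measurable_transProb (v w : Vertex d) :
    Measurable fun ω : Env d => transProb h β₀ β ω v w := by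
  have h1 : ∀ u, Measurable fun ω : Env d => jumpProb h β₀ β d (mark ω v u) := fun u =>
    (measurable_jumpProb h β₀ β).comp (measurable_mark v u)
  unfold transProb
  split_ifs
  · exact h1 w
  · exact measurable_const.sub (Finset.measurable_sum _ fun u _ => h1 u)
  · exact measurable_const

theorem isPiSystem_pathCylinder :
    IsPiSystem {s : Set (ℕ → Vertex d) | ∃ n x, s = pathCylinder n x} := by
  rintro _ ⟨n, x, rfl⟩ _ ⟨m, y, rfl⟩ ⟨z, hz1, hz2⟩
  refine ⟨max n m, z, ?_⟩
  ext w
  simp only [pathCylinder, Set.mem_inter_iff, Set.mem_ofPred_eq] at hz1 hz2 ⊢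
  constructor
  · rintro ⟨h1, h2⟩ i hi
    rcases le_max_iff.1 hi with hi | hi
    · rw [h1 i hi, hz1 i hi]
    · rw [h2 i hi, hz2 i hi]
  · intro hw
    exact ⟨fun i hi => by rw [hw i (le_max_of_le_left hi), hz1 i hi],
      fun i hi => by rw [hw i (le_max_of_le_right hi), hz2 i hi]⟩

theorem measurableSet_pathCylinder (n : ℕ) (x : ℕ → Vertex d) :
    MeasurableSet (pathCylinder n x) := by
  rw [← frestrictLe_preimage_singleton]
  exact (measurableSet_singleton _).preimage (by fun_prop)

theorem generateFrom_pathCylinder :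
    (MeasurableSpace.pi : MeasurableSpace (ℕ → Vertex d))
      = MeasurableSpace.generateFrom {s | ∃ n x, s = pathCylinder n x} := by
  refine le_antisymm ?_ (MeasurableSpace.generateFrom_le ?_)
  · refine iSup_le fun n => ?_
    rintro _ ⟨S, -, rfl⟩
    let ext' : (Fin (n + 1) → Vertex d) → ℕ → Vertex d := fun u i =>
      if hi : i < n + 1 then u ⟨i, hi⟩ else root
    have hS : (fun y : ℕ → Vertex d => y n) ⁻¹' S
        = ⋃ u : {u : Fin (n + 1) → Vertex d // u (Fin.last n) ∈ S},
            pathCylinder n (ext' u.1) := by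
      ext y
      simp only [Set.mem_preimage, Set.mem_iUnion, pathCylinder, Set.mem_ofPred_eq]
      constructor
      · intro hy
        refine ⟨⟨fun i => y i, hy⟩, fun i hi => ?_⟩
        have hi' : i < n + 1 := Nat.lt_succ_of_le hi
        simp only [ext', dif_pos hi']
      · rintro ⟨⟨u, hu⟩, hy⟩
        have := hy n le_rfl
        rw [this]
        simpa [ext', Fin.last] using hu
    rw [hS]
    exact MeasurableSet.iUnion fun u =>
      MeasurableSpace.measurableSet_generateFrom ⟨n, _, rfl⟩
  · rintro _ ⟨n, x, rfl⟩
    exact measurableSet_pathCylinder n x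

theorem measurable_quenchedLaw (v : Vertex d) : Measurable (quenchedLaw h β₀ β v) := by
  refine Measurable.measure_of_isPiSystem_of_isProbabilityMeasure generateFrom_pathCylinder
    isPiSystem_pathCylinder ?_
  rintro _ ⟨n, x, rfl⟩
  simp only [quenchedLaw_pathCylinder]
  exact (Finset.measurable_prod _ fun i _ =>
    (measurable_transProb h β₀ β _ _).ennreal_ofReal).const_mul _

/-- The quenched laws `P_{ω,β}^v`, as a kernel from environments to trajectories. -/
noncomputable def quenchedKernel (v : Vertex d) : Kernel (Env d) (ℕ → Vertex d) where
  toFun := quenchedLaw h β₀ β v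
  measurable' := measurable_quenchedLaw h β₀ β v

instance (v : Vertex d) : IsMarkovKernel (quenchedKernel h β₀ β v) :=
  ⟨fun ω => inferInstanceAs (IsProbabilityMeasure (quenchedLaw h β₀ β v ω))⟩

/-- The annealed law `P(dω) P_{ω,β}^root(dV)` on pairs (environment, trajectory) of the Metropolis
algorithm started from the root. -/
noncomputable def annealedLaw (d : ℕ) (μ : Measure ℝ) [IsProbabilityMeasure μ] :
    Measure (Env d × (ℕ → Vertex d)) :=
  envLaw d μ ⊗ₘ quenchedKernel h β₀ β root

/-! ### Level regeneration times -/

/-- At time `k` the trajectory `V` hits a level for the first time, then immediately jumps to the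
next level and never gets back. -/
def IsLevelRegeneration (V : ℕ → Vertex d) (k : ℕ) : Prop :=
  (∀ j < k, level (V j) ≠ level (V k)) ∧ level (V (k + 1)) = level (V k) + 1 ∧
    ∀ j > k, level (V j) ≠ level (V k)

/-- The level regeneration times: `τ₀ = 0`, and `τ_{m+1}` is the first time strictly after `τ_m`
at which a level regeneration occurs (`⊤` if there is none). -/
noncomputable def regenTime (V : ℕ → Vertex d) : ℕ → ℕ∞
  | 0 => 0
  | m + 1 => ⨅ (k : ℕ) (_ : regenTime V m < (k : ℕ∞) ∧ IsLevelRegeneration V k), (k : ℕ∞)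

end MetropolisTree

namespace MetropolisTree

/-! ### Product measures on real marks -/

section Product

/-! Everything is reduced to one random variable, the escape weight `escape` of a marked subtree. It
stands for the probability that the walk sitting just above the subtree jumps into it in one step
and never comes back. The chain is reversible, so this is an effective conductance up to
normalisation, and it obeys a series-parallel recursion along the tree.

Transience, uniformly in |β| ≤ K. The function exp(β₀ s / 2) cos(θ s), cut off outside a strip |s| ≤
A, is strictly subharmonic for the mean kernel of the branching random walk of potentials, because
exp(β₀ x / 2) μ(dx) is symmetric and Λ(β₀ / 2) > 0 (`exists_stripFunction`). The branching random
walk killed outside the strip is therefore supercritical. Inside the strip the conductances are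
bounded above and below uniformly in β, and rescaled escape weights dominate survival probabilities
of a slightly thinned killed process. This yields P(escape < y) ≤ q < 1 with y and q free of β
(`exists_measure_escape_lt_le`). A small weight forces all of the at least two independent subtrees
below to have small weight, so the lower tail decays doubly exponentially in the number of levels
(`measure_escape_lt_pow_le`). From this come the three moment bounds of `EnvEstimates`.

Freshness. When the walk discovers a new vertex it has not yet read any mark strictly below it, so
quenched bounds which depend on these marks only can be averaged independently of the past
(`walkLaw_inter_shiftPath_le`). Consequently, outside an event of probability at most (T + 1) C
exp(-c t^a), the trajectory is good (`IsGood`): a vertex discovered by time T is visited at most t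
times, at most t vertices are visited on each level up to T, a walk which gets t levels below the
first visited vertex of a level without leaving its strict descendants never leaves them, and among
t successive attempts to do so one succeeds.

The rest is deterministic. On a good trajectory the first two properties force a gain of t² + 1
levels in slightly more than t⁴ steps, the fourth gives a successful attempt in this range, and the
third makes it permanent, which is a regeneration (`IsGood.exists_regeneration`). With T = 2n and t
about n^(1/5), this is used once from time 0 and once from τ₁ on the same good event, so no renewal
property of the increments is required. -/

theorem DependsOn.measurable_iSup {ι α : Type*} [MeasurableSpace α] {S : Set ι}
    {f : (ι → ℝ) → α} (hf : Measurable f) (hS : DependsOn f S) :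
    Measurable[⨆ i ∈ S, MeasurableSpace.comap (fun ω : ι → ℝ => ω i) inferInstance] f := by
  classical
  -- Freezing the coordinates outside `S` at `0` does not change `f`, and makes every coordinate
  -- measurable for the smaller σ-algebra.
  let q : (ι → ℝ) → ι → ℝ := fun ω i => if i ∈ S then ω i else 0
  have hq : f = f ∘ q := by
    funext ω
    exact hS fun i hi => by simp [q, hi]
  rw [hq]
  refine hf.comp (@measurable_pi_lambda _ _ _
    (⨆ i ∈ S, MeasurableSpace.comap (fun ω : ι → ℝ => ω i) inferInstance) _ _ fun i => ?_)
  by_cases hi : i ∈ S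
  · simp only [q, hi, if_true]
    exact Measurable.mono (comap_measurable fun ω : ι → ℝ => ω i)
      (le_iSup₂_of_le i hi le_rfl) le_rfl
  · simp only [q, hi, if_false]
    exact measurable_const

/-- Functions of disjoint families of independent marks are independent. -/
theorem indepFun_of_dependsOn {ι α γ : Type*} [MeasurableSpace α] [MeasurableSpace γ]
    (μ : Measure ℝ) [IsProbabilityMeasure μ] {S T : Set ι} (hST : Disjoint S T)
    {f : (ι → ℝ) → α} {g : (ι → ℝ) → γ} (hf : Measurable f) (hg : Measurable g)
    (hfS : DependsOn f S) (hgT : DependsOn g T) :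
    IndepFun f g (Measure.infinitePi fun _ : ι => μ) := by
  have h1 : iIndepFun (fun (i : ι) (ω : ι → ℝ) => ω i) (Measure.infinitePi fun _ : ι => μ) :=
    iIndepFun_infinitePi (X := fun _ x => x) (fun _ => measurable_id)
  have h2 := indep_iSup_of_disjoint (fun i => (measurable_pi_apply i).comap_le)
    ((iIndepFun_iff_iIndep _ _ _).1 h1) hST
  rw [IndepFun_iff_Indep]
  exact indep_of_indep_of_le_right (indep_of_indep_of_le_left h2
    (DependsOn.measurable_iSup hf hfS).comap_le) (DependsOn.measurable_iSup hg hgT).comap_le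

theorem lintegral_mul_of_dependsOn {ι : Type*}
    (μ : Measure ℝ) [IsProbabilityMeasure μ] {S T : Set ι} (hST : Disjoint S T)
    {f g : (ι → ℝ) → ENNReal} (hf : Measurable f) (hg : Measurable g)
    (hfS : DependsOn f S) (hgT : DependsOn g T) :
    ∫⁻ ω, f ω * g ω ∂(Measure.infinitePi fun _ : ι => μ)
      = (∫⁻ ω, f ω ∂(Measure.infinitePi fun _ : ι => μ))
        * ∫⁻ ω, g ω ∂(Measure.infinitePi fun _ : ι => μ) :=
  lintegral_mul_eq_lintegral_mul_lintegral_of_indepFun hf hg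
    (indepFun_of_dependsOn μ hST hf hg hfS hgT)

end Product

/-! ### Marked trees -/

/-- Marks on the `b`-ary tree, the mark at `[]` being that of an edge above its root. -/
abbrev Marks (b : ℕ) : Type := List (Fin b) → ℝ

variable {b : ℕ}

/-- The marks on the subtree of the `i`-th child. -/
def shift (i : Fin b) (ξ : Marks b) : Marks b := fun l => ξ (l ++ [i])

/-- The law of i.i.d. marks. -/
noncomputable def marksLaw (b : ℕ) (μ : Measure ℝ) [IsProbabilityMeasure μ] : Measure (Marks b) :=
  Measure.infinitePi fun _ : List (Fin b) => μ

instance (μ : Measure ℝ) [IsProbabilityMeasure μ] : IsProbabilityMeasure (marksLaw b μ) := by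
  unfold marksLaw; infer_instance

@[fun_prop]
theorem measurable_shift (i : Fin b) : Measurable (shift i : Marks b → Marks b) :=
  measurable_pi_lambda _ fun _ => measurable_pi_apply _

theorem map_shifts (μ : Measure ℝ) [IsProbabilityMeasure μ] :
    (marksLaw b μ).map (fun ξ i => shift i ξ) = Measure.pi fun _ : Fin b => marksLaw b μ := by
  -- Lists have the newest step at the head, so it is the last entry that says in which child's
  -- subtree a vertex lies.
  have hinj : Function.Injective fun p : Fin b × List (Fin b) => p.2 ++ [p.1] := by
    rintro ⟨i, l⟩ ⟨j, m⟩ h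
    have := List.append_inj' h rfl
    simp_all
  have h1 := Measure.map_infinitePi_infinitePi_of_inj
    (P := fun _ : List (Fin b) => μ) hinj
  have h2 := Measure.infinitePi_map_curry (fun (_ : Fin b) (_ : List (Fin b)) => μ)
  rw [← Measure.infinitePi_eq_pi]
  unfold marksLaw
  rw [← h2, ← h1, Measure.map_map (by fun_prop) (by fun_prop)]
  rfl

/-- The mark above the root and the marked subtrees of the children are independent. -/
theorem map_root_shifts (μ : Measure ℝ) [IsProbabilityMeasure μ] :
    (marksLaw b μ).map (fun ξ => (ξ [], fun i => shift i ξ))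
      = μ.prod (Measure.pi fun _ : Fin b => marksLaw b μ) := by
  have hf : Measurable fun ξ : Marks b => ξ [] := measurable_pi_apply _
  have hg : Measurable fun (ξ : Marks b) (i : Fin b) => shift i ξ := by fun_prop
  have h := indepFun_of_dependsOn (ι := List (Fin b)) μ (S := {[]}) (T := {[]}ᶜ)
    disjoint_compl_right hf hg (fun x y h => h [] rfl)
    (fun x y h => by
      funext i l
      exact h _ (by simp))
  have h2 := (indepFun_iff_map_prod_eq_prod_map_map hf.aemeasurable hg.aemeasurable).1 h
  have h3 := map_shifts (b := b) μ
  unfold marksLaw at *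
  rw [h2, h3]
  congr 1
  exact Measure.infinitePi_map_eval (fun _ : List (Fin b) => μ) []

theorem map_shift (μ : Measure ℝ) [IsProbabilityMeasure μ] (i : Fin b) :
    (marksLaw b μ).map (shift i) = marksLaw b μ :=
  Measure.map_infinitePi_infinitePi_of_inj (P := fun _ : List (Fin b) => μ)
    (f := fun l => l ++ [i]) (fun l m h => by simpa using h)

theorem lintegral_shift (μ : Measure ℝ) [IsProbabilityMeasure μ] (i : Fin b)
    {f : Marks b → ENNReal} (hf : Measurable f) :
    ∫⁻ ξ, f (shift i ξ) ∂marksLaw b μ = ∫⁻ ξ, f ξ ∂marksLaw b μ := by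
  conv_rhs => rw [← map_shift μ i]
  rw [lintegral_map hf (measurable_shift i)]

theorem lintegral_shift_mul (μ : Measure ℝ) [IsProbabilityMeasure μ] {i j : Fin b} (hij : i ≠ j)
    {f g : Marks b → ENNReal} (hf : Measurable f) (hg : Measurable g) :
    ∫⁻ ξ, f (shift i ξ) * g (shift j ξ) ∂marksLaw b μ
      = (∫⁻ ξ, f ξ ∂marksLaw b μ) * ∫⁻ ξ, g ξ ∂marksLaw b μ := by
  rw [← lintegral_shift μ i hf, ← lintegral_shift μ j hg]
  refine lintegral_mul_of_dependsOn (ι := List (Fin b)) μ (S := Set.range fun l => l ++ [i])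
    (T := Set.range fun l => l ++ [j]) ?_ (hf.comp (measurable_shift i))
    (hg.comp (measurable_shift j)) ?_ ?_
  · rw [Set.disjoint_left]
    rintro _ ⟨l, rfl⟩ ⟨m, h⟩
    have := List.append_inj' h rfl
    simp_all
  · intro x y h
    exact congrArg f (funext fun l => h _ ⟨l, rfl⟩)
  · intro x y h
    exact congrArg g (funext fun l => h _ ⟨l, rfl⟩)

theorem ae_marks_bounded {μ : Measure ℝ} [IsProbabilityMeasure μ] {M : ℝ}
    (hM : ∀ᵐ x ∂μ, |x| ≤ M) : ∀ᵐ ξ ∂marksLaw b μ, ∀ l, |ξ l| ≤ M := by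
  rw [ae_all_iff]
  intro l
  exact (measurePreserving_eval_infinitePi (fun _ : List (Fin b) => μ) l).quasiMeasurePreserving.ae hM

/-! ### Acceptance probabilities -/

/-- For large z the symmetry gives h(1/z) = h(z)/z > 0, and monotonicity carries this from the small
argument 1/z to x. -/
theorem AcceptanceFunction.pos (h : AcceptanceFunction) {x : ℝ} (hx : 0 < x) : 0 < h.toFun x := by
  have h1 := (h.tendsto_one.eventually (lt_mem_nhds (show (1 / 2 : ℝ) < 1 by norm_num))).and
    (Filter.eventually_ge_atTop (1 / x))
  obtain ⟨z, hz, hzx⟩ := h1.exists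
  have hz0 : 0 < z := lt_of_lt_of_le (by positivity) hzx
  have h2 : 0 < h.toFun (1 / z) := by
    rw [h.map_inv _ (by positivity), one_div_one_div]
    exact mul_pos (by positivity) (by linarith)
  exact h2.trans_le (h.monotoneOn (by simp [hz0.le]) hx.le
    ((one_div_le hx hz0).1 hzx))

section Jump

variable {d : ℕ} (h : AcceptanceFunction) (β₀ β : ℝ)

theorem jumpProb_pos (hd : 0 < d) (x : ℝ) : 0 < jumpProb h β₀ β d x :=
  mul_pos (by positivity) (h.pos (Real.exp_pos _))

theorem jumpProb_le_one (x : ℝ) : jumpProb h β₀ β d x ≤ 1 := by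
  refine (jumpProb_le h β₀ β x).trans ?_
  rcases Nat.eq_zero_or_pos d with rfl | hd
  · simp
  · rw [div_le_one (by positivity)]
    exact_mod_cast hd

/-- Reversibility of the acceptance probabilities. -/
theorem jumpProb_eq_exp_mul_neg (x : ℝ) :
    jumpProb h β₀ β d x = Real.exp ((β₀ + β) * x) * jumpProb h β₀ β d (-x) := by
  unfold jumpProb
  rw [h.map_inv _ (Real.exp_pos _).le, one_div (Real.exp _), ← Real.exp_neg, mul_neg]
  ring

/-- Uniform ellipticity: by monotonicity of `h` the worst exponent is -A M, so the constant depends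
on β only through the bound on |β₀ + β|. -/
theorem exists_jumpProb_lower_bound (hd : 0 < d) (M A : ℝ) :
    ∃ c : ℝ, 0 < c ∧ c ≤ 1 ∧ ∀ β x : ℝ, |β₀ + β| ≤ A → |x| ≤ M → c ≤ jumpProb h β₀ β d x := by
  refine ⟨1 / d * h.toFun (Real.exp (-(A * M))), mul_pos (by positivity) (h.pos (Real.exp_pos _)),
    ?_, ?_⟩
  · have := jumpProb_le_one (d := d) h 0 1 (-(A * M))
    simpa [jumpProb] using this
  · intro β x hβ hx
    refine mul_le_mul_of_nonneg_left (h.monotoneOn (Real.exp_pos _).le (Real.exp_pos _).le ?_)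
      (by positivity)
    rw [Real.exp_le_exp]
    have : |(β₀ + β) * x| ≤ A * M := by
      rw [abs_mul]
      exact mul_le_mul hβ hx (abs_nonneg _) ((abs_nonneg _).trans hβ)
    exact (abs_le.1 this).1

end Jump

/-! ### Escape weights of marked trees -/

section Escape

variable {b d : ℕ} (h : AcceptanceFunction) (β₀ β : ℝ)

/-- The effective weight of an edge with mark `x` in series with a weight `y` below it. -/
noncomputable def series (d : ℕ) (x y : ℝ) : ℝ :=
  jumpProb h β₀ β d x * (y / (jumpProb h β₀ β d (-x) + y))

/-- The weight with which the walk above the tree escapes through its upper edge and its first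
`n` levels. -/
noncomputable def escapeUpTo (d : ℕ) : ℕ → Marks b → ℝ
  | 0, ξ => jumpProb h β₀ β d (ξ [])
  | n + 1, ξ => series h β₀ β d (ξ []) (∑ i, escapeUpTo d n (shift i ξ))

/-- The weight with which the walk above the tree escapes to infinity through its upper edge. -/
noncomputable def escape (d : ℕ) (ξ : Marks b) : ℝ := ⨅ n, escapeUpTo h β₀ β d n ξ

/-- The probability that the walk started at the root of the tree never crosses the upper edge. -/
noncomputable def escapeProb (d : ℕ) (ξ : Marks b) : ℝ :=
  (∑ i, escape h β₀ β d (shift i ξ)) /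
    (jumpProb h β₀ β d (-ξ []) + ∑ i, escape h β₀ β d (shift i ξ))

variable {h β₀ β}

theorem series_nonneg {x y : ℝ} (hy : 0 ≤ y) : 0 ≤ series h β₀ β d x y :=
  mul_nonneg (jumpProb_nonneg h β₀ β x)
    (div_nonneg hy (add_nonneg (jumpProb_nonneg h β₀ β _) hy))

theorem series_mono (hd : 0 < d) {x y z : ℝ} (hy : 0 ≤ y) (hyz : y ≤ z) :
    series h β₀ β d x y ≤ series h β₀ β d x z := by
  have hp := jumpProb_pos h β₀ β hd (-x)
  refine mul_le_mul_of_nonneg_left ?_ (jumpProb_nonneg h β₀ β x)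
  rw [div_le_div_iff₀ (by linarith) (by linarith)]
  nlinarith

theorem series_le {x y : ℝ} (hy : 0 ≤ y) : series h β₀ β d x y ≤ jumpProb h β₀ β d x :=
  mul_le_of_le_one_right (jumpProb_nonneg h β₀ β x)
    (div_le_one_of_le₀ (by linarith [jumpProb_nonneg h β₀ β (d := d) (-x)])
      (add_nonneg (jumpProb_nonneg h β₀ β _) hy))

theorem escapeUpTo_nonneg (n : ℕ) (ξ : Marks b) : 0 ≤ escapeUpTo h β₀ β d n ξ := by
  induction n generalizing ξ with
  | zero => exact jumpProb_nonneg h β₀ β _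
  | succ n ih => exact series_nonneg (Finset.sum_nonneg fun i _ => ih _)

theorem escapeUpTo_succ_le (hd : 0 < d) (n : ℕ) (ξ : Marks b) :
    escapeUpTo h β₀ β d (n + 1) ξ ≤ escapeUpTo h β₀ β d n ξ := by
  induction n generalizing ξ with
  | zero => exact series_le (Finset.sum_nonneg fun i _ => escapeUpTo_nonneg 0 _)
  | succ n ih =>
    exact series_mono hd (Finset.sum_nonneg fun i _ => escapeUpTo_nonneg _ _)
      (Finset.sum_le_sum fun i _ => ih _)

theorem escapeUpTo_antitone (hd : 0 < d) (ξ : Marks b) :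
    Antitone fun n => escapeUpTo h β₀ β d n ξ :=
  antitone_nat_of_succ_le fun n => escapeUpTo_succ_le hd n ξ

theorem bddBelow_escapeUpTo (ξ : Marks b) :
    BddBelow (Set.range fun n => escapeUpTo h β₀ β d n ξ) :=
  ⟨0, by rintro _ ⟨n, rfl⟩; exact escapeUpTo_nonneg n ξ⟩

theorem tendsto_escapeUpTo (hd : 0 < d) (ξ : Marks b) :
    Filter.Tendsto (fun n => escapeUpTo h β₀ β d n ξ) Filter.atTop
      (nhds (escape h β₀ β d ξ)) :=
  tendsto_atTop_ciInf (escapeUpTo_antitone hd ξ) (bddBelow_escapeUpTo ξ)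

theorem escape_nonneg (ξ : Marks b) : 0 ≤ escape h β₀ β d ξ :=
  le_ciInf fun n => escapeUpTo_nonneg n ξ

theorem sum_escape_nonneg (ξ : Marks b) : 0 ≤ ∑ i, escape h β₀ β d (shift i ξ) :=
  Finset.sum_nonneg fun _ _ => escape_nonneg _

theorem escape_le_one (ξ : Marks b) : escape h β₀ β d ξ ≤ 1 :=
  (ciInf_le (bddBelow_escapeUpTo ξ) 0).trans (jumpProb_le_one h β₀ β _)

/-- The truncated weights decrease to their infimum, and the series law is continuous there because
its denominator stays positive. -/
theorem escape_eq_series (hd : 0 < d) (ξ : Marks b) :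
    escape h β₀ β d ξ = series h β₀ β d (ξ []) (∑ i, escape h β₀ β d (shift i ξ)) := by
  have h1 := (tendsto_escapeUpTo (h := h) (β₀ := β₀) (β := β) hd ξ).comp
    (Filter.tendsto_add_atTop_nat 1)
  refine tendsto_nhds_unique h1 ?_
  have h2 : Filter.Tendsto (fun n => ∑ i, escapeUpTo h β₀ β d n (shift i ξ)) Filter.atTop
      (nhds (∑ i, escape h β₀ β d (shift i ξ))) :=
    tendsto_finsetSum _ fun i _ => tendsto_escapeUpTo hd _
  have hne : jumpProb h β₀ β d (-ξ []) + ∑ i, escape h β₀ β d (shift i ξ) ≠ 0 :=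
    (add_pos_of_pos_of_nonneg (jumpProb_pos h β₀ β hd _) (sum_escape_nonneg ξ)).ne'
  exact (h2.div (h2.const_add _) hne).const_mul _

theorem escape_eq_mul_escapeProb (hd : 0 < d) (ξ : Marks b) :
    escape h β₀ β d ξ = jumpProb h β₀ β d (ξ []) * escapeProb h β₀ β d ξ :=
  escape_eq_series hd ξ

theorem escapeProb_nonneg (ξ : Marks b) : 0 ≤ escapeProb h β₀ β d ξ :=
  div_nonneg (sum_escape_nonneg ξ)
    (add_nonneg (jumpProb_nonneg h β₀ β _) (sum_escape_nonneg ξ))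

theorem one_sub_escapeProb (hd : 0 < d) (ξ : Marks b) :
    1 - escapeProb h β₀ β d ξ = jumpProb h β₀ β d (-ξ []) /
      (jumpProb h β₀ β d (-ξ []) + ∑ i, escape h β₀ β d (shift i ξ)) := by
  have := add_pos_of_pos_of_nonneg (jumpProb_pos h β₀ β hd (-ξ []))
    (sum_escape_nonneg (h := h) (β₀ := β₀) (β := β) (d := d) ξ)
  unfold escapeProb
  field_simp
  ring

theorem one_sub_escapeProb_nonneg (hd : 0 < d) (ξ : Marks b) :
    0 ≤ 1 - escapeProb h β₀ β d ξ := by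
  rw [one_sub_escapeProb hd]
  exact div_nonneg (jumpProb_nonneg h β₀ β _)
    (add_nonneg (jumpProb_nonneg h β₀ β _) (sum_escape_nonneg ξ))

/-- The escape probability is at least the one through a single child. -/
theorem one_sub_escapeProb_le (hd : 0 < d) (ξ : Marks b) (i : Fin b) :
    1 - escapeProb h β₀ β d ξ ≤ 1 / (1 + escape h β₀ β d (shift i ξ)) := by
  have h1 := jumpProb_pos h β₀ β hd (-ξ [])
  have h2 := jumpProb_le_one h β₀ β (d := d) (-ξ [])
  have h3 : escape h β₀ β d (shift i ξ) ≤ ∑ i, escape h β₀ β d (shift i ξ) :=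
    Finset.single_le_sum (f := fun i => escape h β₀ β d (shift i ξ))
      (fun _ _ => escape_nonneg _) (Finset.mem_univ i)
  have h4 := escape_nonneg (h := h) (β₀ := β₀) (β := β) (d := d) (shift i ξ)
  -- With p the probability to move up, y the weight of the i-th subtree and B the total weight,
  -- this is p y ≤ B, which holds as p ≤ 1 and y ≤ B.
  rw [one_sub_escapeProb hd, div_le_div_iff₀ (by linarith) (by linarith)]
  nlinarith

theorem measurable_escapeUpTo (n : ℕ) :
    Measurable (escapeUpTo h β₀ β d n : Marks b → ℝ) := by
  have h0 : Measurable fun ξ : Marks b => ξ [] := measurable_pi_apply _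
  have hp : Measurable (jumpProb h β₀ β d) := measurable_jumpProb h β₀ β
  induction n with
  | zero => exact hp.comp h0
  | succ n ih =>
    have h2 : Measurable fun ξ : Marks b => ∑ i, escapeUpTo h β₀ β d n (shift i ξ) :=
      Finset.measurable_sum _ fun i _ => ih.comp (measurable_shift i)
    exact (hp.comp h0).mul (h2.div ((hp.comp h0.neg).add h2))

theorem measurable_escape : Measurable (escape h β₀ β d : Marks b → ℝ) :=
  Measurable.iInf fun n => measurable_escapeUpTo n

/-- The escape weight of a tree with bounded marks is at least a constant times that of a
subtree. -/
theorem mul_escape_shift_le (hd : 0 < d) {c : ℝ} (hc : 0 < c) {ξ : Marks b} 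
    (hξ : c ≤ jumpProb h β₀ β d (ξ [])) (i : Fin b) :
    c / 2 * escape h β₀ β d (shift i ξ) ≤ escape h β₀ β d ξ := by
  rw [escape_eq_series hd ξ]
  have h3 : escape h β₀ β d (shift i ξ) ≤ ∑ i, escape h β₀ β d (shift i ξ) :=
    Finset.single_le_sum (f := fun i => escape h β₀ β d (shift i ξ))
      (fun _ _ => escape_nonneg _) (Finset.mem_univ i)
  have h4 := escape_nonneg (h := h) (β₀ := β₀) (β := β) (d := d) (shift i ξ)
  have h5 := escape_le_one (h := h) (β₀ := β₀) (β := β) (d := d) (shift i ξ)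
  refine le_trans ?_ (series_mono hd h4 h3)
  unfold series
  set y := escape h β₀ β d (shift i ξ)
  have h1 := jumpProb_pos h β₀ β hd (-ξ [])
  have h2 := jumpProb_le_one h β₀ β (d := d) (-ξ [])
  -- Both terms of the denominator are at most 1; this is the origin of the factor 2 in c / 2.
  have h6 : y / 2 ≤ y / (jumpProb h β₀ β d (-ξ []) + y) :=
    div_le_div_of_nonneg_left h4 (by linarith) (by linarith)
  calc c / 2 * y = c * (y / 2) := by ring
    _ ≤ _ := mul_le_mul hξ h6 (by positivity) (hc.le.trans hξ)

end Escape

/-! ### A subharmonic function of the branching random walk in a strip -/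

/-- Reversibility says that exp(β₀ x / 2) μ(dx) is invariant under x ↦ -x, so odd functions
integrate to zero. -/
theorem ReversibleAt.integral_sin_eq_zero {μ : Measure ℝ} {β₀ : ℝ} (hrev : ReversibleAt μ β₀)
    {M : ℝ} (hM : ∀ᵐ x ∂μ, |x| ≤ M) (θ : ℝ) :
    ∫ x, Real.exp (β₀ * x / 2) * Real.sin (θ * x) ∂μ = 0 := by
  -- The test function exp(-β₀ x / 2) sin(θ x) has to be cut off at M to be bounded; this changes
  -- nothing almost surely.
  have h1 := hrev (fun x => if |x| ≤ M then Real.exp (-(β₀ * x / 2)) * Real.sin (θ * x) else 0)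
    (Measurable.ite (measurableSet_le (by fun_prop) (by fun_prop)) (by fun_prop) (by fun_prop))
    ⟨Real.exp (|β₀| * |M| / 2), fun x => by
      split_ifs with hx
      · rw [abs_mul, Real.abs_exp]
        refine (mul_le_of_le_one_right (Real.exp_pos _).le (Real.abs_sin_le_one _)).trans ?_
        rw [Real.exp_le_exp]
        have h2 := neg_abs_le (β₀ * x)
        rw [abs_mul] at h2
        have h3 : |β₀| * |x| ≤ |β₀| * |M| :=
          mul_le_mul_of_nonneg_left (hx.trans (le_abs_self M)) (abs_nonneg _)
        linarith
      · simpa using (Real.exp_pos _).le⟩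
  have h2 : ∫ x, Real.exp (β₀ * x) * (if |x| ≤ M then
      Real.exp (-(β₀ * x / 2)) * Real.sin (θ * x) else 0) ∂μ
      = ∫ x, Real.exp (β₀ * x / 2) * Real.sin (θ * x) ∂μ := by
    refine integral_congr_ae ?_
    filter_upwards [hM] with x hx
    rw [if_pos hx, ← mul_assoc, ← Real.exp_add]
    congr 2
    ring
  have h3 : ∫ x, (if |-x| ≤ M then
      Real.exp (-(β₀ * -x / 2)) * Real.sin (θ * -x) else 0) ∂μ
      = -∫ x, Real.exp (β₀ * x / 2) * Real.sin (θ * x) ∂μ := by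
    rw [← integral_neg]
    refine integral_congr_ae ?_
    filter_upwards [hM] with x hx
    rw [if_pos (by rwa [abs_neg]), mul_neg θ, Real.sin_neg, mul_neg]
    congr 3
    ring
  rw [h2, h3] at h1
  linarith

theorem integrable_of_bounded {α : Type*} [MeasurableSpace α] {μ : Measure α} [IsFiniteMeasure μ]
    {f : α → ℝ} (hf : Measurable f) {C : ℝ} (hC : ∀ᵐ x ∂μ, |f x| ≤ C) : Integrable f μ :=
  Integrable.of_bound hf.aestronglyMeasurable C hC

theorem integrable_exp_mul {μ : Measure ℝ} [IsProbabilityMeasure μ] {M : ℝ}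
    (hM : ∀ᵐ x ∂μ, |x| ≤ M) (t : ℝ) : Integrable (fun x => Real.exp (t * x)) μ := by
  refine integrable_of_bounded (by fun_prop) (C := Real.exp (|t| * M)) ?_
  filter_upwards [hM] with x hx
  rw [Real.abs_exp, Real.exp_le_exp]
  calc t * x ≤ |t * x| := le_abs_self _
    _ = |t| * |x| := abs_mul _ _
    _ ≤ _ := mul_le_mul_of_nonneg_left hx (abs_nonneg _)

/-- A function supported in a strip which is strictly subharmonic there for the mean kernel of
the branching random walk. -/
structure StripFunction (b : ℕ) (μ : Measure ℝ) where
  /-- the half-width of the strip -/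
  width : ℝ
  /-- the expansion factor -/
  rate : ℝ
  /-- the function -/
  toFun : ℝ → ℝ
  /-- an upper bound of the function -/
  bound : ℝ
  width_pos : 0 < width
  one_lt_rate : 1 < rate
  measurable : Measurable toFun
  nonneg : ∀ s, 0 ≤ toFun s
  eq_zero : ∀ s, width < |s| → toFun s = 0
  le_bound : ∀ s, toFun s ≤ bound
  zero_pos : 0 < toFun 0
  subharmonic : ∀ s, |s| ≤ width → rate * toFun s ≤ b * ∫ x, toFun (s + x) ∂μ

/-- With θ = π / (2A), expand cos(θ(s + x)): the sine term integrates to zero by symmetry. What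
remains is at least Z cos(θ M) times the value at s, where Z = E[exp(β₀ X / 2)]. Since (d - 1) Z >
1, a wide enough strip makes (d - 1) Z cos(θ M) > 1, and this number is the expansion factor. -/
theorem exists_stripFunction {d : ℕ} (hd : 3 ≤ d) (μ : Measure ℝ) [IsProbabilityMeasure μ]
    (hXS : EssBounded μ) {β₀ : ℝ} (hβ₀ : 0 < β₀) (hXR : ReversibleAt μ β₀)
    (hXM : ∃ c > 0, ∀ β : ℝ, 0 ≤ β → c ≤ logLaplace d μ β) :
    Nonempty (StripFunction (d - 1) μ) := by
  obtain ⟨M₀, hM₀⟩ := hXS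
  obtain ⟨M, hM1, hM⟩ : ∃ M : ℝ, 1 ≤ M ∧ ∀ᵐ x ∂μ, |x| ≤ M :=
    ⟨max M₀ 1, le_max_right _ _, hM₀.mono fun x hx => hx.trans (le_max_left _ _)⟩
  obtain ⟨c, hc, hΛ⟩ := hXM
  have hb : (((d - 1 : ℕ) : ℝ)) = (d : ℝ) - 1 := by
    rw [Nat.cast_sub (by omega)]; simp
  have hb0 : (0 : ℝ) < ((d - 1 : ℕ) : ℝ) := by
    have : 0 < d - 1 := by omega
    exact_mod_cast this
  set Z := ∫ x, Real.exp (β₀ * x / 2) ∂μ with hZ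
  have hint : Integrable (fun x => Real.exp (β₀ * x / 2)) μ := by
    have := integrable_exp_mul hM (β₀ / 2)
    refine this.congr (Filter.Eventually.of_forall fun x => ?_)
    simp only
    congr 1
    ring
  have hZpos : 0 < Z := integral_exp_pos hint
  have hZ1 : 1 < ((d - 1 : ℕ) : ℝ) * Z := by
    -- Positivity of Λ at the symmetry point β₀ / 2 means (d - 1) Z > 1.
    have h1 := hΛ (β₀ / 2) (by positivity)
    have h2 : ∫ x, Real.exp (β₀ / 2 * x) ∂μ = Z := by
      rw [hZ]
      congr 1
      ext x
      congr 1
      ring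
    rw [logLaplace, h2, ← hb, ← Real.log_mul hZpos.ne' hb0.ne', mul_comm Z] at h1
    by_contra hle
    have := Real.log_nonpos (by positivity) (not_lt.1 hle)
    linarith
  have hlim : Filter.Tendsto (fun A : ℝ => ((d - 1 : ℕ) : ℝ) * Z * Real.cos (Real.pi / 2 * M / A))
      Filter.atTop (nhds (((d - 1 : ℕ) : ℝ) * Z)) := by
    have h1 : Filter.Tendsto (fun A : ℝ => Real.pi / 2 * M / A) Filter.atTop (nhds 0) :=
      Filter.Tendsto.div_atTop tendsto_const_nhds Filter.tendsto_id
    have h2 := ((Real.continuous_cos.tendsto 0).comp h1).const_mul (((d - 1 : ℕ) : ℝ) * Z)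
    simpa using h2
  obtain ⟨A, hA1, hAM⟩ := ((hlim.eventually (lt_mem_nhds hZ1)).and
    (Filter.eventually_ge_atTop M)).exists
  have hA0 : 0 < A := by linarith
  set θ := Real.pi / 2 / A with hθ
  have hθ0 : 0 < θ := by positivity
  have hθA : θ * A = Real.pi / 2 := by rw [hθ]; field_simp
  have hθM : Real.pi / 2 * M / A = θ * M := by rw [hθ]; ring
  rw [hθM] at hA1
  set C := Real.exp (β₀ * A / 2)
  let f : ℝ → ℝ := fun s => if |s| ≤ A then Real.exp (β₀ * s / 2) * Real.cos (θ * s) else 0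
  have hcos : ∀ s, |s| ≤ A → 0 ≤ Real.cos (θ * s) := by
    intro s hs
    have h1 := abs_le.1 hs
    refine Real.cos_nonneg_of_neg_pi_div_two_le_of_le ?_ ?_ <;> rw [← hθA] <;> nlinarith
  have hf0 : ∀ s, 0 ≤ f s := by
    intro s
    simp only [f]
    split_ifs with hs
    · exact mul_nonneg (Real.exp_pos _).le (hcos s hs)
    · exact le_rfl
  have hfC : ∀ s, f s ≤ C := by
    intro s
    simp only [f]
    split_ifs with hs
    · refine (mul_le_of_le_one_right (Real.exp_pos _).le (Real.cos_le_one _)).trans ?_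
      rw [Real.exp_le_exp]
      have := (abs_le.1 hs).2
      nlinarith
    · exact (Real.exp_pos _).le
  have hfm : Measurable f :=
    Measurable.ite (measurableSet_le (by fun_prop) (by fun_prop)) (by fun_prop) (by fun_prop)
  refine ⟨⟨A, _, f, C, hA0, hA1, hfm, hf0, fun s hs => if_neg (not_le.2 hs), hfC, ?_, ?_⟩⟩
  · simp [f, hA0.le]
  intro s hs
  have hintcos : Integrable (fun x => Real.exp (β₀ * x / 2) * Real.cos (θ * x)) μ :=
    hint.mul_bdd (c := 1) (Measurable.aestronglyMeasurable (by fun_prop)) (Filter.Eventually.of_forall fun x => Real.abs_cos_le_one _)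
  have hintsin : Integrable (fun x => Real.exp (β₀ * x / 2) * Real.sin (θ * x)) μ :=
    hint.mul_bdd (c := 1) (Measurable.aestronglyMeasurable (by fun_prop)) (Filter.Eventually.of_forall fun x => Real.abs_sin_le_one _)
  have h1 : ∀ᵐ x ∂μ, Real.exp (β₀ * s / 2) * Real.cos (θ * s) *
        (Real.exp (β₀ * x / 2) * Real.cos (θ * x))
      - Real.exp (β₀ * s / 2) * Real.sin (θ * s) * (Real.exp (β₀ * x / 2) * Real.sin (θ * x))
      ≤ f (s + x) := by
    filter_upwards [hM] with x hx
    have h2 : Real.exp (β₀ * s / 2) * Real.cos (θ * s) *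
        (Real.exp (β₀ * x / 2) * Real.cos (θ * x))
      - Real.exp (β₀ * s / 2) * Real.sin (θ * s) * (Real.exp (β₀ * x / 2) * Real.sin (θ * x))
      = Real.exp (β₀ * (s + x) / 2) * Real.cos (θ * (s + x)) := by
      rw [mul_add θ, Real.cos_add, mul_add β₀, add_div, Real.exp_add]
      ring
    rw [h2]
    simp only [f]
    split_ifs with hsx
    · exact le_rfl
    · refine mul_nonpos_of_nonneg_of_nonpos (Real.exp_pos _).le ?_
      -- One jump leads from the strip to at most 2A ≥ A + M, where the angle lies between π/2 and
      -- π: the cosine is nonpositive there, so replacing it by zero only increases the integral.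
      have h3 : |s + x| ≤ 2 * A := (abs_add_le s x).trans (by linarith)
      rw [← Real.cos_abs, abs_mul, abs_of_pos hθ0]
      refine Real.cos_nonpos_of_pi_div_two_le_of_le ?_ ?_
      · rw [← hθA]
        exact mul_le_mul_of_nonneg_left (not_le.1 hsx).le hθ0.le
      · nlinarith [Real.pi_pos]
  have h4 := integral_mono_ae ((hintcos.const_mul _).sub (hintsin.const_mul _))
    (integrable_of_bounded (μ := μ) (hfm.comp (measurable_const_add s)) (C := C)
      (Filter.Eventually.of_forall fun x => by
        simpa [abs_of_nonneg (hf0 _)] using hfC (s + x))) h1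
  simp only [Pi.sub_apply, Function.comp_def] at h4
  rw [integral_sub (hintcos.const_mul _) (hintsin.const_mul _), integral_const_mul,
    integral_const_mul, hXR.integral_sin_eq_zero hM, mul_zero, sub_zero] at h4
  have h5 : Z * Real.cos (θ * M) ≤ ∫ x, Real.exp (β₀ * x / 2) * Real.cos (θ * x) ∂μ := by
    rw [hZ, ← integral_mul_const]
    refine integral_mono_ae (hint.mul_const _) hintcos ?_
    filter_upwards [hM] with x hx
    refine mul_le_mul_of_nonneg_left ?_ (Real.exp_pos _).le
    rw [← Real.cos_abs (θ * x), abs_mul, abs_of_pos hθ0]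
    refine Real.cos_le_cos_of_nonneg_of_le_pi (by positivity) ?_
      (mul_le_mul_of_nonneg_left hx hθ0.le)
    have : θ * M ≤ θ * A := mul_le_mul_of_nonneg_left hAM hθ0.le
    linarith [Real.pi_pos]
  have h6 : f s = Real.exp (β₀ * s / 2) * Real.cos (θ * s) := if_pos hs
  calc ((d - 1 : ℕ) : ℝ) * Z * Real.cos (θ * M) * f s
      = ((d - 1 : ℕ) : ℝ) * (f s * (Z * Real.cos (θ * M))) := by ring
    _ ≤ ((d - 1 : ℕ) : ℝ) * (f s * ∫ x, Real.exp (β₀ * x / 2) * Real.cos (θ * x) ∂μ) := by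
      gcongr
      exact hf0 s
    _ ≤ _ := by
      rw [h6]
      exact mul_le_mul_of_nonneg_left h4 hb0.le

/-! ### Uniform lower bound on the escape weights -/

theorem one_sub_sum_le_prod_one_sub {ι : Type*} (s : Finset ι) {a : ι → ℝ}
    (h0 : ∀ i ∈ s, 0 ≤ a i) (h1 : ∀ i ∈ s, a i ≤ 1) :
    1 - ∑ i ∈ s, a i ≤ ∏ i ∈ s, (1 - a i) := by
  classical
  induction s using Finset.induction_on with
  | empty => simp
  | insert i s hi ih =>
    rw [Finset.sum_insert hi, Finset.prod_insert hi]
    have h2 := ih (fun j hj => h0 j (Finset.mem_insert_of_mem hj))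
      (fun j hj => h1 j (Finset.mem_insert_of_mem hj))
    have h3 := h0 i (Finset.mem_insert_self _ _)
    have h4 := h1 i (Finset.mem_insert_self _ _)
    have h5 : ∏ j ∈ s, (1 - a j) ≤ 1 :=
      Finset.prod_le_one (fun j hj => by linarith [h1 j (Finset.mem_insert_of_mem hj)])
        (fun j hj => by linarith [h0 j (Finset.mem_insert_of_mem hj)])
    nlinarith

/-- Bernoulli applied to (1 + u)^n, together with (1 - u)^n (1 + u)^n ≤ 1, linearises the survival
probability from below. The loss 1 + nC is close to 1 when u ranges over small values. -/
theorem one_sub_pow_le (n : ℕ) {u y C : ℝ} (hu : 0 ≤ u) (huC : u ≤ C) (huy : u ≤ y) (hy : y ≤ 1) :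
    n * u / (1 + n * C) ≤ 1 - (1 - y) ^ n := by
  have h1 : (1 - y) ^ n ≤ (1 - u) ^ n := pow_le_pow_left₀ (by linarith) (by linarith) n
  have h2 := one_add_mul_le_pow (show (-2 : ℝ) ≤ u by linarith) n
  have h3 : (1 - u) ^ n * (1 + u) ^ n ≤ 1 := by
    rw [← mul_pow]
    exact pow_le_one₀ (by nlinarith) (by nlinarith)
  have h4 : 0 ≤ (1 - u) ^ n := pow_nonneg (by linarith) n
  have hn : (0 : ℝ) ≤ n := n.cast_nonneg
  have h5 : (1 - u) ^ n ≤ 1 / (1 + n * u) := by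
    rw [le_div_iff₀ (by positivity)]
    nlinarith
  have h6 : n * u / (1 + n * C) ≤ n * u / (1 + n * u) :=
    div_le_div_of_nonneg_left (by positivity) (by positivity) (by nlinarith)
  have h7 : n * u / (1 + n * u) = 1 - 1 / (1 + n * u) := by
    have : (1 + n * u) ≠ 0 := by positivity
    field_simp
    ring
  linarith

section Strip

variable {b d : ℕ} (h : AcceptanceFunction) (β₀ β A κ : ℝ)

/-- The truncated escape weight of a tree hanging from a vertex of potential `s`, set to zero
when its root is outside the strip. -/
noncomputable def stripEscape (d n : ℕ) (s : ℝ) (ξ : Marks b) : ℝ :=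
  if |s + ξ []| ≤ A then min 1 (Real.exp ((β₀ + β) * s) * escapeUpTo h β₀ β d n ξ / κ) else 0

variable {h β₀ β A κ}

theorem stripEscape_nonneg (hκ : 0 < κ) (n : ℕ) (s : ℝ) (ξ : Marks b) :
    0 ≤ stripEscape h β₀ β A κ d n s ξ := by
  unfold stripEscape
  split_ifs
  · exact le_min zero_le_one
      (div_nonneg (mul_nonneg (Real.exp_pos _).le (escapeUpTo_nonneg n ξ)) hκ.le)
  · exact le_rfl

theorem stripEscape_le_one (n : ℕ) (s : ℝ) (ξ : Marks b) :
    stripEscape h β₀ β A κ d n s ξ ≤ 1 := by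
  unfold stripEscape
  split_ifs
  · exact min_le_left _ _
  · exact zero_le_one

theorem stripEscape_mul_le (hκ : 0 < κ) (n : ℕ) (s : ℝ) (ξ : Marks b) :
    κ * stripEscape h β₀ β A κ d n s ξ ≤ Real.exp ((β₀ + β) * s) * escapeUpTo h β₀ β d n ξ := by
  have h1 : stripEscape h β₀ β A κ d n s ξ
      ≤ Real.exp ((β₀ + β) * s) * escapeUpTo h β₀ β d n ξ / κ := by
    unfold stripEscape
    split_ifs
    · exact min_le_right _ _
    · exact div_nonneg (mul_nonneg (Real.exp_pos _).le (escapeUpTo_nonneg n ξ)) hκ.le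
  rwa [le_div_iff₀ hκ, mul_comm] at h1

theorem measurable_stripEscape (n : ℕ) :
    Measurable fun p : ℝ × Marks b => stripEscape h β₀ β A κ d n p.1 p.2 := by
  have h0 : Measurable fun p : ℝ × Marks b => p.2 [] :=
    (measurable_pi_apply _).comp measurable_snd
  have h1 : Measurable fun p : ℝ × Marks b => escapeUpTo h β₀ β d n p.2 :=
    (measurable_escapeUpTo n).comp measurable_snd
  unfold stripEscape
  exact Measurable.ite (measurableSet_le (by fun_prop) (by fun_prop)) (by fun_prop) (by fun_prop)

theorem measurable_stripEscape_right (n : ℕ) (s : ℝ) :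
    Measurable (stripEscape h β₀ β A κ d n s : Marks b → ℝ) :=
  (measurable_stripEscape n).comp measurable_prodMk_left

/-- Multiplied by exp((β₀ + β) s), the jump probabilities become symmetric conductances. In the
strip the conductance of the upper edge is at least c exp(-A' A). A weight of at most κ in series
with it loses at most the factor r when κ is small compared to this bound. The right-hand side thus
obeys the recursion of a survival probability thinned by r. -/
theorem le_stripEscape_succ (hd : 0 < d) {c r A' : ℝ} (hκ : 0 < κ) (hr : 0 < r) (hr1 : r ≤ 1)
    (hA' : |β₀ + β| ≤ A') (hκc : κ * Real.exp (A' * A) ≤ c * (1 / r - 1)) (n : ℕ) {s : ℝ}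
    {ξ : Marks b} (hs : |s + ξ []| ≤ A) (hc : c ≤ jumpProb h β₀ β d (-ξ [])) :
    r * (1 - ∏ i, (1 - stripEscape h β₀ β A κ d n (s + ξ []) (shift i ξ)))
      ≤ stripEscape h β₀ β A κ d (n + 1) s ξ := by
  set a : Fin b → ℝ := fun i => stripEscape h β₀ β A κ d n (s + ξ []) (shift i ξ) with ha
  have ha0 : ∀ i, 0 ≤ a i := fun i => stripEscape_nonneg hκ n _ _
  have ha1 : ∀ i, a i ≤ 1 := fun i => stripEscape_le_one n _ _
  set q := 1 - ∏ i, (1 - a i) with hq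
  have hq0 : 0 ≤ q := by
    have := Finset.prod_le_one (s := Finset.univ) (f := fun i => 1 - a i)
      (fun i _ => by linarith [ha1 i]) (fun i _ => by linarith [ha0 i])
    linarith
  have hq1 : q ≤ 1 := by
    have := Finset.prod_nonneg (s := Finset.univ) (f := fun i => 1 - a i)
      (fun i _ => by linarith [ha1 i])
    linarith
  -- Union bound: the parallel weight of the children dominates the probability that one of
  -- independent events of probabilities `a i` occurs.
  have hqs : q ≤ ∑ i, a i := by
    have := one_sub_sum_le_prod_one_sub Finset.univ (a := a) (fun i _ => ha0 i) (fun i _ => ha1 i)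
    linarith
  set α := β₀ + β with hα
  set s' := s + ξ [] with hs'
  set B := ∑ i, escapeUpTo h β₀ β d n (shift i ξ) with hB
  have hB0 : 0 ≤ B := Finset.sum_nonneg fun i _ => escapeUpTo_nonneg _ _
  have hκB : κ * q ≤ Real.exp (α * s') * B := by
    calc κ * q ≤ κ * ∑ i, a i := mul_le_mul_of_nonneg_left hqs hκ.le
      _ = ∑ i, κ * a i := Finset.mul_sum _ _ _
      _ ≤ ∑ i, Real.exp (α * s') * escapeUpTo h β₀ β d n (shift i ξ) :=
        Finset.sum_le_sum fun i _ => stripEscape_mul_le hκ n _ _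
      _ = _ := (Finset.mul_sum _ _ _).symm
  have habs : |α * s'| ≤ A' * A := by
    rw [abs_mul]
    exact mul_le_mul hA' hs (abs_nonneg _) ((abs_nonneg _).trans hA')
  set p := jumpProb h β₀ β d (-ξ []) with hp
  have hp0 : 0 < p := jumpProb_pos h β₀ β hd _
  have hE := Real.exp_pos (α * s')
  have hE2 : Real.exp (-(A' * A)) ≤ Real.exp (α * s') :=
    Real.exp_le_exp.2 (abs_le.1 habs).1
  have hcancel : Real.exp (A' * A) * Real.exp (-(A' * A)) = 1 := by
    rw [← Real.exp_add]; simp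
  rw [stripEscape, if_pos hs]
  refine le_min (by nlinarith) ?_
  rw [le_div_iff₀ hκ]
  -- Detailed balance moves the reference potential from s to s' = s + ξ [].
  have hkey : Real.exp (α * s) * escapeUpTo h β₀ β d (n + 1) ξ
      = Real.exp (α * s') * B * (p / (p + B)) := by
    rw [escapeUpTo, series, jumpProb_eq_exp_mul_neg, hs', mul_add, Real.exp_add]
    ring
  rw [hkey]
  have hpB : 0 < p + B := by linarith
  rw [mul_div_assoc', le_div_iff₀ hpB]
  have hr2 : κ * Real.exp (A' * A) ≤ p * (1 / r - 1) :=
    hκc.trans (mul_le_mul_of_nonneg_right hc (by rw [sub_nonneg, one_le_div hr]; exact hr1))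
  have hr3 : r * (κ * Real.exp (A' * A)) ≤ p * (1 - r) := by
    have := mul_le_mul_of_nonneg_left hr2 hr.le
    have h2 : r * (p * (1 / r - 1)) = p * (1 - r) := by field_simp
    linarith
  have hr4 : r * κ ≤ p * (1 - r) * Real.exp (α * s') := by
    have h1 : 0 ≤ p * (1 - r) := mul_nonneg hp0.le (by linarith)
    calc r * κ = r * (κ * Real.exp (A' * A)) * Real.exp (-(A' * A)) := by
          rw [mul_assoc, mul_assoc, hcancel, mul_one]
      _ ≤ p * (1 - r) * Real.exp (-(A' * A)) :=
          mul_le_mul_of_nonneg_right hr3 (Real.exp_pos _).le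
      _ ≤ _ := mul_le_mul_of_nonneg_left hE2 h1
  have h5 : r * κ * q * B ≤ p * (1 - r) * Real.exp (α * s') * B := by
    calc r * κ * q * B ≤ r * κ * 1 * B := by gcongr
      _ ≤ _ := by
        rw [mul_one]
        exact mul_le_mul_of_nonneg_right hr4 hB0
  have h6 : r * p * (κ * q) ≤ r * p * (Real.exp (α * s') * B) :=
    mul_le_mul_of_nonneg_left hκB (by positivity)
  nlinarith

/-- Start of the recursion: κ is below every conductance in the strip, so the truncation at 1 is
attained. -/
theorem exp_mul_le_of_strip {c A' : ℝ} (hκ : 0 < κ)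
    (hA' : |β₀ + β| ≤ A') (hκc : κ * Real.exp (A' * A) ≤ c) {s : ℝ}
    {ξ : Marks b} (hs : |s + ξ []| ≤ A) (hc : c ≤ jumpProb h β₀ β d (-ξ [])) :
    stripEscape h β₀ β A κ d 0 s ξ = 1 := by
  rw [stripEscape, if_pos hs]
  refine min_eq_left ?_
  rw [one_le_div hκ, escapeUpTo, jumpProb_eq_exp_mul_neg, ← mul_assoc, ← Real.exp_add, ← mul_add]
  have habs : |(β₀ + β) * (s + ξ [])| ≤ A' * A := by
    rw [abs_mul]
    exact mul_le_mul hA' hs (abs_nonneg _) ((abs_nonneg _).trans hA')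
  have hE2 : Real.exp (-(A' * A)) ≤ Real.exp ((β₀ + β) * (s + ξ [])) :=
    Real.exp_le_exp.2 (abs_le.1 habs).1
  have hcancel : Real.exp (A' * A) * Real.exp (-(A' * A)) = 1 := by
    rw [← Real.exp_add]; simp
  have hc0 : 0 < c := lt_of_lt_of_le (by positivity) hκc
  calc κ = κ * Real.exp (A' * A) * Real.exp (-(A' * A)) := by rw [mul_assoc, hcancel, mul_one]
    _ ≤ c * Real.exp (-(A' * A)) := mul_le_mul_of_nonneg_right hκc (Real.exp_pos _).le
    _ ≤ jumpProb h β₀ β d (-ξ []) * Real.exp ((β₀ + β) * (s + ξ [])) :=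
      mul_le_mul hc hE2 (Real.exp_pos _).le (hc0.le.trans hc)
    _ = _ := mul_comm _ _

/-- Expectation of the pathwise recursion: given the mark at the root, the b subtrees are i.i.d., so
the product becomes a b-th power. -/
theorem integral_stripEscape_succ_ge (hd : 0 < d) {μ : Measure ℝ} [IsProbabilityMeasure μ]
    {c r A' M : ℝ} (hM : ∀ᵐ x ∂μ, |x| ≤ M) (hκ : 0 < κ) (hr : 0 < r) (hr1 : r ≤ 1)
    (hA' : |β₀ + β| ≤ A') (hκc : κ * Real.exp (A' * A) ≤ c * (1 / r - 1))
    (hc : ∀ x, |x| ≤ M → c ≤ jumpProb h β₀ β d x) (n : ℕ) (s : ℝ) :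
    ∫ x, (if |s + x| ≤ A then
        r * (1 - (1 - ∫ ξ, stripEscape h β₀ β A κ d n (s + x) ξ ∂marksLaw b μ) ^ b) else 0) ∂μ
      ≤ ∫ ξ, stripEscape h β₀ β A κ d (n + 1) s ξ ∂marksLaw b μ := by
  let G : ℝ × (Fin b → Marks b) → ℝ := fun p => if |s + p.1| ≤ A then
    r * (1 - ∏ i, (1 - stripEscape h β₀ β A κ d n (s + p.1) (p.2 i))) else 0
  have hGm : Measurable G := by
    refine Measurable.ite (measurableSet_le (by fun_prop) (by fun_prop)) ?_ measurable_const
    refine (measurable_const.sub (Finset.measurable_prod _ fun i _ =>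
      measurable_const.sub ?_)).const_mul r
    exact (measurable_stripEscape n).comp (by fun_prop :
      Measurable fun p : ℝ × (Fin b → Marks b) => (s + p.1, p.2 i))
  have H0 : ∀ s (ξ : Marks b), 0 ≤ stripEscape h β₀ β A κ d n s ξ :=
    fun s ξ => stripEscape_nonneg hκ n s ξ
  have H1 : ∀ s (ξ : Marks b), stripEscape h β₀ β A κ d n s ξ ≤ 1 :=
    fun s ξ => stripEscape_le_one n s ξ
  have hG1 : ∀ p, |G p| ≤ r := by
    intro p
    simp only [G]
    have h1 := Finset.prod_le_one (s := Finset.univ)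
      (f := fun i => 1 - stripEscape h β₀ β A κ d n (s + p.1) (p.2 i))
      (fun i _ => by linarith [H1 (s + p.1) (p.2 i)]) (fun i _ => by linarith [H0 (s + p.1) (p.2 i)])
    have h2 := Finset.prod_nonneg (s := Finset.univ)
      (f := fun i => 1 - stripEscape h β₀ β A κ d n (s + p.1) (p.2 i))
      (fun i _ => by linarith [H1 (s + p.1) (p.2 i)])
    split_ifs
    · rw [abs_of_nonneg (mul_nonneg hr.le (by linarith))]
      exact mul_le_of_le_one_right hr.le (by linarith)
    · simpa using hr.le
  have hint : Integrable G (μ.prod (Measure.pi fun _ : Fin b => marksLaw b μ)) :=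
    integrable_of_bounded hGm (Filter.Eventually.of_forall hG1)
  have hmap : Measurable fun ξ : Marks b => (ξ [], fun i => shift i ξ) :=
    (measurable_pi_apply _).prodMk (by fun_prop)
  have h1 : ∫ ξ, G (ξ [], fun i => shift i ξ) ∂marksLaw b μ
      = ∫ x, (if |s + x| ≤ A then
        r * (1 - (1 - ∫ ξ, stripEscape h β₀ β A κ d n (s + x) ξ ∂marksLaw b μ) ^ b) else 0) ∂μ := by
    rw [← integral_map (φ := fun ξ : Marks b => (ξ [], fun i => shift i ξ)) hmap.aemeasurable
      hGm.aestronglyMeasurable, map_root_shifts, integral_prod _ hint]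
    refine integral_congr_ae (Filter.Eventually.of_forall fun x => ?_)
    simp only [G]
    split_ifs with hx
    · have hm : Measurable fun ξ : Marks b => 1 - stripEscape h β₀ β A κ d n (s + x) ξ :=
        measurable_const.sub (measurable_stripEscape_right n (s + x))
      have hstrip : Integrable (fun ξ : Marks b => stripEscape h β₀ β A κ d n (s + x) ξ)
          (marksLaw b μ) := integrable_of_bounded (measurable_stripEscape_right n (s + x)) (C := 1)
            (Filter.Eventually.of_forall fun ξ => by
              rw [abs_of_nonneg (stripEscape_nonneg hκ n _ _)]
              exact stripEscape_le_one n _ _)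
      rw [integral_const_mul, integral_sub (integrable_const 1), integral_const,
        integral_fintype_prod_eq_pow (ι := Fin b)
          (fun ξ : Marks b => 1 - stripEscape h β₀ β A κ d n (s + x) ξ),
        integral_sub (integrable_const 1) hstrip, integral_const]
      · simp
      · refine integrable_of_bounded (C := 1) (Finset.measurable_prod _ fun i _ =>
          hm.comp (measurable_pi_apply i)) (Filter.Eventually.of_forall fun ζ => ?_)
        rw [Finset.abs_prod]
        refine Finset.prod_le_one (fun i _ => abs_nonneg _) fun i _ => ?_
        rw [abs_le]
        constructor <;> linarith [H1 (s + x) (ζ i), H0 (s + x) (ζ i)]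
    · simp
  rw [← h1]
  refine integral_mono_ae (integrable_of_bounded (hGm.comp hmap)
    (Filter.Eventually.of_forall fun ξ => hG1 _))
    (integrable_of_bounded (measurable_stripEscape_right (n + 1) s) (C := 1)
      (Filter.Eventually.of_forall fun ξ => by
        rw [abs_of_nonneg (stripEscape_nonneg hκ _ _ _)]
        exact stripEscape_le_one _ _ _)) ?_
  filter_upwards [ae_marks_bounded (b := b) hM] with ξ hξ
  simp only [G]
  split_ifs with hs
  · exact le_stripEscape_succ hd hκ hr hr1 hA' hκc n hs (hc _ (by rw [abs_neg]; exact hξ []))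
  · exact stripEscape_nonneg hκ _ _ _

/-- A small multiple of the strip function is a subsolution of the recursion for the mean. The gain
`f.rate` from subharmonicity pays for both losses, the thinning r and the nonlinearity 1 + b δ C,
where C is `f.bound`. The bound does not depend on the truncation depth n, so it survives the limit.
-/
theorem le_integral_stripEscape (hd : 0 < d) {μ : Measure ℝ} [IsProbabilityMeasure μ]
    (f : StripFunction b μ) {c r A' M δ : ℝ} (hM : ∀ᵐ x ∂μ, |x| ≤ M) (hκ : 0 < κ)
    (hr : 0 < r) (hr1 : r ≤ 1) (hA' : |β₀ + β| ≤ A')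
    (hκc : κ * Real.exp (A' * f.width) ≤ c * (1 / r - 1)) (hκc' : κ * Real.exp (A' * f.width) ≤ c)
    (hc : ∀ x, |x| ≤ M → c ≤ jumpProb h β₀ β d x) (hδ : 0 < δ) (hδ1 : δ * f.bound ≤ 1)
    (hδr : 1 + b * (δ * f.bound) ≤ r * f.rate) (n : ℕ) (s : ℝ) :
    δ * ∫ x, f.toFun (s + x) ∂μ
      ≤ ∫ ξ, stripEscape h β₀ β f.width κ d n s ξ ∂marksLaw b μ := by
  have hfint : ∀ s, Integrable (fun x => f.toFun (s + x)) μ := fun s =>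
    integrable_of_bounded (f.measurable.comp (measurable_const_add s)) (C := f.bound)
      (Filter.Eventually.of_forall fun x => by
        rw [abs_of_nonneg (f.nonneg _)]; exact f.le_bound _)
  have hsint : ∀ n s, Integrable (fun ξ => stripEscape h β₀ β f.width κ d n s ξ)
      (marksLaw b μ) := fun n s =>
    integrable_of_bounded (measurable_stripEscape_right n s) (C := 1)
      (Filter.Eventually.of_forall fun ξ => by
        rw [abs_of_nonneg (stripEscape_nonneg hκ n _ _)]
        exact stripEscape_le_one n _ _)
  have hy1 : ∀ n s, ∫ ξ, stripEscape h β₀ β f.width κ d n s ξ ∂marksLaw b μ ≤ 1 := by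
    intro n s
    have := integral_mono (hsint n s) (integrable_const 1) fun ξ => stripEscape_le_one n s ξ
    simpa using this
  induction n generalizing s with
  | zero =>
    have hm : Measurable fun ξ : Marks b => ξ [] := measurable_pi_apply _
    have h1 : ∫ x, f.toFun (s + x) ∂μ = ∫ ξ : Marks b, f.toFun (s + ξ []) ∂marksLaw b μ := by
      have : (marksLaw b μ).map (fun ξ : Marks b => ξ []) = μ :=
        Measure.infinitePi_map_eval (fun _ : List (Fin b) => μ) []
      have h2 := integral_map (μ := marksLaw b μ) hm.aemeasurable
        (f := fun x => f.toFun (s + x))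
        (f.measurable.comp (measurable_const_add s)).aestronglyMeasurable
      rw [← h2]
      congr 1
      exact this.symm
    rw [h1, ← integral_const_mul]
    refine integral_mono_ae ?_ (hsint 0 s) ?_
    · refine (integrable_of_bounded (f.measurable.comp (hm.const_add s)) (C := f.bound)
        (Filter.Eventually.of_forall fun ξ => ?_)).const_mul δ
      simp only [Function.comp_def]
      rw [abs_of_nonneg (f.nonneg _)]; exact f.le_bound _
    · filter_upwards [ae_marks_bounded (b := b) hM] with ξ hξ
      by_cases hs : |s + ξ []| ≤ f.width
      · rw [exp_mul_le_of_strip hκ hA' hκc' hs (hc _ (by rw [abs_neg]; exact hξ []))]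
        exact (mul_le_mul_of_nonneg_left (f.le_bound _) hδ.le).trans hδ1
      · rw [f.eq_zero _ (not_le.1 hs), mul_zero]
        exact stripEscape_nonneg hκ _ _ _
  | succ n ih =>
    refine le_trans ?_ (integral_stripEscape_succ_ge hd hM hκ hr hr1 hA' hκc hc n s)
    rw [← integral_const_mul]
    have hym : Measurable fun s => ∫ ξ, stripEscape h β₀ β f.width κ d n s ξ ∂marksLaw b μ :=
      ((measurable_stripEscape n).stronglyMeasurable.integral_prod_right).measurable
    refine integral_mono_of_nonneg (Filter.Eventually.of_forall fun x =>
      mul_nonneg hδ.le (f.nonneg _)) ?_ (Filter.Eventually.of_forall fun x => ?_)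
    · refine integrable_of_bounded (C := r) ?_ (Filter.Eventually.of_forall fun x => ?_)
      · exact Measurable.ite (measurableSet_le (by fun_prop) (by fun_prop))
          ((measurable_const.sub ((measurable_const.sub
            (hym.comp (measurable_const_add s))).pow_const b)).const_mul r) measurable_const
      · have h0 : 0 ≤ ∫ ξ, stripEscape h β₀ β f.width κ d n (s + x) ξ ∂marksLaw b μ :=
          integral_nonneg fun ξ => stripEscape_nonneg hκ _ _ _
        have h1 := hy1 n (s + x)
        have h2 : (1 - ∫ ξ, stripEscape h β₀ β f.width κ d n (s + x) ξ ∂marksLaw b μ) ^ b ≤ 1 :=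
          pow_le_one₀ (by linarith) (by linarith)
        have h3 : 0 ≤ (1 - ∫ ξ, stripEscape h β₀ β f.width κ d n (s + x) ξ ∂marksLaw b μ) ^ b :=
          pow_nonneg (by linarith) _
        split_ifs
        · rw [abs_of_nonneg (mul_nonneg hr.le (by linarith))]
          exact mul_le_of_le_one_right hr.le (by linarith)
        · simpa using hr.le
    · simp only
      split_ifs with hs
      · have hg0 : 0 ≤ ∫ x', f.toFun (s + x + x') ∂μ := integral_nonneg fun _ => f.nonneg _
        have hgC : ∫ x', f.toFun (s + x + x') ∂μ ≤ f.bound := by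
          have := integral_mono (hfint (s + x)) (integrable_const f.bound) fun y => f.le_bound _
          simpa using this
        have hC0 : 0 ≤ f.bound := (f.nonneg 0).trans (f.le_bound 0)
        have h1 := one_sub_pow_le b (mul_nonneg hδ.le hg0)
          (mul_le_mul_of_nonneg_left hgC hδ.le) (ih (s + x)) (hy1 n (s + x))
        refine le_trans ?_ (mul_le_mul_of_nonneg_left h1 hr.le)
        have hpos : 0 < 1 + b * (δ * f.bound) := by positivity
        rw [mul_div_assoc', le_div_iff₀ hpos]
        have h2 := f.subharmonic (s + x) hs
        have h3 := f.nonneg (s + x)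
        calc δ * f.toFun (s + x) * (1 + b * (δ * f.bound))
            ≤ δ * f.toFun (s + x) * (r * f.rate) := by gcongr
          _ = r * δ * (f.rate * f.toFun (s + x)) := by ring
          _ ≤ r * δ * (b * ∫ x', f.toFun (s + x + x') ∂μ) := by gcongr
          _ = _ := by ring
      · rw [f.eq_zero _ (not_le.1 hs), mul_zero]

end Strip

/-- The escape weight is bounded below with positive probability, uniformly in `β`. -/
theorem exists_measure_escape_lt_le {d : ℕ} (hd : 3 ≤ d) (μ : Measure ℝ) [IsProbabilityMeasure μ]
    (hXS : EssBounded μ) {β₀ : ℝ} (hβ₀ : 0 < β₀) (hXR : ReversibleAt μ β₀)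
    (hXM : ∃ c > 0, ∀ β : ℝ, 0 ≤ β → c ≤ logLaplace d μ β) (h : AcceptanceFunction) (K : ℝ) :
    ∃ y q : ℝ, 0 < y ∧ y ≤ 1 ∧ 0 < q ∧ q < 1 ∧ ∀ β, |β| ≤ K →
      marksLaw (d - 1) μ {ξ | escape h β₀ β d ξ < y} ≤ ENNReal.ofReal q := by
  obtain ⟨f⟩ := exists_stripFunction hd μ hXS hβ₀ hXR hXM
  obtain ⟨M, hM⟩ := hXS
  have hd0 : 0 < d := by omega
  set A' := β₀ + K with hA'
  obtain ⟨c, hc0, -, hc⟩ := exists_jumpProb_lower_bound h β₀ hd0 M A'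
  have hrate := f.one_lt_rate
  -- Any r strictly between 1 / rate and 1 would do: r rate = (rate + 1)/2 > 1 leaves the margin
  -- (rate - 1)/2 from which δ is chosen.
  set r := (1 + 1 / f.rate) / 2 with hr
  have hinv : 1 / f.rate < 1 := by rw [div_lt_one (by linarith)]; exact hrate
  have hinv0 : 0 < 1 / f.rate := by positivity
  have hr0 : 0 < r := by rw [hr]; linarith
  have hr1 : r < 1 := by rw [hr]; linarith
  have hrr : r * f.rate = (f.rate + 1) / 2 := by rw [hr]; field_simp
  have hC0 : 0 < f.bound := f.zero_pos.trans_le (f.le_bound 0)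
  have hb0 : (0 : ℝ) < ((d - 1 : ℕ) : ℝ) := by
    have : 0 < d - 1 := by omega
    exact_mod_cast this
  obtain ⟨δ, hδ0, hδ1, hδ2⟩ : ∃ δ : ℝ, 0 < δ ∧ δ * f.bound ≤ 1 ∧
      ((d - 1 : ℕ) : ℝ) * (δ * f.bound) ≤ (f.rate - 1) / 2 := by
    refine ⟨min (1 / f.bound) ((f.rate - 1) / 2 / (((d - 1 : ℕ) : ℝ) * f.bound)),
      lt_min (by positivity) (div_pos (by linarith) (by positivity)), ?_, ?_⟩
    · rw [← le_div_iff₀ hC0]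
      exact min_le_left _ _
    · have := min_le_right (1 / f.bound) ((f.rate - 1) / 2 / (((d - 1 : ℕ) : ℝ) * f.bound))
      rw [le_div_iff₀ (by positivity)] at this
      linarith
  obtain ⟨κ, hκ0, hκ1, hκ2, hκ3⟩ : ∃ κ : ℝ, 0 < κ ∧ κ * Real.exp (A' * f.width) ≤ c * (1 / r - 1) ∧
      κ * Real.exp (A' * f.width) ≤ c ∧ κ ≤ 1 := by
    have h1 : 0 < 1 / r - 1 := by rw [sub_pos, one_lt_div hr0]; exact hr1
    refine ⟨min (min (c * (1 / r - 1)) c / Real.exp (A' * f.width)) 1,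
      lt_min (div_pos (lt_min (by positivity) hc0) (Real.exp_pos _)) one_pos, ?_, ?_,
      min_le_right _ _⟩
    · rw [← le_div_iff₀ (Real.exp_pos _)]
      exact (min_le_left _ _).trans
        (div_le_div_of_nonneg_right (min_le_left _ _) (Real.exp_pos _).le)
    · rw [← le_div_iff₀ (Real.exp_pos _)]
      exact (min_le_left _ _).trans
        (div_le_div_of_nonneg_right (min_le_right _ _) (Real.exp_pos _).le)
  set x₀ := δ * ∫ x, f.toFun (0 + x) ∂μ with hx₀
  have hx₀pos : 0 < x₀ := by
    have h1 := f.subharmonic 0 (by simpa using f.width_pos.le)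
    have h2 : 0 < f.rate * f.toFun 0 := mul_pos (by linarith) f.zero_pos
    exact mul_pos hδ0 (pos_of_mul_pos_right (h2.trans_le h1) hb0.le)
  have hx₀1 : x₀ ≤ 1 := by
    refine le_trans ?_ hδ1
    refine mul_le_mul_of_nonneg_left ?_ hδ0.le
    have := integral_mono_of_nonneg (μ := μ) (f := fun x => f.toFun (0 + x))
      (Filter.Eventually.of_forall fun x => f.nonneg _) (integrable_const f.bound)
      (Filter.Eventually.of_forall fun x => f.le_bound _)
    simpa using this
  -- The variable min(1, escape/κ) is at most 1 and has mean at least x₀, hence is at least x₀ / 2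
  -- with probability at least x₀ / 2.
  refine ⟨κ * (x₀ / 2), 1 - x₀ / 2, by positivity, by nlinarith, by linarith, by linarith,
    fun β hβ => ?_⟩
  have hβ' : |β₀ + β| ≤ A' := by
    refine (abs_add_le _ _).trans ?_
    rw [abs_of_pos hβ₀]
    linarith
  have hE : ∀ n, x₀ ≤ ∫ ξ, min 1 (escapeUpTo h β₀ β d n ξ / κ) ∂marksLaw (d - 1) μ := by
    intro n
    refine (le_integral_stripEscape hd0 f hM hκ0 hr0 hr1.le hβ' hκ1 hκ2
      (fun x hx => hc β x hβ' hx) hδ0 hδ1 (by linarith) n 0).trans ?_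
    refine integral_mono_of_nonneg (Filter.Eventually.of_forall fun ξ =>
      stripEscape_nonneg hκ0 _ _ _) (integrable_of_bounded (C := 1)
        (measurable_const.min ((measurable_escapeUpTo n).div_const κ))
        (Filter.Eventually.of_forall fun ξ => ?_)) (Filter.Eventually.of_forall fun ξ => ?_)
    · rw [abs_of_nonneg (le_min zero_le_one (div_nonneg (escapeUpTo_nonneg n ξ) hκ0.le))]
      exact min_le_left _ _
    · simp only [stripEscape, mul_zero, Real.exp_zero, one_mul]
      split_ifs
      · exact le_rfl
      · exact le_min zero_le_one (div_nonneg (escapeUpTo_nonneg n ξ) hκ0.le)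
  have hlim : Filter.Tendsto
      (fun n => ∫ ξ, min 1 (escapeUpTo h β₀ β d n ξ / κ) ∂marksLaw (d - 1) μ) Filter.atTop
      (nhds (∫ ξ, min 1 (escape h β₀ β d ξ / κ) ∂marksLaw (d - 1) μ)) := by
    refine tendsto_integral_of_dominated_convergence (fun _ => 1)
      (fun n => (measurable_const.min
        ((measurable_escapeUpTo n).div_const κ)).aestronglyMeasurable)
      (integrable_const 1) (fun n => Filter.Eventually.of_forall fun ξ => ?_)
      (Filter.Eventually.of_forall fun ξ => ?_)
    · rw [Real.norm_eq_abs,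
        abs_of_nonneg (le_min zero_le_one (div_nonneg (escapeUpTo_nonneg n ξ) hκ0.le))]
      exact min_le_left _ _
    · exact tendsto_const_nhds.min ((tendsto_escapeUpTo hd0 ξ).div_const κ)
  have hx : x₀ ≤ ∫ ξ, min 1 (escape h β₀ β d ξ / κ) ∂marksLaw (d - 1) μ :=
    ge_of_tendsto' hlim hE
  set S := {ξ : Marks (d - 1) | escape h β₀ β d ξ < κ * (x₀ / 2)} with hS
  have hSm : MeasurableSet S := measurableSet_lt measurable_escape measurable_const
  have hle : ∫ ξ, min 1 (escape h β₀ β d ξ / κ) ∂marksLaw (d - 1) μ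
      ≤ ∫ ξ, (x₀ / 2 + Sᶜ.indicator (fun _ => (1 : ℝ)) ξ) ∂marksLaw (d - 1) μ := by
    refine integral_mono_of_nonneg (Filter.Eventually.of_forall fun ξ =>
      le_min zero_le_one (div_nonneg (escape_nonneg ξ) hκ0.le))
      ((integrable_const _).add ((integrable_const _).indicator hSm.compl))
      (Filter.Eventually.of_forall fun ξ => ?_)
    by_cases hξ : ξ ∈ S
    · have h1 : escape h β₀ β d ξ < κ * (x₀ / 2) := hξ
      simp only [Set.indicator_of_notMem (show ξ ∉ Sᶜ from fun hn => hn hξ), add_zero]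
      refine (min_le_right _ _).trans ?_
      rw [div_le_iff₀ hκ0]
      linarith
    · simp only [Set.indicator_of_mem (show ξ ∈ Sᶜ from hξ)]
      exact (min_le_left _ _).trans (by linarith)
  rw [integral_add (integrable_const _) ((integrable_const _).indicator hSm.compl),
    integral_indicator hSm.compl, setIntegral_const, integral_const] at hle
  simp only [probReal_univ, smul_eq_mul, one_mul, mul_one] at hle
  rw [probReal_compl_eq_one_sub hSm] at hle
  rw [← ofReal_measureReal (measure_ne_top _ _)]
  exact ENNReal.ofReal_le_ofReal (by linarith)

/-! ### Moments of the escape weights -/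

section Moments

variable {b d : ℕ} {h : AcceptanceFunction} {β₀ β : ℝ} {μ : Measure ℝ} [IsProbabilityMeasure μ]

/-- One level costs a factor c / 2 in the weight but squares the probability: a small weight forces
all b ≥ 2 independent subtrees to have a small weight. -/
theorem measure_escape_lt_pow_le (hd : 0 < d) (hb : 2 ≤ b) {M c y q : ℝ}
    (hM : ∀ᵐ x ∂μ, |x| ≤ M) (hc0 : 0 < c)
    (hc : ∀ x, |x| ≤ M → c ≤ jumpProb h β₀ β d x) (hq0 : 0 ≤ q)
    (hq : marksLaw b μ {ξ | escape h β₀ β d ξ < y} ≤ ENNReal.ofReal q) (k : ℕ) :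
    marksLaw b μ {ξ | escape h β₀ β d ξ < (c / 2) ^ k * y} ≤ ENNReal.ofReal (q ^ 2 ^ k) := by
  induction k with
  | zero => simpa using hq
  | succ k ih =>
    set S := {ξ : Marks b | escape h β₀ β d ξ < (c / 2) ^ k * y} with hS
    have hSm : MeasurableSet S := measurableSet_lt measurable_escape measurable_const
    have h1 : marksLaw b μ {ξ | escape h β₀ β d ξ < (c / 2) ^ (k + 1) * y}
        ≤ marksLaw b μ ((fun ξ i => shift i ξ) ⁻¹' (Set.univ.pi fun _ : Fin b => S)) := by
      refine measure_mono_ae ?_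
      filter_upwards [ae_marks_bounded (b := b) hM] with ξ hξ hlt i _
      have h2 := mul_escape_shift_le hd hc0 (hc _ (hξ [])) i
      have h3 : c / 2 * escape h β₀ β d (shift i ξ) < (c / 2) ^ (k + 1) * y := h2.trans_lt hlt
      rw [pow_succ', mul_assoc] at h3
      exact lt_of_mul_lt_mul_left h3 (by positivity)
    refine h1.trans ?_
    rw [← Measure.map_apply (by fun_prop) (MeasurableSet.univ_pi fun _ => hSm), map_shifts,
      Measure.pi_pi, Finset.prod_const, Finset.card_univ, Fintype.card_fin]
    calc marksLaw b μ S ^ b ≤ marksLaw b μ S ^ 2 := pow_le_pow_right_of_le_one' prob_le_one hb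
      _ ≤ ENNReal.ofReal (q ^ 2 ^ k) ^ 2 := by gcongr
      _ = _ := by rw [← ENNReal.ofReal_pow (by positivity), ← pow_mul, pow_succ]

theorem lintegral_le_measure_escape_add {f : Marks b → ℝ} {t v : ℝ} (hf1 : ∀ ξ, f ξ ≤ 1)
    (hfv : ∀ ξ, t ≤ escape h β₀ β d ξ → f ξ ≤ v) :
    ∫⁻ ξ, ENNReal.ofReal (f ξ) ∂marksLaw b μ
      ≤ marksLaw b μ {ξ | escape h β₀ β d ξ < t} + ENNReal.ofReal v := by
  have hSm : MeasurableSet {ξ : Marks b | escape h β₀ β d ξ < t} :=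
    measurableSet_lt measurable_escape measurable_const
  calc ∫⁻ ξ, ENNReal.ofReal (f ξ) ∂marksLaw b μ
      ≤ ∫⁻ ξ, ({ξ : Marks b | escape h β₀ β d ξ < t}.indicator 1 ξ + ENNReal.ofReal v)
          ∂marksLaw b μ := by
        refine lintegral_mono fun ξ => ?_
        by_cases hξ : escape h β₀ β d ξ < t
        · rw [Set.indicator_of_mem (show ξ ∈ {ξ : Marks b | escape h β₀ β d ξ < t} from hξ)]
          refine le_add_right ?_
          simpa using hf1 ξ
        · exact le_add_left (ENNReal.ofReal_le_ofReal (hfv ξ (not_lt.1 hξ)))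
    _ = _ := by
        rw [lintegral_add_right _ measurable_const, lintegral_indicator_one hSm]
        simp

theorem lintegral_one_sub_escape_le {y q : ℝ} (hy : 0 ≤ y) (hy1 : y ≤ 1) (hq0 : 0 ≤ q)
    (hq : marksLaw b μ {ξ | escape h β₀ β d ξ < y} ≤ ENNReal.ofReal q) :
    ∫⁻ ξ, ENNReal.ofReal (1 - escape h β₀ β d ξ) ∂marksLaw b μ
      ≤ ENNReal.ofReal (1 - y + y * q) := by
  have hSm : MeasurableSet {ξ : Marks b | escape h β₀ β d ξ < y} :=
    measurableSet_lt measurable_escape measurable_const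
  have hnn : ∀ ξ : Marks b, 0 ≤ escape h β₀ β d ξ := escape_nonneg
  calc ∫⁻ ξ, ENNReal.ofReal (1 - escape h β₀ β d ξ) ∂marksLaw b μ
      ≤ ∫⁻ ξ, (ENNReal.ofReal (1 - y) + {ξ : Marks b | escape h β₀ β d ξ < y}.indicator
          (fun _ => ENNReal.ofReal y) ξ) ∂marksLaw b μ := by
        refine lintegral_mono fun ξ => ?_
        by_cases hξ : escape h β₀ β d ξ < y
        · rw [Set.indicator_of_mem (show ξ ∈ {ξ : Marks b | escape h β₀ β d ξ < y} from hξ),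
            ← ENNReal.ofReal_add (by linarith) hy]
          exact ENNReal.ofReal_le_ofReal (by linarith [hnn ξ])
        · exact le_add_right (ENNReal.ofReal_le_ofReal (by linarith [not_lt.1 hξ]))
    _ = ENNReal.ofReal (1 - y) + ENNReal.ofReal y
          * marksLaw b μ {ξ : Marks b | escape h β₀ β d ξ < y} := by
        rw [lintegral_add_left measurable_const, lintegral_indicator_const hSm]
        simp
    _ ≤ ENNReal.ofReal (1 - y) + ENNReal.ofReal y * ENNReal.ofReal q := by gcongr
    _ = _ := by
        rw [← ENNReal.ofReal_mul hy, ← ENNReal.ofReal_add (by linarith) (by positivity)]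

/-- An upper bound for the `p`-th powers of the probabilities to backtrack over `s` levels, where
`σ` chooses a sibling of each vertex. -/
noncomputable def backtrackSum (h : AcceptanceFunction) (β₀ β : ℝ) (d p : ℕ) (σ : Fin b → Fin b) :
    ℕ → Marks b → ENNReal
  | 0, _ => 1
  | s + 1, ξ => ∑ i, ENNReal.ofReal ((1 / (1 + escape h β₀ β d (shift (σ i) ξ))) ^ p)
      * backtrackSum h β₀ β d p σ s (shift i ξ)

theorem measurable_one_div_pow (p : ℕ) :
    Measurable fun ξ : Marks b => ENNReal.ofReal ((1 / (1 + escape h β₀ β d ξ)) ^ p) := by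
  have := measurable_escape (b := b) (d := d) (h := h) (β₀ := β₀) (β := β)
  fun_prop

theorem measurable_backtrackSum (p : ℕ) (σ : Fin b → Fin b) (s : ℕ) :
    Measurable (backtrackSum h β₀ β d p σ s) := by
  induction s with
  | zero => exact measurable_const
  | succ s ih =>
    refine Finset.measurable_sum _ fun i _ => ?_
    exact ((measurable_one_div_pow p).comp (measurable_shift (σ i))).mul
      (ih.comp (measurable_shift i))

/-- The factor of a step to child i only reads the subtree of the sibling σ i, which is independent
of the subtree of i where the path continues. Hence the expectation factorises level by level. -/
theorem lintegral_backtrackSum (p : ℕ) {σ : Fin b → Fin b} (hσ : ∀ i, σ i ≠ i) (s : ℕ) :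
    ∫⁻ ξ, backtrackSum h β₀ β d p σ s ξ ∂marksLaw b μ
      = (b * ∫⁻ ξ, ENNReal.ofReal ((1 / (1 + escape h β₀ β d ξ)) ^ p) ∂marksLaw b μ) ^ s := by
  induction s with
  | zero => simp [backtrackSum]
  | succ s ih =>
    simp only [backtrackSum]
    have hm : ∀ i ∈ (Finset.univ : Finset (Fin b)), Measurable fun ξ : Marks b =>
        ENNReal.ofReal ((1 / (1 + escape h β₀ β d (shift (σ i) ξ))) ^ p)
          * backtrackSum h β₀ β d p σ s (shift i ξ) := fun i _ =>
      ((measurable_one_div_pow p).comp (measurable_shift (σ i))).mul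
        ((measurable_backtrackSum p σ s).comp (measurable_shift i))
    rw [lintegral_finsetSum _ hm, Finset.sum_congr rfl fun i _ => lintegral_shift_mul μ (hσ i)
      (measurable_one_div_pow p) (measurable_backtrackSum p σ s), ih]
    simp [pow_succ']
    ring

end Moments

/-- The estimates on the environment used below, with constants which do not depend on `β`. -/
structure EnvEstimates (d : ℕ) (μ : Measure ℝ) [IsProbabilityMeasure μ] (β₀ : ℝ)
    (h : AcceptanceFunction) (K : ℝ) where
  /-- a bound for the probability not to escape -/
  ρ : ℝ
  /-- the exponent of the tail of the inverse escape weight -/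
  a : ℝ
  /-- the rate of the tail of the inverse escape weight -/
  c : ℝ
  /-- the order of the moment of the backtracking probabilities -/
  p : ℕ
  ρ_pos : 0 < ρ
  ρ_lt_one : ρ < 1
  a_pos : 0 < a
  a_le_one : a ≤ 1
  c_pos : 0 < c
  p_pos : 0 < p
  lintegral_one_sub : ∀ β, |β| ≤ K →
    ∫⁻ ξ, ENNReal.ofReal (1 - escape h β₀ β d ξ) ∂marksLaw (d - 1) μ ≤ ENNReal.ofReal ρ
  lintegral_pow : ∀ β, |β| ≤ K → ∀ r : ℕ, 0 < r →
    ∫⁻ ξ, ENNReal.ofReal ((1 - escape h β₀ β d ξ) ^ r) ∂marksLaw (d - 1) μ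
      ≤ ENNReal.ofReal (2 * Real.exp (-(c * (r : ℝ) ^ a)))
  lintegral_backtrack : ∀ β, |β| ≤ K →
    ((d - 1 : ℕ) : ENNReal) * ∫⁻ ξ, ENNReal.ofReal ((1 / (1 + escape h β₀ β d ξ)) ^ p)
      ∂marksLaw (d - 1) μ ≤ ENNReal.ofReal (1 / 4)

/-- Balances two errors: after k levels the escape weight is only of order θ^k, while the
probability of a smaller one is exponentially small in 2^k. A number of levels k logarithmic in r
makes both r θ^k and 2^k at least of order r^a. -/
theorem exists_pow_le_and_le_pow {θ : ℝ} (hθ : 0 < θ) :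
    ∃ a : ℝ, 0 < a ∧ a ≤ 1 / 2 ∧ ∀ r : ℕ, 0 < r →
      ∃ k : ℕ, (r : ℝ) ^ a ≤ r * θ ^ k ∧ (r : ℝ) ^ a ≤ 2 * 2 ^ k := by
  obtain ⟨N, hN⟩ := exists_pow_lt_of_lt_one hθ (show (1 / 2 : ℝ) < 1 by norm_num)
  have hN' : (1 / 2 : ℝ) ^ (N + 1) ≤ θ :=
    (pow_le_pow_of_le_one (by norm_num) (by norm_num) (Nat.le_succ N)).trans hN.le
  set n := N + 1 with hn
  have hn1 : (1 : ℝ) ≤ n := by rw [hn]; push_cast; linarith [(Nat.cast_nonneg N : (0 : ℝ) ≤ N)]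
  -- With 2^(-n) ≤ θ and k the logarithm of r to base 4^n: r θ^k ≥ r / √r ≥ r^a, while r ≤
  -- 4^(n(k+1)) gives r^a ≤ 2^(k+1).
  refine ⟨1 / (2 * n), by positivity, ?_, fun r hr => ⟨Nat.log (2 ^ (2 * n)) r, ?_, ?_⟩⟩
  · exact one_div_le_one_div_of_le (by norm_num) (by linarith)
  all_goals
    set k := Nat.log (2 ^ (2 * n)) r with hk
    have hr1 : (1 : ℝ) ≤ r := by exact_mod_cast hr
  · have h1 : ((2 : ℝ) ^ (2 * n)) ^ k ≤ r := by
      exact_mod_cast Nat.pow_log_le_self (2 ^ (2 * n)) hr.ne'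
    have h2 : (r : ℝ) ^ (1 / (2 * n) : ℝ) ≤ (r : ℝ) ^ (1 / 2 : ℝ) :=
      Real.rpow_le_rpow_of_exponent_le hr1
        (one_div_le_one_div_of_le (by norm_num) (by linarith))
    refine h2.trans ?_
    have h3 : ((1 / 2 : ℝ) ^ n) ^ k ≤ θ ^ k := pow_le_pow_left₀ (by positivity) hN' k
    rw [← Real.sqrt_eq_rpow]
    have h4 : (2 : ℝ) ^ (n * k) ≤ Real.sqrt r := by
      refine Real.le_sqrt_of_sq_le ?_
      refine le_trans (le_of_eq ?_) h1
      rw [← pow_mul, ← pow_mul]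
      congr 1
      ring
    have h5 : ((1 / 2 : ℝ) ^ n) ^ k * 2 ^ (n * k) = 1 := by
      rw [← pow_mul, ← mul_pow]; norm_num
    have h6 : Real.sqrt r * Real.sqrt r = r := Real.mul_self_sqrt (by positivity)
    have h7 : 1 ≤ θ ^ k * Real.sqrt r := by
      rw [← h5]
      exact mul_le_mul h3 h4 (by positivity) (by positivity)
    calc Real.sqrt r = Real.sqrt r * 1 := (mul_one _).symm
      _ ≤ Real.sqrt r * (θ ^ k * Real.sqrt r) := by gcongr
      _ = Real.sqrt r * Real.sqrt r * θ ^ k := by ring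
      _ = _ := by rw [h6]
  · have hlt : 1 < 2 ^ (2 * n) := Nat.one_lt_two_pow (by omega)
    have h1 : (r : ℝ) ≤ ((2 : ℝ) ^ (2 * n)) ^ (k + 1) := by
      exact_mod_cast (Nat.lt_pow_succ_log_self hlt r).le
    have h2 : ((2 : ℝ) ^ (2 * n)) ^ (k + 1) = (2 ^ (k + 1)) ^ (2 * n) := by
      rw [← pow_mul, ← pow_mul, mul_comm]
    rw [h2] at h1
    have h3 := Real.rpow_le_rpow (by positivity) h1 (show 0 ≤ (1 / (2 * n) : ℝ) by positivity)
    have h4 : (1 / (2 * n) : ℝ) = ((2 * n : ℕ) : ℝ)⁻¹ := by push_cast; rw [one_div]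
    rw [h4, Real.pow_rpow_inv_natCast (by positivity) (by omega), pow_succ'] at h3
    rwa [h4]

theorem exists_envEstimates {d : ℕ} (hd : 3 ≤ d) (μ : Measure ℝ) [IsProbabilityMeasure μ]
    (hXS : EssBounded μ) {β₀ : ℝ} (hβ₀ : 0 < β₀) (hXR : ReversibleAt μ β₀)
    (hXM : ∃ c > 0, ∀ β : ℝ, 0 ≤ β → c ≤ logLaplace d μ β) (h : AcceptanceFunction) (K : ℝ) :
    Nonempty (EnvEstimates d μ β₀ h K) := by
  obtain ⟨y, q, hy0, hy1, hq0, hq1, hq⟩ := exists_measure_escape_lt_le hd μ hXS hβ₀ hXR hXM h K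
  obtain ⟨M, hM⟩ := hXS
  have hd0 : 0 < d := by omega
  have hb : 2 ≤ d - 1 := by omega
  obtain ⟨m, hm0, hm1, hm⟩ := exists_jumpProb_lower_bound h β₀ hd0 M (β₀ + K)
  have hK : ∀ β, |β| ≤ K → |β₀ + β| ≤ β₀ + K := fun β hβ =>
    (abs_add_le _ _).trans (by rw [abs_of_pos hβ₀]; linarith)
  have hpow : ∀ β, |β| ≤ K → ∀ k, marksLaw (d - 1) μ {ξ | escape h β₀ β d ξ < (m / 2) ^ k * y}
      ≤ ENNReal.ofReal (q ^ 2 ^ k) := fun β hβ k =>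
    measure_escape_lt_pow_le hd0 hb hM hm0 (fun x hx => hm β x (hK β hβ) hx) hq0.le
      (hq β hβ) k
  obtain ⟨a, ha0, ha1, ha⟩ := exists_pow_le_and_le_pow (θ := m / 2) (by positivity)
  have hlogq : 0 < -Real.log q := by linarith [Real.log_neg hq0 hq1]
  have hbpos : (0 : ℝ) < ((d - 1 : ℕ) : ℝ) := by
    have : 0 < d - 1 := by omega
    exact_mod_cast this
  -- First k makes bad subtrees so rare that their share is at most 1/8, even after multiplication
  -- by the branching number d - 1. Then p makes the p-th moment on the remaining ones equally
  -- small. The value 1/4 later beats the choice of x, which costs 2^s over s levels.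
  obtain ⟨k, p, hp0, hkp⟩ : ∃ k p : ℕ, 0 < p ∧ ((d - 1 : ℕ) : ℝ) * (q ^ 2 ^ k +
      (1 / (1 + (m / 2) ^ k * y)) ^ p) ≤ 1 / 4 := by
    obtain ⟨k, hk⟩ := exists_pow_lt_of_lt_one (show (0 : ℝ) < 1 / 8 / ((d - 1 : ℕ) : ℝ) by
      positivity) hq1
    have hk' : q ^ 2 ^ k ≤ 1 / 8 / ((d - 1 : ℕ) : ℝ) :=
      (pow_le_pow_of_le_one hq0.le hq1.le Nat.lt_two_pow_self.le).trans hk.le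
    have hv : 1 / (1 + (m / 2) ^ k * y) < 1 := by
      rw [div_lt_one (by positivity)]
      have : 0 < (m / 2) ^ k * y := by positivity
      linarith
    obtain ⟨p, hp⟩ := exists_pow_lt_of_lt_one (show (0 : ℝ) < 1 / 8 / ((d - 1 : ℕ) : ℝ) by
      positivity) hv
    have hp' : (1 / (1 + (m / 2) ^ k * y)) ^ (p + 1) ≤ 1 / 8 / ((d - 1 : ℕ) : ℝ) :=
      (pow_le_pow_of_le_one (by positivity) hv.le (Nat.le_succ p)).trans hp.le
    refine ⟨k, p + 1, Nat.succ_pos p, ?_⟩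
    calc _ ≤ ((d - 1 : ℕ) : ℝ) * (1 / 8 / ((d - 1 : ℕ) : ℝ) + 1 / 8 / ((d - 1 : ℕ) : ℝ)) := by
          gcongr
      _ = 1 / 4 := by field_simp; norm_num
  refine ⟨⟨1 - y + y * q, a, min y (-Real.log q / 2), p, ?_, ?_, ha0, by linarith,
    lt_min hy0 (by linarith), hp0, ?_, ?_, ?_⟩⟩
  · have : 0 < y * q := by positivity
    linarith
  · nlinarith
  · exact fun β hβ => lintegral_one_sub_escape_le hy0.le hy1 hq0.le (hq β hβ)
  · intro β hβ r hr
    obtain ⟨k, hk1, hk2⟩ := ha r hr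
    have hr0 : (0 : ℝ) ≤ (r : ℝ) ^ a := by positivity
    refine (lintegral_le_measure_escape_add (h := h) (β₀ := β₀) (β := β) (d := d)
      (t := (m / 2) ^ k * y) (v := Real.exp (-(y * (r : ℝ) ^ a))) (fun ξ => ?_)
      (fun ξ hξ => ?_)).trans ?_
    · exact pow_le_one₀ (by linarith [escape_le_one (h := h) (β₀ := β₀) (β := β) (d := d) ξ])
        (by linarith [escape_nonneg (h := h) (β₀ := β₀) (β := β) (d := d) ξ])
    · have h1 : 1 - escape h β₀ β d ξ ≤ Real.exp (-((m / 2) ^ k * y)) := by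
        have := Real.add_one_le_exp (-((m / 2) ^ k * y))
        linarith
      refine (pow_le_pow_left₀ (by linarith [escape_le_one (h := h) (β₀ := β₀) (β := β) (d := d) ξ])
        h1 r).trans ?_
      rw [← Real.exp_nat_mul, Real.exp_le_exp]
      nlinarith
    · refine (add_le_add_left (hpow β hβ k) _).trans ?_
      rw [← ENNReal.ofReal_add (by positivity) (by positivity)]
      refine ENNReal.ofReal_le_ofReal ?_
      have h1 : q ^ 2 ^ k ≤ Real.exp (-(min y (-Real.log q / 2) * (r : ℝ) ^ a)) := by
        rw [← Real.exp_log hq0, ← Real.exp_nat_mul, Real.exp_le_exp, Real.log_exp]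
        push_cast
        have h2 := min_le_right y (-Real.log q / 2)
        nlinarith
      have h2 : Real.exp (-(y * (r : ℝ) ^ a))
          ≤ Real.exp (-(min y (-Real.log q / 2) * (r : ℝ) ^ a)) := by
        rw [Real.exp_le_exp]
        have h2 := min_le_left y (-Real.log q / 2)
        nlinarith
      linarith
  · intro β hβ
    have h1 := lintegral_le_measure_escape_add (h := h) (β₀ := β₀) (β := β) (d := d) (μ := μ)
      (b := d - 1) (t := (m / 2) ^ k * y) (v := (1 / (1 + (m / 2) ^ k * y)) ^ p)
      (f := fun ξ => (1 / (1 + escape h β₀ β d ξ)) ^ p) (fun ξ => ?_) (fun ξ hξ => ?_)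
    · calc _ ≤ ((d - 1 : ℕ) : ENNReal) * (ENNReal.ofReal (q ^ 2 ^ k)
            + ENNReal.ofReal ((1 / (1 + (m / 2) ^ k * y)) ^ p)) := by
            gcongr
            exact h1.trans (add_le_add_left (hpow β hβ k) _)
        _ = ENNReal.ofReal (((d - 1 : ℕ) : ℝ) * (q ^ 2 ^ k +
              (1 / (1 + (m / 2) ^ k * y)) ^ p)) := by
            rw [← ENNReal.ofReal_add (by positivity) (by positivity),
              ENNReal.ofReal_mul (by positivity), ENNReal.ofReal_natCast]
        _ ≤ _ := ENNReal.ofReal_le_ofReal hkp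
    · have h2 := escape_nonneg (h := h) (β₀ := β₀) (β := β) (d := d) ξ
      exact pow_le_one₀ (by positivity) (by rw [div_le_one (by positivity)]; linarith)
    · have h2 := escape_nonneg (h := h) (β₀ := β₀) (β := β) (d := d) ξ
      refine pow_le_pow_left₀ (by positivity) ?_ p
      exact one_div_le_one_div_of_le (by positivity) (by linarith)

variable {d : ℕ}

/-! ### Descendants -/

theorem level_eq_level_parent_add_one {w : Vertex d} (hw : w ≠ root) :
    level w = level (parent w) + 1 := by
  rcases w with _ | ⟨i, _ | ⟨j, l⟩⟩
  · exact absurd rfl hw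
  · rfl
  · rfl

/-- The strict descendants of a vertex. -/
inductive StrictDesc (v : Vertex d) : Vertex d → Prop
  | child {w : Vertex d} : w ≠ root → parent w = v → StrictDesc v w
  | step {w : Vertex d} : w ≠ root → StrictDesc v (parent w) → StrictDesc v w

namespace StrictDesc

variable {v w : Vertex d}

theorem ne_root (hw : StrictDesc v w) : w ≠ root := by
  cases hw <;> assumption

theorem parent_eq_or (hw : StrictDesc v w) : parent w = v ∨ StrictDesc v (parent w) := by
  cases hw with
  | child _ h => exact Or.inl h
  | step _ h => exact Or.inr h

theorem level_lt (hw : StrictDesc v w) : level v < level w := by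
  induction hw with
  | child h1 h2 => rw [level_eq_level_parent_add_one h1, h2]; exact Nat.lt_succ_self _
  | step h1 h2 ih => rw [level_eq_level_parent_add_one h1]; omega

theorem trans {u : Vertex d} (hw : StrictDesc v w) (hu : StrictDesc w u) : StrictDesc v u := by
  induction hu with
  | child h1 h2 => exact step h1 (h2 ▸ hw)
  | step h1 _ ih => exact step h1 ih

end StrictDesc

theorem not_strictDesc_self (v : Vertex d) : ¬StrictDesc v v := fun h => lt_irrefl _ h.level_lt

theorem strictDesc_append (i : Fin d) (l : List (Fin (d - 1))) :
    ∀ t : List (Fin (d - 1)), t ≠ [] → StrictDesc (some (i, l)) (some (i, t ++ l))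
  | [], h => absurd rfl h
  | [_], _ => .child (by simp [root]) rfl
  | _ :: a :: t, _ => .step (by simp [root]) (strictDesc_append i l (a :: t) (by simp))

theorem StrictDesc.exists_append {i : Fin d} {l : List (Fin (d - 1))} {w : Vertex d}
    (hw : StrictDesc (some (i, l)) w) :
    ∃ (t : List (Fin (d - 1))) (j : Fin (d - 1)), w = some (i, t ++ j :: l) := by
  induction hw with
  | @child w h1 h2 =>
    rcases w with _ | ⟨i', _ | ⟨j, l'⟩⟩
    · exact absurd rfl h1
    · simp [parent] at h2
    · simp only [parent, Option.some.injEq, Prod.mk.injEq] at h2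
      obtain ⟨rfl, rfl⟩ := h2
      exact ⟨[], j, rfl⟩
  | @step w h1 _ ih =>
    rcases w with _ | ⟨i', _ | ⟨j, l'⟩⟩
    · exact absurd rfl h1
    · simp [parent] at ih
    · obtain ⟨t, j', h⟩ := ih
      simp only [parent, Option.some.injEq, Prod.mk.injEq] at h
      obtain ⟨rfl, rfl⟩ := h
      exact ⟨j :: t, j', rfl⟩

/-! ### Marks seen from a vertex -/

theorem mark_parent_left (ω : Env d) (e : Edge d) : mark ω (parent (some e)) (some e) = ω e := by
  obtain ⟨i, _ | ⟨j, l⟩⟩ := e <;> simp [parent, mark]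

theorem mark_parent_right (ω : Env d) (e : Edge d) :
    mark ω (some e) (parent (some e)) = -ω e := by
  obtain ⟨i, _ | ⟨j, l⟩⟩ := e
  · simp [parent, mark]
  · have h1 : parent (some (i, l)) ≠ some (i, j :: l) := by
      intro h
      have := congrArg level h
      rcases l with _ | ⟨k, l⟩
      · simp [parent] at h
      · simp [parent, level] at this
    have h2 : parent (some (i, j :: l)) = some (i, l) := rfl
    rw [h2]
    simp only [mark, if_neg h1, if_pos h2]

/-- The marks of the subtree hanging from an edge. -/
def subMarks (e : Edge d) (ω : Env d) : Marks (d - 1) := fun l => ω (e.1, l ++ e.2)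

@[fun_prop]
theorem measurable_subMarks (e : Edge d) : Measurable (subMarks e) :=
  measurable_pi_lambda _ fun _ => measurable_pi_apply _

theorem subMarks_nil (e : Edge d) (ω : Env d) : subMarks e ω [] = ω e := rfl

theorem subMarks_cons (i : Fin d) (j : Fin (d - 1)) (l : List (Fin (d - 1))) (ω : Env d) :
    subMarks (i, j :: l) ω = shift j (subMarks (i, l) ω) := by
  funext t
  simp [subMarks, shift]

theorem map_subMarks (μ : Measure ℝ) [IsProbabilityMeasure μ] (e : Edge d) :
    (envLaw d μ).map (subMarks e) = marksLaw (d - 1) μ :=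
  Measure.map_infinitePi_infinitePi_of_inj (P := fun _ : Edge d => μ)
    (f := fun l => (e.1, l ++ e.2)) (fun l m h => by simpa using h)

theorem lintegral_subMarks (μ : Measure ℝ) [IsProbabilityMeasure μ] (e : Edge d)
    {f : Marks (d - 1) → ENNReal} (hf : Measurable f) :
    ∫⁻ ω, f (subMarks e ω) ∂envLaw d μ = ∫⁻ ξ, f ξ ∂marksLaw (d - 1) μ := by
  rw [← map_subMarks μ e, lintegral_map hf (measurable_subMarks e)]

/-! ### Superharmonic functions -/

section Superharmonic

variable (h : AcceptanceFunction) (β₀ β : ℝ)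

/-- A bound for the probability that the walk started at `u` ever leaves `D`. -/
noncomputable def exitBound (D : Set (Vertex d)) (ω : Env d) : Vertex d → ℝ
  | none => 1
  | some (i, l) => aux i l
where
  /-- the product of the probabilities to move up from the ancestors which lie in `D` -/
  aux (i : Fin d) : List (Fin (d - 1)) → ℝ
    | [] => open Classical in
        if some (i, []) ∈ D then 1 - escapeProb h β₀ β d (subMarks (i, []) ω) else 1
    | j :: l => open Classical in
        (if some (i, j :: l) ∈ D then 1 - escapeProb h β₀ β d (subMarks (i, j :: l) ω) else 1)
          * aux i l

variable {h β₀ β} {D : Set (Vertex d)} {ω : Env d}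

open Classical in
theorem exitBound_some (e : Edge d) :
    exitBound h β₀ β D ω (some e)
      = (if some e ∈ D then 1 - escapeProb h β₀ β d (subMarks e ω) else 1)
        * exitBound h β₀ β D ω (parent (some e)) := by
  obtain ⟨i, _ | ⟨j, l⟩⟩ := e
  · simp [exitBound, exitBound.aux, parent]
  · rfl

/-- Sets of vertices which contain the children of their elements, but not the root. -/
structure IsLower (D : Set (Vertex d)) : Prop where
  root_notMem : root ∉ D
  mem_of_parent : ∀ w, w ≠ root → parent w ∈ D → w ∈ D

theorem isLower_strictDesc (v : Vertex d) : IsLower {w | StrictDesc v w} where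
  root_notMem := fun hr => hr.ne_root rfl
  mem_of_parent := fun _ h1 h2 => StrictDesc.step h1 h2

theorem edge_induction {C : Vertex d → Prop} (h0 : C root)
    (h1 : ∀ e : Edge d, C (parent (some e)) → C (some e)) (v : Vertex d) : C v := by
  rcases v with _ | ⟨i, l⟩
  · exact h0
  · induction l with
    | nil => exact h1 _ h0
    | cons j l ih => exact h1 _ ih

theorem exitBound_nonneg (hd : 0 < d) (u : Vertex d) : 0 ≤ exitBound h β₀ β D ω u := by
  induction u using edge_induction with
  | h0 => exact zero_le_one
  | h1 e ih =>
    rw [exitBound_some]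
    refine mul_nonneg ?_ ih
    split_ifs
    · exact one_sub_escapeProb_nonneg hd _
    · exact zero_le_one

theorem exitBound_le_one (hd : 0 < d) (u : Vertex d) : exitBound h β₀ β D ω u ≤ 1 := by
  induction u using edge_induction with
  | h0 => exact le_rfl
  | h1 e ih =>
    rw [exitBound_some]
    refine mul_le_one₀ ?_ (exitBound_nonneg hd _) ih
    split_ifs
    · linarith [escapeProb_nonneg (h := h) (β₀ := β₀) (β := β) (d := d) (subMarks e ω)]
    · exact le_rfl

theorem exitBound_eq_one (hD : IsLower D) {u : Vertex d} (hu : u ∉ D) :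
    exitBound h β₀ β D ω u = 1 := by
  induction u using edge_induction with
  | h0 => rfl
  | h1 e ih =>
    rw [exitBound_some, if_neg hu, one_mul]
    exact ih fun hp => hu (hD.mem_of_parent _ (by simp [root]) hp)

theorem sum_children (i : Fin d) (l : List (Fin (d - 1))) (f : Vertex d → ℝ) :
    ∑ w ∈ children (some (i, l)), f w = ∑ j, f (some (i, j :: l)) := by
  rw [children, Finset.sum_image]
  intro a _ b _ hab
  simpa using hab

theorem parent_notMem_children (e : Edge d) : parent (some e) ∉ children (some e) := by
  intro h
  rw [mem_children] at h
  have h1 := level_eq_level_parent_add_one h.1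
  have h2 := level_eq_level_parent_add_one (w := some e) (by simp [root])
  rw [h.2] at h1
  omega

theorem sum_neighbors (i : Fin d) (l : List (Fin (d - 1))) (f : Vertex d → ℝ) :
    ∑ w ∈ neighbors (some (i, l)), f w
      = f (parent (some (i, l))) + ∑ j, f (some (i, j :: l)) := by
  rw [neighbors, Finset.sum_insert (parent_notMem_children _), sum_children]

theorem mark_child (ω : Env d) (i : Fin d) (l : List (Fin (d - 1))) (j : Fin (d - 1)) :
    mark ω (some (i, l)) (some (i, j :: l)) = shift j (subMarks (i, l) ω) [] := by
  rw [← subMarks_cons, subMarks_nil]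
  exact mark_parent_left ω (i, j :: l)

/-- The product of the upward-crossing probabilities is in fact harmonic in D. The weight a child
contributes to `escape` is the part of its jump probability from which there is no return. After
subtracting it, the identity at u is the defining formula of `escapeProb`. -/
theorem exitBound_superharmonic (hd : 0 < d) (hD : IsLower D) {u : Vertex d} (hu : u ∈ D) :
    ∑ w ∈ insert u (neighbors u), transProb h β₀ β ω u w * exitBound h β₀ β D ω w
      ≤ exitBound h β₀ β D ω u := by
  obtain _ | ⟨i, l⟩ := u
  · exact absurd hu hD.root_notMem
  set u : Vertex d := some (i, l) with hu'
  have hself : transProb h β₀ β ω u u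
      = 1 - ∑ w ∈ neighbors u, jumpProb h β₀ β d (mark ω u w) := by
    simp [transProb, notMem_neighbors_self]
  have hsum : ∑ w ∈ neighbors u, transProb h β₀ β ω u w * exitBound h β₀ β D ω w
      = ∑ w ∈ neighbors u, jumpProb h β₀ β d (mark ω u w) * exitBound h β₀ β D ω w :=
    Finset.sum_congr rfl fun w hw => by simp only [transProb, if_pos hw]
  rw [Finset.sum_insert (notMem_neighbors_self u), hself, hsum, hu', sum_neighbors,
    sum_neighbors, mark_parent_right]
  set ξ := subMarks (i, l) ω with hξ
  have hF : exitBound h β₀ β D ω (some (i, l))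
      = (1 - escapeProb h β₀ β d ξ) * exitBound h β₀ β D ω (parent (some (i, l))) := by
    rw [exitBound_some, if_pos hu]
  -- A jump to a child followed by a return is the jump probability minus the escape weight of the
  -- child's subtree.
  have hchild : ∀ j : Fin (d - 1), jumpProb h β₀ β d (mark ω (some (i, l)) (some (i, j :: l))) *
      exitBound h β₀ β D ω (some (i, j :: l))
      = (jumpProb h β₀ β d (mark ω (some (i, l)) (some (i, j :: l)))
        - escape h β₀ β d (shift j ξ)) * exitBound h β₀ β D ω (some (i, l)) := by
    intro j
    rw [exitBound_some, if_pos (hD.mem_of_parent (some (i, j :: l)) (by simp [root]) hu), mark_child,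
      subMarks_cons, ← hξ, escape_eq_mul_escapeProb hd (shift j ξ)]
    have : parent (some (i, j :: l)) = some (i, l) := rfl
    rw [this]
    ring
  simp only [hchild]
  rw [← Finset.sum_mul, Finset.sum_sub_distrib]
  have hω : ω (i, l) = ξ [] := rfl
  rw [hω]
  have hesc := one_sub_escapeProb (h := h) (β₀ := β₀) (β := β) hd ξ
  set S := ∑ j, jumpProb h β₀ β d (mark ω (some (i, l)) (some (i, j :: l)))
  set B := ∑ j, escape h β₀ β d (shift j ξ) with hB
  set p := jumpProb h β₀ β d (-ξ [])
  set G := exitBound h β₀ β D ω (parent (some (i, l)))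
  have hp : 0 < p := jumpProb_pos h β₀ β hd _
  have hB0 : 0 ≤ B := sum_escape_nonneg ξ
  have hpB : p + B ≠ 0 := by positivity
  rw [hF, hesc]
  refine le_of_eq ?_
  field_simp
  ring

/-- The product over the levels of the escape estimates along a path. -/
theorem exitBound_pow_le_backtrackSum (hd : 0 < d) (p : ℕ) (σ : Fin (d - 1) → Fin (d - 1))
    (hD : IsLower D) (t : List (Fin (d - 1))) (i : Fin d) (l : List (Fin (d - 1)))
    (hmem : some (i, l) ∈ D) (hpar : parent (some (i, l)) ∉ D) :
    ENNReal.ofReal (exitBound h β₀ β D ω (some (i, t ++ l)) ^ p)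
      ≤ backtrackSum h β₀ β d p σ t.length (subMarks (i, l) ω) := by
  classical
  have hall : ∀ (t l : List (Fin (d - 1))), some (i, l) ∈ D → some (i, t ++ l) ∈ D := by
    intro t l hl
    induction t with
    | nil => exact hl
    | cons a t ih => exact hD.mem_of_parent _ (by simp [root]) ih
  -- The path is peeled from its top, as in `backtrackSum`. The factor of a vertex is estimated
  -- through a sibling of the next vertex on the path, and the factor of the lowest vertex is
  -- dropped.
  have key : ∀ (t l : List (Fin (d - 1))), some (i, l) ∈ D →
      ENNReal.ofReal ((exitBound h β₀ β D ω (some (i, t ++ l))) ^ p)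
        ≤ backtrackSum h β₀ β d p σ t.length (subMarks (i, l) ω)
          * ENNReal.ofReal ((exitBound h β₀ β D ω (parent (some (i, l)))) ^ p) := by
    intro t
    induction t using List.reverseRecOn with
    | nil =>
      intro l hl
      rw [List.nil_append, List.length_nil, backtrackSum, one_mul]
      refine ENNReal.ofReal_le_ofReal (pow_le_pow_left₀ (exitBound_nonneg hd _) ?_ p)
      rw [exitBound_some, if_pos hl]
      exact mul_le_of_le_one_left (exitBound_nonneg hd _)
        (by linarith [escapeProb_nonneg (h := h) (β₀ := β₀) (β := β) (d := d)
              (subMarks (i, l) ω)])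
    | append_singleton t j ih =>
      intro l hl
      have h1 := ih (j :: l) (hall [j] l hl)
      rw [List.append_assoc, List.singleton_append]
      refine h1.trans ?_
      rw [List.length_append, List.length_singleton, backtrackSum, subMarks_cons]
      have h2 : parent (some (i, j :: l)) = some (i, l) := rfl
      rw [h2, exitBound_some, if_pos hl, mul_pow, ENNReal.ofReal_mul (pow_nonneg
        (one_sub_escapeProb_nonneg hd _) _), ← mul_assoc]
      refine mul_le_mul_left ?_ _
      refine le_trans ?_ (Finset.single_le_sum (f := fun j => ENNReal.ofReal
        ((1 / (1 + escape h β₀ β d (shift (σ j) (subMarks (i, l) ω)))) ^ p)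
          * backtrackSum h β₀ β d p σ t.length (shift j (subMarks (i, l) ω)))
        (fun _ _ => zero_le) (Finset.mem_univ j))
      rw [mul_comm]
      exact mul_le_mul_left (ENNReal.ofReal_le_ofReal (pow_le_pow_left₀
        (one_sub_escapeProb_nonneg hd _) (one_sub_escapeProb_le hd _ (σ j)) p)) _
  refine (key t l hmem).trans ?_
  rw [exitBound_eq_one hD hpar]
  simp

end Superharmonic

/-! ### The Markov property -/

/-- The trajectory after time `k`. -/
def shiftPath (k : ℕ) (V : ℕ → Vertex d) : ℕ → Vertex d := fun n => V (n + k)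

@[fun_prop]
theorem measurable_shiftPath (k : ℕ) : Measurable (shiftPath k : (ℕ → Vertex d) → _) :=
  measurable_pi_lambda _ fun _ => measurable_pi_apply _

/-- The sets of trajectories determined by the positions up to time `k`. -/
def Adapted (k : ℕ) (F : Set (ℕ → Vertex d)) : Prop :=
  ∀ x y : ℕ → Vertex d, (∀ i ≤ k, x i = y i) → x ∈ F → y ∈ F

/-- The extension of a finite path to a trajectory. -/
def extendPath (k : ℕ) (u : Fin (k + 1) → Vertex d) : ℕ → Vertex d := fun i =>
  if hi : i < k + 1 then u ⟨i, hi⟩ else root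

theorem mem_pathCylinder_extendPath {k : ℕ} {u : Fin (k + 1) → Vertex d} {V : ℕ → Vertex d} :
    V ∈ pathCylinder k (extendPath k u) ↔ (fun i : Fin (k + 1) => V i) = u := by
  constructor
  · intro hV
    funext i
    rw [hV i (Nat.lt_succ_iff.1 i.2), extendPath, dif_pos i.2]
  · rintro rfl i hi
    rw [extendPath, dif_pos (Nat.lt_succ_of_le hi)]

theorem measure_eq_tsum_pathCylinder (m : Measure (ℕ → Vertex d)) (k : ℕ)
    {A : Set (ℕ → Vertex d)} (hA : MeasurableSet A) :
    m A = ∑' u : Fin (k + 1) → Vertex d, m (pathCylinder k (extendPath k u) ∩ A) := by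
  rw [← measure_iUnion]
  · congr 1
    ext V
    simp [mem_pathCylinder_extendPath]
  · intro u u' huu'
    refine Set.disjoint_left.2 fun V h1 h2 => huu' ?_
    exact (mem_pathCylinder_extendPath.1 h1.1).symm.trans (mem_pathCylinder_extendPath.1 h2.1)
  · exact fun u => (measurableSet_pathCylinder _ _).inter hA

theorem Adapted.pathCylinder_subset {k : ℕ} {F : Set (ℕ → Vertex d)} (hF : Adapted k F)
    {x : ℕ → Vertex d} (hx : x ∈ F) : pathCylinder k x ⊆ F :=
  fun _ hy => hF x _ (fun i hi => (hy i hi).symm) hx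

theorem Adapted.inter_eq_empty {k : ℕ} {F : Set (ℕ → Vertex d)} (hF : Adapted k F)
    {x : ℕ → Vertex d} (hx : x ∉ F) : pathCylinder k x ∩ F = ∅ := by
  ext y
  simp only [Set.mem_inter_iff, Set.mem_empty_iff_false, iff_false]
  exact fun hy => hx (hF y x hy.1 hy.2)

theorem Adapted.measurableSet {k : ℕ} {F : Set (ℕ → Vertex d)} (hF : Adapted k F) :
    MeasurableSet F := by
  have : F = ⋃ u : {u : Fin (k + 1) → Vertex d // extendPath k u ∈ F},
      pathCylinder k (extendPath k u.1) := by
    ext V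
    simp only [Set.mem_iUnion]
    constructor
    · intro hV
      have h1 := (mem_pathCylinder_extendPath (V := V)
        (u := fun i : Fin (k + 1) => V i)).2 rfl
      exact ⟨⟨_, hF V _ h1 hV⟩, h1⟩
    · rintro ⟨u, hu⟩
      exact hF.pathCylinder_subset u.2 hu
  rw [this]
  exact MeasurableSet.iUnion fun u => measurableSet_pathCylinder _ _

section Quenched

variable (h : AcceptanceFunction) (β₀ β : ℝ)

/-- The Markov property of the quenched law. -/
theorem quenchedLaw_inter_shiftPath (v : Vertex d) (ω : Env d) (k : ℕ) (x : ℕ → Vertex d)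
    {E : Set (ℕ → Vertex d)} (hE : MeasurableSet E) :
    quenchedLaw h β₀ β v ω (pathCylinder k x ∩ shiftPath k ⁻¹' E)
      = quenchedLaw h β₀ β v ω (pathCylinder k x) * quenchedLaw h β₀ β (x k) ω E := by
  have hk := measurable_shiftPath (d := d) k
  set m₁ := ((quenchedLaw h β₀ β v ω).restrict (pathCylinder k x)).map (shiftPath k) with hm₁
  set m₂ := quenchedLaw h β₀ β v ω (pathCylinder k x) • quenchedLaw h β₀ β (x k) ω with hm₂
  have h1 : ∀ S, MeasurableSet S → m₁ S
      = quenchedLaw h β₀ β v ω (pathCylinder k x ∩ shiftPath k ⁻¹' S) := fun S hS => by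
    rw [hm₁, Measure.map_apply hk hS, Measure.restrict_apply (hk hS), Set.inter_comm]
  have heq : m₁ = m₂ := by
    refine ext_of_generate_finite _ generateFrom_pathCylinder isPiSystem_pathCylinder ?_ ?_
    · rintro _ ⟨n, y, rfl⟩
      rw [h1 _ (measurableSet_pathCylinder n y), hm₂, Measure.smul_apply, smul_eq_mul]
      by_cases hy : y 0 = x k
      -- On cylinders the Markov property is multiplicativity of the path weights: `z` is x up to
      -- time k followed by y.
      · set z : ℕ → Vertex d := fun i => if i ≤ k then x i else y (i - k) with hz
        have hset : pathCylinder k x ∩ shiftPath k ⁻¹' pathCylinder n y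
            = pathCylinder (k + n) z := by
          ext V
          simp only [pathCylinder, shiftPath, Set.mem_inter_iff, Set.mem_preimage,
            Set.mem_ofPred_eq, hz]
          constructor
          · rintro ⟨h2, h3⟩ i hi
            split_ifs with hik
            · exact h2 i hik
            · have := h3 (i - k) (by omega)
              rwa [Nat.sub_add_cancel (by omega)] at this
          · intro h2
            refine ⟨fun i hi => by simpa [hi] using h2 i (by omega), fun i hi => ?_⟩
            have h3 := h2 (i + k) (by omega)
            split_ifs at h3 with hik
            · obtain rfl : i = 0 := by omega
              rw [h3, hy, Nat.zero_add]
            · rwa [Nat.add_sub_cancel] at h3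
        rw [hset, quenchedLaw_pathCylinder, quenchedLaw_pathCylinder, quenchedLaw_pathCylinder,
          Finset.prod_range_add, ← hy]
        have e0 : z 0 = x 0 := by simp [hz]
        have e1 : ∀ i ∈ Finset.range k, ENNReal.ofReal (transProb h β₀ β ω (z i) (z (i + 1)))
            = ENNReal.ofReal (transProb h β₀ β ω (x i) (x (i + 1))) := by
          intro i hi
          have hi' := Finset.mem_range.1 hi
          simp only [hz, if_pos hi'.le, if_pos (Nat.succ_le_of_lt hi')]
        have e2 : ∀ i, z (k + i) = y i := by
          intro i
          simp only [hz]
          split_ifs with hik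
          · obtain rfl : i = 0 := by omega
            rw [hy, Nat.add_zero]
          · rw [Nat.add_sub_cancel_left]
        rw [e0, Finset.prod_congr rfl e1]
        simp only [add_assoc, e2, Measure.dirac_apply' _ (measurableSet_singleton _)]
        simp [mul_assoc]
      · have hset : pathCylinder k x ∩ shiftPath k ⁻¹' pathCylinder n y = ∅ := by
          ext V
          simp only [Set.mem_inter_iff, Set.mem_empty_iff_false, iff_false]
          rintro ⟨h2, h3⟩
          have h4 := h3 0 (Nat.zero_le _)
          rw [shiftPath, Nat.zero_add, h2 k le_rfl] at h4
          exact hy h4.symm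
        rw [hset, quenchedLaw_pathCylinder _ _ _ (x k), Measure.dirac_apply' _
          (measurableSet_singleton _), Set.indicator_of_notMem (fun hn => hy hn.symm)]
        simp
    · rw [h1 _ MeasurableSet.univ, hm₂, Measure.smul_apply, measure_univ]
      simp
  rw [← h1 E hE, heq, hm₂, Measure.smul_apply, smul_eq_mul]

variable {h β₀ β}

theorem quenchedLaw_ae_start (v : Vertex d) (ω : Env d) :
    ∀ᵐ V ∂quenchedLaw h β₀ β v ω, V 0 = v := by
  have h1 : quenchedLaw h β₀ β v ω (pathCylinder 0 fun _ => v) = 1 := by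
    rw [quenchedLaw_pathCylinder_zero]
    simp
  have h2 : (pathCylinder 0 fun _ => v : Set (ℕ → Vertex d)) = {V | V 0 = v} := by
    ext V
    simp [pathCylinder]
  rw [h2] at h1
  exact (prob_compl_eq_zero_iff (measurableSet_eq_fun (by fun_prop) (by fun_prop))).2 h1

theorem quenchedLaw_inter_shiftPath_le {v : Vertex d} {ω : Env d} {k : ℕ}
    {F E : Set (ℕ → Vertex d)} (hF : Adapted k F) (hE : MeasurableSet E) {c : ENNReal}
    (hc : ∀ V ∈ F, quenchedLaw h β₀ β (V k) ω E ≤ c) :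
    quenchedLaw h β₀ β v ω (F ∩ shiftPath k ⁻¹' E) ≤ quenchedLaw h β₀ β v ω F * c := by
  have hk := measurable_shiftPath (d := d) k
  rw [measure_eq_tsum_pathCylinder _ k (hF.measurableSet.inter (hk hE)),
    measure_eq_tsum_pathCylinder _ k hF.measurableSet, ← ENNReal.tsum_mul_right]
  refine ENNReal.tsum_le_tsum fun u => ?_
  by_cases hu : extendPath k u ∈ F
  · rw [← Set.inter_assoc, Set.inter_eq_left.2 (hF.pathCylinder_subset hu),
      quenchedLaw_inter_shiftPath _ _ _ _ _ _ _ hE]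
    gcongr
    exact hc _ hu
  · rw [← Set.inter_assoc, hF.inter_eq_empty hu]
    simp

/-- Strong Markov property: the disjoint adapted sets F k play the role of the events that a
stopping time equals k. -/
theorem quenchedLaw_iUnion_inter_shiftPath_le {v : Vertex d} {ω : Env d}
    {F : ℕ → Set (ℕ → Vertex d)} {E : Set (ℕ → Vertex d)} (hF : ∀ k, Adapted k (F k))
    (hdisj : Pairwise (Function.onFun Disjoint F)) (hE : MeasurableSet E) {c : ENNReal}
    (hc : ∀ k, ∀ V ∈ F k, V 0 = v → quenchedLaw h β₀ β (V k) ω E ≤ c) :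
    quenchedLaw h β₀ β v ω (⋃ k, F k ∩ shiftPath k ⁻¹' E)
      ≤ quenchedLaw h β₀ β v ω (⋃ k, F k) * c := by
  let G : ℕ → Set (ℕ → Vertex d) := fun k => F k ∩ {V | V 0 = v}
  have hG : ∀ k, Adapted k (G k) := fun k x y hxy hx =>
    ⟨hF k x y hxy hx.1, (hxy 0 (Nat.zero_le _)).symm.trans hx.2⟩
  have h0 := quenchedLaw_ae_start (h := h) (β₀ := β₀) (β := β) v ω
  calc quenchedLaw h β₀ β v ω (⋃ k, F k ∩ shiftPath k ⁻¹' E)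
      ≤ quenchedLaw h β₀ β v ω (⋃ k, G k ∩ shiftPath k ⁻¹' E) := by
        refine measure_mono_ae ?_
        filter_upwards [h0] with V hV hmem
        obtain ⟨k, hk⟩ := Set.mem_iUnion.1 hmem
        exact Set.mem_iUnion.2 ⟨k, ⟨hk.1, hV⟩, hk.2⟩
    _ ≤ ∑' k, quenchedLaw h β₀ β v ω (G k ∩ shiftPath k ⁻¹' E) := measure_iUnion_le _
    _ ≤ ∑' k, quenchedLaw h β₀ β v ω (G k) * c := by
        refine ENNReal.tsum_le_tsum fun k => ?_
        exact quenchedLaw_inter_shiftPath_le (hG k) hE fun V hV => hc k V hV.1 hV.2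
    _ = quenchedLaw h β₀ β v ω (⋃ k, G k) * c := by
        rw [ENNReal.tsum_mul_right, measure_iUnion (fun i j hij => (hdisj hij).mono
          Set.inter_subset_left Set.inter_subset_left) fun k => (hG k).measurableSet]
    _ ≤ quenchedLaw h β₀ β v ω (⋃ k, F k) * c := by
        gcongr with k
        exact Set.inter_subset_left

theorem quenchedLaw_shiftPath_one_le (v : Vertex d) (ω : Env d) {E : Set (ℕ → Vertex d)}
    (hE : MeasurableSet E) :
    quenchedLaw h β₀ β v ω (shiftPath 1 ⁻¹' E) ≤ ∑ w ∈ insert v (neighbors v),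
      ENNReal.ofReal (transProb h β₀ β ω v w) * quenchedLaw h β₀ β w ω E := by
  let x : Vertex d → ℕ → Vertex d := fun w n => if n = 0 then v else w
  have h0 := quenchedLaw_ae_start (h := h) (β₀ := β₀) (β := β) v ω
  calc quenchedLaw h β₀ β v ω (shiftPath 1 ⁻¹' E)
      ≤ quenchedLaw h β₀ β v ω (⋃ w, pathCylinder 1 (x w) ∩ shiftPath 1 ⁻¹' E) := by
        refine measure_mono_ae ?_
        filter_upwards [h0] with V hV hmem
        refine Set.mem_iUnion.2 ⟨V 1, ?_, hmem⟩
        intro i hi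
        rcases Nat.le_one_iff_eq_zero_or_eq_one.1 hi with rfl | rfl
        · simpa [x] using hV
        · simp [x]
    _ ≤ ∑' w, quenchedLaw h β₀ β v ω (pathCylinder 1 (x w) ∩ shiftPath 1 ⁻¹' E) :=
        measure_iUnion_le _
    _ = ∑' w, ENNReal.ofReal (transProb h β₀ β ω v w) * quenchedLaw h β₀ β w ω E := by
        refine tsum_congr fun w => ?_
        rw [quenchedLaw_inter_shiftPath _ _ _ _ _ _ _ hE, quenchedLaw_pathCylinder]
        simp [x]
    _ = _ := by
        refine tsum_eq_sum fun w hw => ?_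
        rw [Finset.mem_insert, not_or] at hw
        simp [transProb, hw.1, hw.2]

/-- A superharmonic function bounds the probability to leave a set. -/
theorem quenchedLaw_exit_le {D : Set (Vertex d)} {ω : Env d} {F : Vertex d → ℝ}
    (hF0 : ∀ u, 0 ≤ F u) (hF1 : ∀ u, u ∉ D → 1 ≤ F u)
    (hF : ∀ u ∈ D, ∑ w ∈ insert u (neighbors u), transProb h β₀ β ω u w * F w ≤ F u)
    (u : Vertex d) :
    quenchedLaw h β₀ β u ω {V | ∃ j, V j ∉ D} ≤ ENNReal.ofReal (F u) := by
  have hmeas : ∀ n : ℕ, MeasurableSet {V : ℕ → Vertex d | ∃ j ≤ n, V j ∉ D} := fun n =>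
    Adapted.measurableSet (k := n) fun x y hxy => by
      rintro ⟨j, hj, hx⟩
      exact ⟨j, hj, by rwa [← hxy j hj]⟩
  -- Induction on the time horizon replaces optional stopping; the horizon is removed by monotone
  -- convergence.
  have key : ∀ (n : ℕ) (u : Vertex d),
      quenchedLaw h β₀ β u ω {V | ∃ j ≤ n, V j ∉ D} ≤ ENNReal.ofReal (F u) := by
    intro n
    induction n with
    | zero =>
      intro u
      by_cases hu : u ∈ D
      · refine le_of_eq_of_le ?_ zero_le
        rw [measure_eq_zero_iff_ae_notMem]
        filter_upwards [quenchedLaw_ae_start u ω] with V hV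
        rintro ⟨j, hj, hVj⟩
        obtain rfl : j = 0 := by omega
        exact hVj (hV ▸ hu)
      · exact prob_le_one.trans (by simpa using hF1 u hu)
    | succ n ih =>
      intro u
      by_cases hu : u ∈ D
      · calc quenchedLaw h β₀ β u ω {V | ∃ j ≤ n + 1, V j ∉ D}
            ≤ quenchedLaw h β₀ β u ω (shiftPath 1 ⁻¹' {V | ∃ j ≤ n, V j ∉ D}) := by
              refine measure_mono_ae ?_
              filter_upwards [quenchedLaw_ae_start u ω] with V hV
              rintro ⟨j, hj, hVj⟩
              rcases j with _ | j
              · exact absurd (hV ▸ hu) hVj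
              · exact ⟨j, by omega, hVj⟩
          _ ≤ _ := quenchedLaw_shiftPath_one_le u ω (hmeas n)
          _ ≤ ∑ w ∈ insert u (neighbors u),
                ENNReal.ofReal (transProb h β₀ β ω u w) * ENNReal.ofReal (F w) :=
              Finset.sum_le_sum fun w _ => mul_le_mul_right (ih w) _
          _ = ENNReal.ofReal (∑ w ∈ insert u (neighbors u), transProb h β₀ β ω u w * F w) := by
              rw [ENNReal.ofReal_sum_of_nonneg fun w _ =>
                mul_nonneg (transProb_nonneg h β₀ β ω u w) (hF0 w)]
              exact Finset.sum_congr rfl fun w _ =>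
                (ENNReal.ofReal_mul (transProb_nonneg h β₀ β ω u w)).symm
          _ ≤ _ := ENNReal.ofReal_le_ofReal (hF u hu)
      · exact prob_le_one.trans (by simpa using hF1 u hu)
  have hU : {V : ℕ → Vertex d | ∃ j, V j ∉ D} = ⋃ n, {V | ∃ j ≤ n, V j ∉ D} := by
    ext V
    simp only [Set.mem_ofPred_eq, Set.mem_iUnion]
    exact ⟨fun ⟨j, hj⟩ => ⟨j, j, le_rfl, hj⟩, fun ⟨_, j, _, hj⟩ => ⟨j, hj⟩⟩
  have hmono : Monotone fun n : ℕ => {V : ℕ → Vertex d | ∃ j ≤ n, V j ∉ D} :=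
    fun n m hnm V ⟨j, hj, hV⟩ => ⟨j, hj.trans hnm, hV⟩
  rw [hU, hmono.measure_iUnion]
  exact iSup_le fun n => key n u

theorem quenchedLaw_exit_le_exitBound (hd : 0 < d) {D : Set (Vertex d)} (hD : IsLower D)
    (ω : Env d) (u : Vertex d) :
    quenchedLaw h β₀ β u ω {V | ∃ j, V j ∉ D} ≤ ENNReal.ofReal (exitBound h β₀ β D ω u) :=
  quenchedLaw_exit_le (exitBound_nonneg hd) (fun _ hu => (exitBound_eq_one hD hu).ge)
    (fun _ hu => exitBound_superharmonic hd hD hu) u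

theorem measurableSet_exists_notMem (D : Set (Vertex d)) :
    MeasurableSet {V : ℕ → Vertex d | ∃ j, V j ∉ D} := by
  have : {V : ℕ → Vertex d | ∃ j, V j ∉ D} = ⋃ j, {V | V j ∉ D} := by ext; simp
  rw [this]
  exact MeasurableSet.iUnion fun j =>
    measurable_pi_apply (X := fun _ => Vertex d) j (MeasurableSet.of_discrete (s := Dᶜ))

/-! ### Escape and backtracking of the quenched walk -/

/-- After time `0` the trajectory does not stay among the strict descendants of its start. -/
def exitEvent (d : ℕ) : Set (ℕ → Vertex d) := {V | ∃ j, ¬StrictDesc (V 0) (V (j + 1))}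

theorem measurableSet_exitEvent : MeasurableSet (exitEvent d) := by
  have : exitEvent d = ⋃ j, {V | ¬StrictDesc (V 0) (V (j + 1))} := by
    ext; simp [exitEvent]
  rw [this]
  refine MeasurableSet.iUnion fun j => Adapted.measurableSet (k := j + 1) fun x y hxy hx => ?_
  simpa [hxy 0 (by omega), hxy (j + 1) le_rfl] using hx

/-- A child of a vertex. -/
def firstChild (hd : 3 ≤ d) : Vertex d → Edge d
  | none => (⟨0, by omega⟩, [])
  | some (i, l) => (i, ⟨0, by omega⟩ :: l)

theorem parent_firstChild (hd : 3 ≤ d) (v : Vertex d) : parent (some (firstChild hd v)) = v := by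
  rcases v with _ | ⟨i, l⟩ <;> rfl

theorem mem_neighbors_firstChild (hd : 3 ≤ d) (v : Vertex d) :
    some (firstChild hd v) ∈ neighbors v :=
  mem_neighbors.2 (Or.inl ⟨by simp [root], parent_firstChild hd v⟩)

/-- One scenario for never leaving is an immediate jump to the first child without ever crossing
that edge back; its probability is exactly the escape weight of that subtree. -/
theorem quenchedLaw_exitEvent_le (hd : 3 ≤ d) (v : Vertex d) (ω : Env d) :
    quenchedLaw h β₀ β v ω (exitEvent d)
      ≤ ENNReal.ofReal (1 - escape h β₀ β d (subMarks (firstChild hd v) ω)) := by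
  have hd0 : 0 < d := by omega
  set D : Set (Vertex d) := {w | StrictDesc v w} with hD
  have hDl : IsLower D := isLower_strictDesc v
  set c : Vertex d := some (firstChild hd v) with hc
  have hcD : c ∈ D := StrictDesc.child (by simp [root, hc]) (parent_firstChild hd v)
  have hpc : parent c ∉ D := by
    rw [hc, parent_firstChild]; exact not_strictDesc_self v
  have hFc : exitBound h β₀ β D ω c
      = 1 - escapeProb h β₀ β d (subMarks (firstChild hd v) ω) := by
    rw [hc, exitBound_some, if_pos hcD, exitBound_eq_one hDl hpc, mul_one]
  have hcn : c ∈ insert v (neighbors v) := Finset.mem_insert_of_mem (mem_neighbors_firstChild hd v)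
  have htp : transProb h β₀ β ω v c
      = jumpProb h β₀ β d (subMarks (firstChild hd v) ω []) := by
    have h1 : mark ω v c = ω (firstChild hd v) := by
      have := mark_parent_left ω (firstChild hd v)
      rwa [parent_firstChild] at this
    rw [transProb, if_pos (mem_neighbors_firstChild hd v), h1, subMarks_nil]
  have hsum : ∑ w ∈ insert v (neighbors v), transProb h β₀ β ω v w = 1 := by
    have h1 := sum_transProb h β₀ β ω v
    rw [← ENNReal.ofReal_sum_of_nonneg fun w _ => transProb_nonneg h β₀ β ω v w] at h1
    exact ENNReal.ofReal_eq_one.1 h1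
  calc quenchedLaw h β₀ β v ω (exitEvent d)
      ≤ quenchedLaw h β₀ β v ω (shiftPath 1 ⁻¹' {V | ∃ j, V j ∉ D}) := by
        refine measure_mono_ae ?_
        filter_upwards [quenchedLaw_ae_start v ω] with V hV
        rintro ⟨j, hj⟩
        exact ⟨j, by rwa [hV] at hj⟩
    _ ≤ _ := quenchedLaw_shiftPath_one_le v ω (measurableSet_exists_notMem D)
    _ ≤ ∑ w ∈ insert v (neighbors v), ENNReal.ofReal
          (transProb h β₀ β ω v w * exitBound h β₀ β D ω w) := by
        refine Finset.sum_le_sum fun w _ => ?_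
        rw [ENNReal.ofReal_mul (transProb_nonneg h β₀ β ω v w)]
        exact mul_le_mul_right (quenchedLaw_exit_le_exitBound hd0 hDl ω w) _
    _ = ENNReal.ofReal (∑ w ∈ insert v (neighbors v),
          transProb h β₀ β ω v w * exitBound h β₀ β D ω w) :=
        (ENNReal.ofReal_sum_of_nonneg fun w _ =>
          mul_nonneg (transProb_nonneg h β₀ β ω v w) (exitBound_nonneg hd0 w)).symm
    _ ≤ _ := by
        refine ENNReal.ofReal_le_ofReal ?_
        rw [escape_eq_mul_escapeProb hd0, ← htp]
        rw [← Finset.add_sum_erase _ _ hcn] at hsum ⊢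
        have h2 : ∑ w ∈ (insert v (neighbors v)).erase c,
            transProb h β₀ β ω v w * exitBound h β₀ β D ω w
            ≤ ∑ w ∈ (insert v (neighbors v)).erase c, transProb h β₀ β ω v w :=
          Finset.sum_le_sum fun w _ => mul_le_of_le_one_right
            (transProb_nonneg h β₀ β ω v w) (exitBound_le_one hd0 w)
        rw [hFc]
        nlinarith

/-- The trajectory returns at least `r` times to its start. -/
def returnEvent (d : ℕ) : ℕ → Set (ℕ → Vertex d)
  | 0 => Set.univ
  | r + 1 => ⋃ k, {V | 0 < k ∧ V k = V 0 ∧ ∀ j, 0 < j → j < k → V j ≠ V 0}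
      ∩ shiftPath k ⁻¹' returnEvent d r

theorem adapted_firstReturn (k : ℕ) :
    Adapted k {V : ℕ → Vertex d | 0 < k ∧ V k = V 0 ∧ ∀ j, 0 < j → j < k → V j ≠ V 0} := by
  rintro x y hxy ⟨h1, h2, h3⟩
  refine ⟨h1, ?_, fun j hj hjk => ?_⟩
  · rw [← hxy k le_rfl, ← hxy 0 (Nat.zero_le _), h2]
  · rw [← hxy j hjk.le, ← hxy 0 (Nat.zero_le _)]
    exact h3 j hj hjk

theorem measurableSet_returnEvent (r : ℕ) : MeasurableSet (returnEvent d r) := by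
  induction r with
  | zero => exact MeasurableSet.univ
  | succ r ih =>
    exact MeasurableSet.iUnion fun k => (adapted_firstReturn k).measurableSet.inter
      (measurable_shiftPath k ih)

/-- Every return restarts the walk from v in the same environment, hence the power inside the
environment average. A return to the start is an exit, since a vertex is not its own strict
descendant. -/
theorem quenchedLaw_returnEvent_le (hd : 3 ≤ d) (v : Vertex d) (ω : Env d) (r : ℕ) :
    quenchedLaw h β₀ β v ω (returnEvent d r)
      ≤ ENNReal.ofReal ((1 - escape h β₀ β d (subMarks (firstChild hd v) ω)) ^ r) := by
  have hE : 0 ≤ 1 - escape h β₀ β d (subMarks (firstChild hd v) ω) := by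
    linarith [escape_le_one (h := h) (β₀ := β₀) (β := β) (d := d)
      (subMarks (firstChild hd v) ω)]
  induction r with
  | zero => simp [returnEvent]
  | succ r ih =>
    rw [returnEvent]
    refine (quenchedLaw_iUnion_inter_shiftPath_le adapted_firstReturn ?_
      (measurableSet_returnEvent r) (c := ENNReal.ofReal
        ((1 - escape h β₀ β d (subMarks (firstChild hd v) ω)) ^ r)) ?_).trans ?_
    · intro k k' hkk'
      refine Set.disjoint_left.2 ?_
      rintro V ⟨h1, h2, h3⟩ ⟨h1', h2', h3'⟩
      rcases lt_or_gt_of_ne hkk' with hlt | hlt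
      · exact h3' k h1 hlt h2
      · exact h3 k' h1' hlt h2'
    · intro k V hV hV0
      rw [hV.2.1, hV0]
      exact ih
    · rw [pow_succ', ENNReal.ofReal_mul hE]
      refine mul_le_mul_left ((measure_mono ?_).trans (quenchedLaw_exitEvent_le hd v ω)) _
      refine Set.iUnion_subset fun k => ?_
      rintro V ⟨h1, h2, -⟩
      refine ⟨k - 1, ?_⟩
      rw [Nat.sub_add_cancel h1, h2]
      exact not_strictDesc_self _

/-- The trajectory stays among the strict descendants of its start until it is `s` levels below
it, and leaves them afterwards. -/
def backtrackEvent (d s : ℕ) : Set (ℕ → Vertex d) :=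
  {V | ∃ k, (∀ j, 0 < j → j ≤ k → StrictDesc (V 0) (V j)) ∧ level (V k) = level (V 0) + s ∧
    ∃ j, ¬StrictDesc (V 0) (V (j + k))}

theorem measurableSet_backtrackEvent (s : ℕ) : MeasurableSet (backtrackEvent d s) := by
  have : backtrackEvent d s = ⋃ k, ⋃ j, {V | (∀ j, 0 < j → j ≤ k → StrictDesc (V 0) (V j)) ∧
      level (V k) = level (V 0) + s ∧ ¬StrictDesc (V 0) (V (j + k))} := by
    ext V
    simp [backtrackEvent]
  rw [this]
  refine MeasurableSet.iUnion fun k => MeasurableSet.iUnion fun j =>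
    Adapted.measurableSet (k := j + k) ?_
  rintro x y hxy ⟨h1, h2, h3⟩
  refine ⟨fun j hj hjk => ?_, ?_, ?_⟩
  · rw [← hxy 0 (by omega), ← hxy j (by omega)]; exact h1 j hj hjk
  · rw [← hxy 0 (by omega), ← hxy k (by omega)]; exact h2
  · rw [← hxy 0 (by omega), ← hxy _ le_rfl]; exact h3

/-- An upper bound of the quenched probability to backtrack over `s + 1` levels. -/
noncomputable def backtrackBound (h : AcceptanceFunction) (β₀ β : ℝ) (d p : ℕ)
    (σ : Fin (d - 1) → Fin (d - 1)) (x : ℝ) (s : ℕ) (ω : Env d) : Vertex d → ENNReal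
  | none => 1
  | some (i, l) => ENNReal.ofReal x + ENNReal.ofReal (x⁻¹ ^ p)
      * ∑ j, backtrackSum h β₀ β d p σ s (subMarks (i, j :: l) ω)

/-- The vertex u first reached s + 1 levels below v depends on the environment, so its exit
probability is bounded by summing p-th powers over all such vertices. -/
theorem quenchedLaw_backtrackEvent_le (hd : 0 < d) (p : ℕ) (σ : Fin (d - 1) → Fin (d - 1))
    {x : ℝ} (hx : 0 < x) (s : ℕ) (v : Vertex d) (ω : Env d) :
    quenchedLaw h β₀ β v ω (backtrackEvent d (s + 1))
      ≤ backtrackBound h β₀ β d p σ x s ω v := by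
  rcases v with _ | ⟨i, l⟩
  · exact prob_le_one
  set v : Vertex d := some (i, l) with hv
  set D : Set (Vertex d) := {w | StrictDesc v w} with hD
  have hDl : IsLower D := isLower_strictDesc v
  set B := backtrackBound h β₀ β d p σ x s ω v with hB
  let F : ℕ → Set (ℕ → Vertex d) := fun k => {V | (∀ j, 0 < j → j ≤ k → StrictDesc (V 0) (V j)) ∧
    level (V k) = level (V 0) + (s + 1) ∧ ∀ j < k, level (V j) ≠ level (V 0) + (s + 1)}
  have hF : ∀ k, Adapted k (F k) := by
    rintro k x y hxy ⟨h1, h2, h3⟩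
    refine ⟨fun j hj hjk => ?_, ?_, fun j hj => ?_⟩
    · rw [← hxy 0 (by omega), ← hxy j (by omega)]; exact h1 j hj hjk
    · rw [← hxy 0 (by omega), ← hxy k (by omega)]; exact h2
    · rw [← hxy 0 (by omega), ← hxy _ hj.le]; exact h3 j hj
  have hdisj : Pairwise (Function.onFun Disjoint F) := by
    intro k k' hkk'
    refine Set.disjoint_left.2 ?_
    rintro V ⟨h1, h2, h3⟩ ⟨h1', h2', h3'⟩
    rcases lt_or_gt_of_ne hkk' with hlt | hlt
    · exact h3' k hlt h2
    · exact h3 k' hlt h2'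
  have hbound : ∀ u : Vertex d, StrictDesc v u → level u = level v + (s + 1) →
      quenchedLaw h β₀ β u ω {V | ∃ j, V j ∉ D} ≤ B := by
    intro u hu hlev
    refine (quenchedLaw_exit_le_exitBound hd hDl ω u).trans ?_
    obtain ⟨t, j, rfl⟩ := StrictDesc.exists_append hu
    have ht : t.length = s := by
      simp only [level, hv, List.length_append, List.length_cons] at hlev
      omega
    have h1 := exitBound_pow_le_backtrackSum (h := h) (β₀ := β₀) (β := β) (ω := ω) hd p σ hDl t i
      (j :: l) (strictDesc_append i l [j] (by simp)) (not_strictDesc_self v)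
    rw [ht] at h1
    set z := exitBound h β₀ β D ω (some (i, t ++ j :: l)) with hz
    have hz0 : 0 ≤ z := exitBound_nonneg hd _
    have hz1 : z ≤ 1 := exitBound_le_one hd _
    -- Markov's inequality in pointwise form: either z ≤ x, or (z/x)^p ≥ 1 ≥ z. The level x is
    -- chosen at the end.
    have h2 : z ≤ x + x⁻¹ ^ p * z ^ p := by
      rcases le_or_gt z x with hzx | hzx
      · have : 0 ≤ x⁻¹ ^ p * z ^ p := by positivity
        linarith
      · have h3 : 1 ≤ x⁻¹ * z := by
          rw [inv_mul_eq_div, one_le_div hx]; exact hzx.le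
        have h4 : 1 ≤ x⁻¹ ^ p * z ^ p := by
          rw [← mul_pow]; exact one_le_pow₀ h3
        linarith
    calc ENNReal.ofReal z ≤ ENNReal.ofReal (x + x⁻¹ ^ p * z ^ p) := ENNReal.ofReal_le_ofReal h2
      _ = ENNReal.ofReal x + ENNReal.ofReal (x⁻¹ ^ p) * ENNReal.ofReal (z ^ p) := by
        rw [ENNReal.ofReal_add hx.le (by positivity), ENNReal.ofReal_mul (by positivity)]
      _ ≤ B := by
        rw [hB, hv, backtrackBound]
        gcongr
        exact h1.trans (Finset.single_le_sum
          (f := fun j => backtrackSum h β₀ β d p σ s (subMarks (i, j :: l) ω))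
          (fun _ _ => zero_le) (Finset.mem_univ j))
  calc quenchedLaw h β₀ β v ω (backtrackEvent d (s + 1))
      ≤ quenchedLaw h β₀ β v ω (⋃ k, F k ∩ shiftPath k ⁻¹' {V | ∃ j, V j ∉ D}) := by
        refine measure_mono_ae ?_
        filter_upwards [quenchedLaw_ae_start v ω] with V hV
        rintro ⟨k, h1, h2, j, h3⟩
        classical
        have hex : ∃ k, level (V k) = level (V 0) + (s + 1) := ⟨k, h2⟩
        have hle : Nat.find hex ≤ k := Nat.find_min' hex h2
        refine Set.mem_iUnion.2 ⟨Nat.find hex, ⟨fun j hj hjk => h1 j hj (hjk.trans hle),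
          Nat.find_spec hex, fun j hj => Nat.find_min hex hj⟩, j + (k - Nat.find hex), ?_⟩
        change ¬StrictDesc v (V (j + (k - Nat.find hex) + Nat.find hex))
        rw [← hV]
        have : j + (k - Nat.find hex) + Nat.find hex = j + k := by omega
        rwa [this]
    _ ≤ quenchedLaw h β₀ β v ω (⋃ k, F k) * B := by
        refine quenchedLaw_iUnion_inter_shiftPath_le hF hdisj (measurableSet_exists_notMem D) ?_
        rintro k V ⟨h1, h2, -⟩ hV
        rw [hV] at h1 h2
        refine hbound _ (h1 k ?_ le_rfl) h2
        rcases Nat.eq_zero_or_pos k with rfl | hk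
        · rw [hV] at h2; omega
        · exact hk
    _ ≤ B := mul_le_of_le_one_left zero_le prob_le_one

end Quenched

/-! ### The annealed walk discovers fresh subtrees -/

theorem mark_congr {ω ω' : Env d} {a : Vertex d}
    (hω : ∀ e : Edge d, (some e = a ∨ parent (some e) = a) → ω e = ω' e) (u : Vertex d) :
    mark ω a u = mark ω' a u := by
  rcases a with _ | e <;> rcases u with _ | e' <;> simp only [mark]
  · split_ifs with h1
    · exact hω e' (Or.inr h1)
    · rfl
  · rw [hω e (Or.inl rfl)]
  · split_ifs with h1 h2
    · exact hω e' (Or.inr h1)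
    · rw [hω e (Or.inl rfl)]
    · rfl

theorem transProb_congr (h : AcceptanceFunction) (β₀ β : ℝ) {ω ω' : Env d} {a : Vertex d}
    (hω : ∀ e : Edge d, (some e = a ∨ parent (some e) = a) → ω e = ω' e) (u : Vertex d) :
    transProb h β₀ β ω a u = transProb h β₀ β ω' a u := by
  unfold transProb
  rw [mark_congr hω u, Finset.sum_congr rfl fun u _ => by rw [mark_congr hω u]]

/-- A nearest-neighbour path from the root up to time `k` (staying put being allowed). -/
def IsPath (k : ℕ) (x : ℕ → Vertex d) : Prop :=
  x 0 = root ∧ ∀ i < k, x (i + 1) = x i ∨ x (i + 1) ∈ neighbors (x i)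

/-- On a tree, the strict descendants of a vertex can only be entered through that vertex, and the
path starts at the root, which is a strict descendant of nothing. -/
theorem IsPath.avoids_subtree {k : ℕ} {x : ℕ → Vertex d} (hx : IsPath k x)
    (hnew : ∀ i < k, x i ≠ x k) : ∀ i < k, ¬StrictDesc (x k) (x i) := by
  intro i
  induction i with
  | zero =>
    intro _ hs
    rw [hx.1] at hs
    exact hs.ne_root rfl
  | succ i ih =>
    intro hi hs
    have h1 := ih (by omega)
    have h2 := hnew i (by omega)
    rcases hx.2 i (by omega) with h3 | h3
    · exact h1 (h3 ▸ hs)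
    · rcases mem_neighbors.1 h3 with ⟨-, h4⟩ | ⟨h4, h5⟩
      · rcases hs.parent_eq_or with h5 | h5
        · exact h2 (h4.symm.trans h5)
        · exact h1 (h4 ▸ h5)
      · exact h1 (.step h4 (h5 ▸ hs))

section Annealed

variable (h : AcceptanceFunction) (β₀ β : ℝ) (μ : Measure ℝ) [IsProbabilityMeasure μ]

/-- The annealed law of the trajectory. -/
noncomputable def walkLaw (d : ℕ) (h : AcceptanceFunction) (β₀ β : ℝ) (μ : Measure ℝ)
    [IsProbabilityMeasure μ] : Measure (ℕ → Vertex d) :=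
  (annealedLaw h β₀ β d μ).map Prod.snd

instance : IsProbabilityMeasure (annealedLaw h β₀ β d μ) := by
  unfold annealedLaw; infer_instance

instance : IsProbabilityMeasure (walkLaw d h β₀ β μ) :=
  Measure.isProbabilityMeasure_map measurable_snd.aemeasurable

variable {h β₀ β μ}

theorem walkLaw_apply {A : Set (ℕ → Vertex d)} (hA : MeasurableSet A) :
    walkLaw d h β₀ β μ A = ∫⁻ ω, quenchedLaw h β₀ β root ω A ∂envLaw d μ := by
  rw [walkLaw, Measure.map_apply measurable_snd hA, annealedLaw,
    Measure.compProd_apply (measurable_snd hA)]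
  rfl

theorem annealedLaw_preimage_le {A B : Set (ℕ → Vertex d)} (hAB : A ⊆ B) :
    annealedLaw h β₀ β d μ {x | x.2 ∈ A} ≤ walkLaw d h β₀ β μ B :=
  (measure_mono (t := Prod.snd ⁻¹' B) fun _ hx => hAB hx).trans
    (Measure.le_map_apply measurable_snd.aemeasurable B)

theorem measurable_quenchedLaw_apply (v : Vertex d) {A : Set (ℕ → Vertex d)}
    (hA : MeasurableSet A) : Measurable fun ω => quenchedLaw h β₀ β v ω A :=
  (Measure.measurable_coe hA).comp (measurable_quenchedLaw h β₀ β v)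

theorem quenchedLaw_pathCylinder_eq_zero {ω : Env d} {k : ℕ} {x : ℕ → Vertex d}
    (hx : ¬IsPath k x) : quenchedLaw h β₀ β root ω (pathCylinder k x) = 0 := by
  rw [quenchedLaw_pathCylinder]
  by_cases h0 : x 0 = root
  · have h1 : ∃ i < k, ¬(x (i + 1) = x i ∨ x (i + 1) ∈ neighbors (x i)) := by
      by_contra hcon
      push Not at hcon
      refine hx ⟨h0, fun i hi => ?_⟩
      by_cases h2 : x (i + 1) = x i
      · exact Or.inl h2
      · exact Or.inr ((hcon i hi).elim (fun h3 => absurd h3 h2) id)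
    obtain ⟨i, hi, h2⟩ := h1
    rw [not_or] at h2
    rw [Finset.prod_eq_zero (Finset.mem_range.2 hi), mul_zero]
    simp [transProb, h2.1, h2.2]
  · rw [Measure.dirac_apply' _ (measurableSet_singleton _),
      Set.indicator_of_notMem (fun hn => h0 (Set.mem_singleton_iff.1 hn).symm), zero_mul]

theorem walkLaw_ae_isPath : ∀ᵐ V ∂walkLaw d h β₀ β μ, ∀ k, IsPath k V := by
  rw [ae_all_iff]
  intro k
  have hA : Adapted k {V : ℕ → Vertex d | ¬IsPath k V} := by
    intro x y hxy hx hy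
    refine hx ⟨(hxy 0 (Nat.zero_le _)).trans hy.1, fun i hi => ?_⟩
    rw [hxy i hi.le, hxy (i + 1) hi]
    exact hy.2 i hi
  have hzero : walkLaw d h β₀ β μ {V : ℕ → Vertex d | ¬IsPath k V} = 0 := by
    rw [walkLaw_apply hA.measurableSet]
    refine (lintegral_congr fun ω => ?_).trans lintegral_zero
    rw [measure_eq_tsum_pathCylinder _ k hA.measurableSet]
    refine ENNReal.tsum_eq_zero.2 fun u => ?_
    by_cases hu : IsPath k (extendPath k u)
    · rw [hA.inter_eq_empty (fun hn => hn hu)]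
      simp
    · exact measure_mono_null Set.inter_subset_left (quenchedLaw_pathCylinder_eq_zero hu)
  exact hzero

/-- The edges strictly below a vertex. -/
def edgesBelow (v : Vertex d) : Set (Edge d) := {e | StrictDesc v (some e)}

/-- A step taken at a vertex reads the marks of its incident edges only. An edge strictly below x k
is incident only to x k and its strict descendants, none of which is visited before time k. -/
theorem dependsOn_quenchedLaw_pathCylinder {k : ℕ} {x : ℕ → Vertex d}
    (hnew : ∀ i < k, x i ≠ x k) :
    DependsOn (fun ω : Env d => quenchedLaw h β₀ β root ω (pathCylinder k x))
      (edgesBelow (x k))ᶜ := by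
  intro ω ω' hω
  by_cases hx : IsPath k x
  · simp only [quenchedLaw_pathCylinder]
    congr 1
    refine Finset.prod_congr rfl fun i hi => ?_
    rw [transProb_congr h β₀ β]
    rintro e he
    refine hω e fun hs => ?_
    have hi' := Finset.mem_range.1 hi
    have h1 := hx.avoids_subtree hnew i hi'
    rcases he with he | he
    · exact h1 (he ▸ hs)
    · rcases StrictDesc.parent_eq_or hs with h2 | h2
      · exact hnew i hi' (he.symm.trans h2)
      · exact h1 (he ▸ h2)
  · simp only [quenchedLaw_pathCylinder_eq_zero hx]

/-- A family of bounds for the quenched probabilities of an event, which only involve the part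
of the environment strictly below the starting point. -/
structure FreshBound (h : AcceptanceFunction) (β₀ β : ℝ) (E : Set (ℕ → Vertex d)) where
  /-- the bound -/
  toFun : Vertex d → Env d → ENNReal
  measurable : ∀ v, Measurable (toFun v)
  dependsOn : ∀ v, DependsOn (toFun v) (edgesBelow v)
  quenchedLaw_le : ∀ v ω, quenchedLaw h β₀ β v ω E ≤ toFun v ω

/-- When the walk discovers a new vertex, the environment below it is fresh. -/
theorem walkLaw_inter_shiftPath_le {k : ℕ} {F E : Set (ℕ → Vertex d)} (hF : Adapted k F)
    (hnew : ∀ V ∈ F, ∀ i < k, V i ≠ V k) (hE : MeasurableSet E) (g : FreshBound h β₀ β E)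
    {c : ENNReal} (hc : ∀ V ∈ F, ∫⁻ ω, g.toFun (V k) ω ∂envLaw d μ ≤ c) :
    walkLaw d h β₀ β μ (F ∩ shiftPath k ⁻¹' E) ≤ walkLaw d h β₀ β μ F * c := by
  have hk := measurable_shiftPath (d := d) k
  rw [measure_eq_tsum_pathCylinder _ k (hF.measurableSet.inter (hk hE)),
    measure_eq_tsum_pathCylinder _ k hF.measurableSet, ← ENNReal.tsum_mul_right]
  refine ENNReal.tsum_le_tsum fun u => ?_
  by_cases hu : extendPath k u ∈ F
  · set x := extendPath k u with hx
    rw [← Set.inter_assoc, Set.inter_eq_left.2 (hF.pathCylinder_subset hu),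
      walkLaw_apply ((measurableSet_pathCylinder _ _).inter (hk hE)),
      walkLaw_apply (measurableSet_pathCylinder _ _)]
    calc ∫⁻ ω, quenchedLaw h β₀ β root ω (pathCylinder k x ∩ shiftPath k ⁻¹' E) ∂envLaw d μ
        ≤ ∫⁻ ω, quenchedLaw h β₀ β root ω (pathCylinder k x) * g.toFun (x k) ω ∂envLaw d μ := by
          refine lintegral_mono fun ω => ?_
          rw [quenchedLaw_inter_shiftPath _ _ _ _ _ _ _ hE]
          gcongr
          exact g.quenchedLaw_le _ _
      _ = (∫⁻ ω, quenchedLaw h β₀ β root ω (pathCylinder k x) ∂envLaw d μ)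
            * ∫⁻ ω, g.toFun (x k) ω ∂envLaw d μ :=
          lintegral_mul_of_dependsOn μ disjoint_compl_left
            (measurable_quenchedLaw_apply root (measurableSet_pathCylinder _ _))
            (g.measurable _) (dependsOn_quenchedLaw_pathCylinder (hnew x hu)) (g.dependsOn _)
      _ ≤ _ := by
          gcongr
          exact hc _ hu
  · rw [← Set.inter_assoc, hF.inter_eq_empty hu]
    simp

theorem walkLaw_iUnion_inter_shiftPath_le {F : ℕ → Set (ℕ → Vertex d)} {E : Set (ℕ → Vertex d)}
    (hF : ∀ k, Adapted k (F k)) (hdisj : Pairwise (Function.onFun Disjoint F))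
    (hnew : ∀ k, ∀ V ∈ F k, ∀ i < k, V i ≠ V k) (hE : MeasurableSet E)
    (g : FreshBound h β₀ β E) {c : ENNReal}
    (hc : ∀ k, ∀ V ∈ F k, ∫⁻ ω, g.toFun (V k) ω ∂envLaw d μ ≤ c) :
    walkLaw d h β₀ β μ (⋃ k, F k ∩ shiftPath k ⁻¹' E) ≤ walkLaw d h β₀ β μ (⋃ k, F k) * c := by
  calc walkLaw d h β₀ β μ (⋃ k, F k ∩ shiftPath k ⁻¹' E)
      ≤ ∑' k, walkLaw d h β₀ β μ (F k ∩ shiftPath k ⁻¹' E) := measure_iUnion_le _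
    _ ≤ ∑' k, walkLaw d h β₀ β μ (F k) * c :=
        ENNReal.tsum_le_tsum fun k =>
          walkLaw_inter_shiftPath_le (hF k) (hnew k) hE g (hc k)
    _ = _ := by
        rw [ENNReal.tsum_mul_right, measure_iUnion hdisj fun k => (hF k).measurableSet]

/-- Events which require to leave the subtree of a newly discovered vertex many times. -/
theorem walkLaw_chain_le {C : ℕ → ℕ → Set (ℕ → Vertex d)} (hC : ∀ j k, Adapted k (C j k))
    (hdisj : ∀ j, Pairwise (Function.onFun Disjoint (C j)))
    (hnew : ∀ j k, ∀ V ∈ C j k, ∀ i < k, V i ≠ V k)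
    (hstep : ∀ j k, ∀ V ∈ C (j + 1) k, (∀ n, IsPath n V) →
      ∃ k', V ∈ C j k' ∧ shiftPath k' V ∈ exitEvent d)
    (g : FreshBound h β₀ β (exitEvent d)) {c : ENNReal}
    (hc : ∀ v, ∫⁻ ω, g.toFun v ω ∂envLaw d μ ≤ c) (j : ℕ) :
    walkLaw d h β₀ β μ (⋃ k, C j k) ≤ c ^ j := by
  induction j with
  | zero => simpa using prob_le_one
  | succ j ih =>
    calc walkLaw d h β₀ β μ (⋃ k, C (j + 1) k)
        ≤ walkLaw d h β₀ β μ (⋃ k, C j k ∩ shiftPath k ⁻¹' exitEvent d) := by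
          refine measure_mono_ae ?_
          filter_upwards [walkLaw_ae_isPath (h := h) (β₀ := β₀) (β := β) (μ := μ)] with V hV hmem
          obtain ⟨k, hk⟩ := Set.mem_iUnion.1 hmem
          obtain ⟨k', h1, h2⟩ := hstep j k V hk hV
          exact Set.mem_iUnion.2 ⟨k', h1, h2⟩
      _ ≤ walkLaw d h β₀ β μ (⋃ k, C j k) * c :=
          walkLaw_iUnion_inter_shiftPath_le (hC j) (hdisj j) (hnew j) measurableSet_exitEvent g
            fun k V _ => hc _
      _ ≤ _ := by
          rw [pow_succ]
          gcongr

/-! ### The bounds for the three events -/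

theorem strictDesc_of_append_firstChild (hd : 3 ≤ d) (v : Vertex d) (l : List (Fin (d - 1))) :
    StrictDesc v (some ((firstChild hd v).1, l ++ (firstChild hd v).2)) := by
  have h1 : StrictDesc v (some (firstChild hd v)) :=
    StrictDesc.child (by simp [root]) (parent_firstChild hd v)
  rcases l with _ | ⟨j, l⟩
  · exact h1
  · exact h1.trans (strictDesc_append _ _ _ (by simp))

theorem dependsOn_subMarks_firstChild (hd : 3 ≤ d) (v : Vertex d) :
    DependsOn (fun ω : Env d => subMarks (firstChild hd v) ω) (edgesBelow v) :=
  fun _ _ hω => funext fun l => hω _ (strictDesc_of_append_firstChild hd v l)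

/-- The bound for the event to leave the strict descendants of the start. -/
noncomputable def exitFreshBound (hd : 3 ≤ d) : FreshBound h β₀ β (exitEvent d) where
  toFun v ω := ENNReal.ofReal (1 - escape h β₀ β d (subMarks (firstChild hd v) ω))
  measurable v := (measurable_const.sub
    (measurable_escape.comp (measurable_subMarks _))).ennreal_ofReal
  dependsOn v _ _ hω := by
    simp only [show subMarks (firstChild hd v) _ = _ from dependsOn_subMarks_firstChild hd v hω]
  quenchedLaw_le v ω := quenchedLaw_exitEvent_le hd v ω

/-- The bound for the event to return often to the start. -/
noncomputable def returnFreshBound (hd : 3 ≤ d) (r : ℕ) :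
    FreshBound h β₀ β (returnEvent d r) where
  toFun v ω := ENNReal.ofReal ((1 - escape h β₀ β d (subMarks (firstChild hd v) ω)) ^ r)
  measurable v := ((measurable_const.sub
    (measurable_escape.comp (measurable_subMarks _))).pow_const r).ennreal_ofReal
  dependsOn v _ _ hω := by
    simp only [show subMarks (firstChild hd v) _ = _ from dependsOn_subMarks_firstChild hd v hω]
  quenchedLaw_le v ω := quenchedLaw_returnEvent_le hd v ω r

/-- The bound for the event to backtrack. -/
noncomputable def backtrackFreshBound (hd : 0 < d) (p : ℕ) (σ : Fin (d - 1) → Fin (d - 1))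
    {x : ℝ} (hx : 0 < x) (s : ℕ) : FreshBound h β₀ β (backtrackEvent d (s + 1)) where
  toFun v ω := backtrackBound h β₀ β d p σ x s ω v
  measurable v := by
    rcases v with _ | ⟨i, l⟩
    · exact measurable_const
    · exact measurable_const.add ((Finset.measurable_sum _ fun j _ =>
        (measurable_backtrackSum p σ s).comp (measurable_subMarks _)).const_mul _)
  dependsOn v ω ω' hω := by
    rcases v with _ | ⟨i, l⟩
    · rfl
    · simp only [backtrackBound]
      congr 2
      refine Finset.sum_congr rfl fun j _ => ?_
      congr 1
      refine funext fun t => hω _ ?_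
      change StrictDesc _ (some (i, t ++ ([j] ++ l)))
      rw [← List.append_assoc]
      exact strictDesc_append i l _ (by simp)
  quenchedLaw_le v ω := quenchedLaw_backtrackEvent_le hd p σ hx s v ω

theorem lintegral_exitFreshBound_le (hd : 3 ≤ d) {K : ℝ} (e : EnvEstimates d μ β₀ h K)
    (hβ : |β| ≤ K) (v : Vertex d) :
    ∫⁻ ω, (exitFreshBound (h := h) (β₀ := β₀) (β := β) hd).toFun v ω ∂envLaw d μ
      ≤ ENNReal.ofReal e.ρ := by
  refine le_of_eq_of_le ?_ (e.lintegral_one_sub β hβ)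
  exact lintegral_subMarks μ (firstChild hd v)
    (f := fun ξ => ENNReal.ofReal (1 - escape h β₀ β d ξ))
    (measurable_const.sub measurable_escape).ennreal_ofReal

theorem lintegral_returnFreshBound_le (hd : 3 ≤ d) {K : ℝ} (e : EnvEstimates d μ β₀ h K)
    (hβ : |β| ≤ K) {r : ℕ} (hr : 0 < r) (v : Vertex d) :
    ∫⁻ ω, (returnFreshBound (h := h) (β₀ := β₀) (β := β) hd r).toFun v ω ∂envLaw d μ
      ≤ ENNReal.ofReal (2 * Real.exp (-(e.c * (r : ℝ) ^ e.a))) := by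
  refine le_of_eq_of_le ?_ (e.lintegral_pow β hβ r hr)
  exact lintegral_subMarks μ (firstChild hd v)
    (f := fun ξ => ENNReal.ofReal ((1 - escape h β₀ β d ξ) ^ r))
    ((measurable_const.sub measurable_escape).pow_const r).ennreal_ofReal

/-- The root is excluded because it has d children, so that its subtree is not one of the (d -
1)-ary marked trees; the bound there is the trivial 1. -/
theorem lintegral_backtrackFreshBound_le (hd : 0 < d) {K : ℝ} (e : EnvEstimates d μ β₀ h K)
    (hβ : |β| ≤ K) {σ : Fin (d - 1) → Fin (d - 1)} (hσ : ∀ i, σ i ≠ i) {x : ℝ} (hx : 0 < x)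
    (s : ℕ) {v : Vertex d} (hv : v ≠ root) :
    ∫⁻ ω, (backtrackFreshBound (h := h) (β₀ := β₀) (β := β) hd e.p σ hx s).toFun v ω ∂envLaw d μ
      ≤ ENNReal.ofReal (x + x⁻¹ ^ e.p * (d * (1 / 4) ^ s)) := by
  rcases v with _ | ⟨i, l⟩
  · exact absurd rfl hv
  change ∫⁻ ω, (ENNReal.ofReal x + ENNReal.ofReal (x⁻¹ ^ e.p)
      * ∑ j, backtrackSum h β₀ β d e.p σ s (subMarks (i, j :: l) ω)) ∂envLaw d μ ≤ _
  have hm : ∀ j : Fin (d - 1),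
      Measurable fun ω => backtrackSum h β₀ β d e.p σ s (subMarks (i, j :: l) ω) := fun j =>
    (measurable_backtrackSum e.p σ s).comp (measurable_subMarks _)
  rw [lintegral_add_left measurable_const, lintegral_const_mul _
    (Finset.measurable_sum _ fun j _ => hm j), lintegral_finsetSum _ fun j _ => hm j]
  have h1 : ∀ j : Fin (d - 1), ∫⁻ ω, backtrackSum h β₀ β d e.p σ s (subMarks (i, j :: l) ω)
      ∂envLaw d μ ≤ ENNReal.ofReal (1 / 4) ^ s := fun j => by
    rw [lintegral_subMarks μ _ (measurable_backtrackSum e.p σ s), lintegral_backtrackSum e.p hσ]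
    gcongr
    exact e.lintegral_backtrack β hβ
  calc _ ≤ ENNReal.ofReal x + ENNReal.ofReal (x⁻¹ ^ e.p)
        * ∑ _j : Fin (d - 1), ENNReal.ofReal (1 / 4) ^ s := by
        rw [lintegral_const, measure_univ, mul_one]
        gcongr with j
        exact h1 j
    _ ≤ ENNReal.ofReal x + ENNReal.ofReal (x⁻¹ ^ e.p) * (d * ENNReal.ofReal (1 / 4) ^ s) := by
        gcongr
        rw [Finset.sum_const, Finset.card_univ, Fintype.card_fin, nsmul_eq_mul]
        gcongr
        omega
    _ = _ := by
        rw [ENNReal.ofReal_add hx.le (by positivity), ENNReal.ofReal_mul (p := x⁻¹ ^ e.p)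
          (by positivity), ENNReal.ofReal_mul (p := (d : ℝ)) (by positivity),
          ENNReal.ofReal_natCast, ENNReal.ofReal_pow (p := 1 / 4) (by norm_num)]

end Annealed

/-! ### Levels along a trajectory -/

theorem level_le_of_mem_neighbors {v w : Vertex d} (hw : w ∈ neighbors v) :
    level w ≤ level v + 1 ∧ level v ≤ level w + 1 := by
  rcases mem_neighbors.1 hw with ⟨h1, h2⟩ | ⟨h1, h2⟩
  · have := level_eq_level_parent_add_one h1
    rw [h2] at this
    omega
  · have := level_eq_level_parent_add_one h1
    rw [h2] at this
    omega

section Path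

variable {V : ℕ → Vertex d} (hV : ∀ k, IsPath k V)
include hV

theorem IsPath.level_succ_le (i : ℕ) :
    level (V (i + 1)) ≤ level (V i) + 1 ∧ level (V i) ≤ level (V (i + 1)) + 1 := by
  rcases (hV (i + 1)).2 i (Nat.lt_succ_self i) with h | h
  · rw [h]; omega
  · exact level_le_of_mem_neighbors h

theorem IsPath.level_zero : level (V 0) = 0 := by
  rw [(hV 0).1]; rfl

theorem IsPath.level_le (i : ℕ) : level (V i) ≤ i := by
  induction i with
  | zero => rw [IsPath.level_zero hV]
  | succ i ih => have := IsPath.level_succ_le hV i; omega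

theorem IsPath.exists_level_eq {L j : ℕ} (hL : L ≤ level (V j)) : ∃ i ≤ j, level (V i) = L := by
  induction j with
  | zero =>
    rw [IsPath.level_zero hV] at hL
    exact ⟨0, le_rfl, by rw [IsPath.level_zero hV]; omega⟩
  | succ j ih =>
    rcases le_or_gt L (level (V j)) with h | h
    · obtain ⟨i, hi, h'⟩ := ih h
      exact ⟨i, by omega, h'⟩
    · have := IsPath.level_succ_le hV j
      exact ⟨j + 1, le_rfl, by omega⟩

end Path

/-- Time `k` is the first visit of level `L`. -/
def FirstHit (L k : ℕ) (V : ℕ → Vertex d) : Prop :=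
  level (V k) = L ∧ ∀ i < k, level (V i) ≠ L

/-- A new vertex is visited at time `k`. -/
def NewVertex (k : ℕ) (V : ℕ → Vertex d) : Prop := ∀ i < k, V i ≠ V k

theorem FirstHit.newVertex {L k : ℕ} {V : ℕ → Vertex d} (hV : FirstHit L k V) : NewVertex k V :=
  fun i hi he => hV.2 i hi (he ▸ hV.1)

theorem FirstHit.unique {L k k' : ℕ} {V : ℕ → Vertex d} (h1 : FirstHit L k V)
    (h2 : FirstHit L k' V) : k = k' := by
  rcases lt_trichotomy k k' with h | h | h
  · exact absurd h1.1 (h2.2 k h)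
  · exact h
  · exact absurd h2.1 (h1.2 k' h)

theorem IsPath.exists_firstHit {V : ℕ → Vertex d} (hV : ∀ k, IsPath k V) {L j : ℕ}
    (hL : L ≤ level (V j)) : ∃ k ≤ j, FirstHit L k V := by
  classical
  obtain ⟨i, hi, h⟩ := IsPath.exists_level_eq hV hL
  have hex : ∃ i, level (V i) = L := ⟨i, h⟩
  exact ⟨Nat.find hex, (Nat.find_min' hex h).trans hi, Nat.find_spec hex,
    fun i hi => Nat.find_min hex hi⟩

theorem IsPath.firstHit_lt {V : ℕ → Vertex d} (hV : ∀ k, IsPath k V) {L L' k k' : ℕ}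
    (h1 : FirstHit L k V) (h2 : FirstHit L' k' V) (hL : L < L') : k < k' := by
  obtain ⟨i, hi, h3⟩ := IsPath.exists_firstHit hV (L := L) (j := k') (by rw [h2.1]; omega)
  rw [h1.unique h3]
  refine lt_of_le_of_ne hi fun he => ?_
  rw [he] at h3
  have := h3.1.symm.trans h2.1
  omega

theorem adapted_firstHit (L k : ℕ) : Adapted k {V : ℕ → Vertex d | FirstHit L k V} := by
  rintro x y hxy ⟨h1, h2⟩
  refine ⟨by rw [← hxy k le_rfl, h1], fun i hi => ?_⟩
  rw [← hxy i hi.le]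
  exact h2 i hi

theorem newVertex_congr {k : ℕ} {x y : ℕ → Vertex d} (hxy : ∀ i ≤ k, x i = y i) :
    NewVertex k x ↔ NewVertex k y := by
  refine forall₂_congr fun i hi => ?_
  rw [hxy i hi.le, hxy k le_rfl]

/-! ### Distinct vertices visited on a level -/

open Classical in
/-- The times before `k` at which a new vertex of level `L` is visited. -/
noncomputable def newTimes (L k : ℕ) (V : ℕ → Vertex d) : Finset ℕ :=
  (Finset.range k).filter fun i => NewVertex i V ∧ level (V i) = L

theorem mem_newTimes {L k i : ℕ} {V : ℕ → Vertex d} :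
    i ∈ newTimes L k V ↔ i < k ∧ NewVertex i V ∧ level (V i) = L := by
  simp [newTimes]

/-- Time `k` is the `(j + 1)`-st time at which a new vertex of level `L` is visited. -/
def newVertexEvent (d L j k : ℕ) : Set (ℕ → Vertex d) :=
  {V | NewVertex k V ∧ level (V k) = L ∧ (newTimes L k V).card = j}

theorem adapted_newVertexEvent (L j k : ℕ) : Adapted k (newVertexEvent d L j k) := by
  rintro x y hxy ⟨h1, h2, h3⟩
  refine ⟨(newVertex_congr hxy).1 h1, by rw [← hxy k le_rfl, h2], ?_⟩
  rw [← h3]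
  congr 1
  ext i
  simp only [mem_newTimes]
  refine and_congr_right fun hi => ?_
  rw [newVertex_congr fun j hj => hxy j (by omega), hxy i hi.le]

theorem newTimes_mono {L k k' : ℕ} (hk : k ≤ k') (V : ℕ → Vertex d) :
    newTimes L k V ⊆ newTimes L k' V := by
  intro i hi
  rw [mem_newTimes] at hi ⊢
  exact ⟨by omega, hi.2⟩

theorem disjoint_newVertexEvent (L j : ℕ) :
    Pairwise (Function.onFun Disjoint (newVertexEvent d L j)) := by
  have key : ∀ k k', k < k' → ∀ V : ℕ → Vertex d, V ∈ newVertexEvent d L j k →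
      V ∉ newVertexEvent d L j k' := by
    rintro k k' hlt V ⟨h1, h2, h3⟩ ⟨h1', h2', h3'⟩
    have hmem : k ∈ newTimes L k' V := mem_newTimes.2 ⟨hlt, h1, h2⟩
    have hnot : k ∉ newTimes L k V := fun h => lt_irrefl _ (mem_newTimes.1 h).1
    have := Finset.card_lt_card ((Finset.ssubset_iff_of_subset (newTimes_mono hlt.le V)).2
      ⟨k, hmem, hnot⟩)
    omega
  intro k k' hkk'
  refine Set.disjoint_left.2 fun V h1 h2 => ?_
  rcases lt_or_gt_of_ne hkk' with h | h
  · exact key k k' h V h1 h2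
  · exact key k' k h V h2 h1

/-- Between two discoveries on the same level the walk leaves the strict descendants of the first of
the two vertices. The relevant one is the latest earlier discovery, at time k'. -/
theorem newVertexEvent_succ {L j k : ℕ} {V : ℕ → Vertex d}
    (hV : V ∈ newVertexEvent d L (j + 1) k) :
    ∃ k', V ∈ newVertexEvent d L j k' ∧ shiftPath k' V ∈ exitEvent d := by
  obtain ⟨h1, h2, h3⟩ := hV
  have hne : (newTimes L k V).Nonempty := by
    rw [← Finset.card_pos, h3]; omega
  set k' := (newTimes L k V).max' hne with hk'
  obtain ⟨h4, h5, h6⟩ := mem_newTimes.1 ((newTimes L k V).max'_mem hne)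
  refine ⟨k', ⟨h5, h6, ?_⟩, k - k' - 1, ?_⟩
  · have : newTimes L k' V = (newTimes L k V).erase k' := by
      ext i
      rw [Finset.mem_erase, mem_newTimes]
      constructor
      · rintro ⟨h7, h8⟩
        exact ⟨h7.ne, mem_newTimes.2 ⟨by omega, h8⟩⟩
      · rintro ⟨h7, h8⟩
        exact ⟨lt_of_le_of_ne ((newTimes L k V).le_max' i h8) h7, (mem_newTimes.1 h8).2⟩
    rw [this, Finset.card_erase_of_mem ((newTimes L k V).max'_mem hne), h3]
    omega
  · have h4' : k' < k := h4
    have h7 : k - k' - 1 + 1 + k' = k := by omega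
    simp only [shiftPath, h7, Nat.zero_add]
    intro hs
    have hlt : level (V k') < level (V k) := hs.level_lt
    have h6' : level (V k') = L := h6
    rw [h6', h2] at hlt
    exact lt_irrefl _ hlt

theorem card_newTimes_le {L q : ℕ} {V : ℕ → Vertex d}
    (hV : V ∉ ⋃ k, newVertexEvent d L q k) (N : ℕ) : (newTimes L N V).card ≤ q := by
  classical
  induction N with
  | zero => simp [newTimes]
  | succ N ih =>
    by_cases hN : NewVertex N V ∧ level (V N) = L
    · have h1 : (newTimes L N V).card ≠ q := fun h =>
        hV (Set.mem_iUnion.2 ⟨N, hN.1, hN.2, h⟩)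
      have h2 : newTimes L (N + 1) V = insert N (newTimes L N V) := by
        rw [newTimes, Finset.range_add_one, Finset.filter_insert, if_pos hN, newTimes]
      have := Finset.card_insert_le N (newTimes L N V)
      rw [h2]
      omega
    · have h2 : newTimes L (N + 1) V = newTimes L N V := by
        rw [newTimes, Finset.range_add_one, Finset.filter_insert, if_neg hN, newTimes]
      rw [h2]
      exact ih

/-! ### Number of visits -/

-- The visit at time 0 is counted as well, so fewer than r returns give at most r visits.
open Classical in
theorem card_visits_le {r : ℕ} {V : ℕ → Vertex d} (hV : V ∉ returnEvent d r) (N : ℕ) :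
    ((Finset.range N).filter fun j => V j = V 0).card ≤ r := by
  induction r generalizing V N with
  | zero => exact absurd (Set.mem_univ V) hV
  | succ r ih =>
    by_cases hex : ∃ k, 0 < k ∧ V k = V 0
    · obtain ⟨h1, h2⟩ := Nat.find_spec hex
      set k := Nat.find hex with hk
      have hmin : ∀ j, 0 < j → j < k → V j ≠ V 0 := fun j hj hjk he =>
        Nat.find_min hex hjk ⟨hj, he⟩
      have h3 : shiftPath k V ∉ returnEvent d r := fun h =>
        hV (Set.mem_iUnion.2 ⟨k, ⟨h1, h2, hmin⟩, h⟩)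
      have h4 := ih h3 N
      have h5 : (Finset.range N).filter (fun j => V j = V 0) ⊆ insert 0
          (((Finset.range N).filter fun j => shiftPath k V j = shiftPath k V 0).image
            (· + k)) := by
        intro j hj
        rw [Finset.mem_filter, Finset.mem_range] at hj
        rw [Finset.mem_insert, Finset.mem_image]
        rcases Nat.eq_zero_or_pos j with rfl | hj0
        · exact Or.inl rfl
        · have h6 : k ≤ j := by
            by_contra hlt
            exact hmin j hj0 (not_le.1 hlt) hj.2
          refine Or.inr ⟨j - k, ?_, Nat.sub_add_cancel h6⟩
          rw [Finset.mem_filter, Finset.mem_range]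
          refine ⟨by omega, ?_⟩
          simp only [shiftPath, Nat.sub_add_cancel h6, Nat.zero_add]
          rw [hj.2, h2]
      refine (Finset.card_le_card h5).trans ((Finset.card_insert_le _ _).trans ?_)
      have := Finset.card_image_le (s := (Finset.range N).filter
        fun j => shiftPath k V j = shiftPath k V 0) (f := (· + k))
      omega
    · have h5 : (Finset.range N).filter (fun j => V j = V 0) ⊆ {0} := by
        intro j hj
        rw [Finset.mem_filter] at hj
        rw [Finset.mem_singleton]
        by_contra hj0
        exact hex ⟨j, Nat.pos_of_ne_zero hj0, hj.2⟩
      refine (Finset.card_le_card h5).trans ?_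
      simp

open Classical in
theorem card_visits_shift_le {r i : ℕ} {V : ℕ → Vertex d}
    (hnew : NewVertex i V) (hV : shiftPath i V ∉ returnEvent d r) (S : Finset ℕ) :
    (S.filter fun j => V j = V i).card ≤ r := by
  have h1 := card_visits_le hV (S.sup id + 1)
  have h2 : S.filter (fun j => V j = V i) ⊆ ((Finset.range (S.sup id + 1)).filter
      fun j => shiftPath i V j = shiftPath i V 0).image (· + i) := by
    intro j hj
    rw [Finset.mem_filter] at hj
    have hij : i ≤ j := by
      by_contra hlt
      exact hnew j (not_le.1 hlt) hj.2
    refine Finset.mem_image.2 ⟨j - i, ?_, Nat.sub_add_cancel hij⟩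
    have hle : j ≤ S.sup id := Finset.le_sup (f := id) hj.1
    rw [Finset.mem_filter, Finset.mem_range]
    refine ⟨by omega, ?_⟩
    simp only [shiftPath, Nat.sub_add_cancel hij, Nat.zero_add]
    exact hj.2
  exact (Finset.card_le_card h2).trans (Finset.card_image_le.trans h1)

/-- A trajectory which stays for a long time between two levels visits many vertices of some
level, or some vertex many times. -/
theorem exists_level_ge {V : ℕ → Vertex d} (hV : ∀ k, IsPath k V) {T r q N n k L : ℕ}
    (hT : k + n ≤ T)
    (h1 : ∀ i ≤ T, NewVertex i V → shiftPath i V ∉ returnEvent d r)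
    (h2 : ∀ l ≤ T, V ∉ ⋃ k, newVertexEvent d l q k)
    (hL : ∀ j > k, L ≤ level (V j)) (hn : N * q * r < n) :
    ∃ j, j ≤ k + n ∧ L + N ≤ level (V j) := by
  classical
  by_contra hcon
  push Not at hcon
  have hex : ∀ j, ∃ i, V i = V j := fun j => ⟨j, rfl⟩
  -- Each time is sent to the discovery time of the current vertex. At most r times share a vertex
  -- and at most q vertices share a level, so staying in N levels allows at most N q r steps.
  set φ : ℕ → ℕ := fun j => Nat.find (hex j) with hφ
  have hφ1 : ∀ j, V (φ j) = V j := fun j => Nat.find_spec (hex j)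
  have hφ2 : ∀ j, φ j ≤ j := fun j => Nat.find_min' (hex j) rfl
  have hφ3 : ∀ j, NewVertex (φ j) V := fun j i hi he =>
    Nat.find_min (hex j) hi (he.trans (hφ1 j))
  set S := Finset.Ioc k (k + n) with hS
  have hc1 : S.card ≤ r * (S.image φ).card := by
    refine Finset.card_le_mul_card_image S r fun i hi => ?_
    obtain ⟨j, hj, rfl⟩ := Finset.mem_image.1 hi
    rw [hS, Finset.mem_Ioc] at hj
    refine le_trans (Finset.card_le_card ?_)
      (card_visits_shift_le (hφ3 j) (h1 (φ j) ((hφ2 j).trans (by omega)) (hφ3 j)) S)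
    intro j' hj'
    rw [Finset.mem_filter] at hj' ⊢
    exact ⟨hj'.1, by rw [← hj'.2, hφ1]⟩
  have hc2 : (S.image φ).card ≤ q * (Finset.Ico L (L + N)).card := by
    refine Finset.card_le_mul_card_image_of_maps_to (f := fun i => level (V i)) ?_ q ?_
    · intro i hi
      obtain ⟨j, hj, rfl⟩ := Finset.mem_image.1 hi
      rw [hS, Finset.mem_Ioc] at hj
      simp only [hφ1, Finset.mem_Ico]
      exact ⟨hL j hj.1, hcon j hj.2⟩
    · intro l hl
      by_cases hlT : l ≤ T
      · refine le_trans (Finset.card_le_card ?_) (card_newTimes_le (h2 l hlT) (T + 1))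
        intro i hi
        rw [Finset.mem_filter] at hi
        obtain ⟨j, hj, rfl⟩ := Finset.mem_image.1 hi.1
        rw [hS, Finset.mem_Ioc] at hj
        exact mem_newTimes.2 ⟨by have := hφ2 j; omega, hφ3 j, hi.2⟩
      -- Levels above T cannot be reached by time T, so the hypothesis is only needed up to T.
      · refine le_of_eq_of_le (Finset.card_eq_zero.2 ?_) (Nat.zero_le q)
        rw [Finset.filter_eq_empty_iff]
        rintro i hi he
        obtain ⟨j, hj, rfl⟩ := Finset.mem_image.1 hi
        rw [hS, Finset.mem_Ioc] at hj
        have := IsPath.level_le hV (φ j)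
        have := hφ2 j
        omega
  have hS' : S.card = n := by rw [hS, Nat.card_Ioc]; omega
  rw [hS'] at hc1
  rw [Nat.card_Ico] at hc2
  have h3 : r * (S.image φ).card ≤ r * (q * N) :=
    Nat.mul_le_mul_left r (hc2.trans (by rw [Nat.add_sub_cancel_left]))
  have h4 : r * (q * N) = N * q * r := by ring
  omega

/-! ### Regeneration attempts -/

/-- The regeneration attempts on the levels `L, L + s, …, L + (j - 1) s` have failed before the
first visit of level `L + j s`, which takes place at time `k`. -/
def failEvent (d L s : ℕ) : ℕ → ℕ → Set (ℕ → Vertex d)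
  | 0, k => {V | FirstHit L k V}
  | j + 1, k => {V | FirstHit (L + (j + 1) * s) k V ∧ ∃ k' < k, V ∈ failEvent d L s j k' ∧
      ∃ i, k' < i ∧ i ≤ k ∧ ¬StrictDesc (V k') (V i)}

theorem firstHit_of_mem_failEvent {L s j k : ℕ} {V : ℕ → Vertex d}
    (hV : V ∈ failEvent d L s j k) : FirstHit (L + j * s) k V := by
  cases j with
  | zero => simpa [failEvent] using hV
  | succ j => exact hV.1

theorem adapted_failEvent (L s j k : ℕ) : Adapted k (failEvent d L s j k) := by
  induction j generalizing k with
  | zero => exact adapted_firstHit L k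
  | succ j ih =>
    rintro x y hxy ⟨h1, k', hk', h2, i, hi, hik, h3⟩
    refine ⟨adapted_firstHit _ k x y hxy h1, k', hk', ih k' x y (fun i hi => hxy i (by omega)) h2,
      i, hi, hik, ?_⟩
    rwa [← hxy k' hk'.le, ← hxy i hik]

theorem disjoint_failEvent (L s j : ℕ) :
    Pairwise (Function.onFun Disjoint (failEvent d L s j)) :=
  fun _ _ hkk' => Set.disjoint_left.2 fun _ h1 h2 =>
    hkk' ((firstHit_of_mem_failEvent h1).unique (firstHit_of_mem_failEvent h2))

theorem failEvent_succ {L s j k : ℕ} {V : ℕ → Vertex d} (hV : V ∈ failEvent d L s (j + 1) k) :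
    ∃ k', V ∈ failEvent d L s j k' ∧ shiftPath k' V ∈ exitEvent d := by
  obtain ⟨-, k', hk', h2, i, hi, hik, h3⟩ := hV
  refine ⟨k', h2, i - k' - 1, ?_⟩
  have h7 : i - k' - 1 + 1 + k' = i := by omega
  simpa only [shiftPath, h7, Nat.zero_add] using h3

/-- If every attempt launched from the first visits of the levels L, L + s, … failed before the next
of these levels was reached, the failures would accumulate to `failEvent` with index m. -/
theorem exists_successful_attempt {V : ℕ → Vertex d} (hV : ∀ k, IsPath k V) {L s m T : ℕ}
    (hs : 0 < s) (hfail : V ∉ ⋃ k, failEvent d L s m k) (hT : L + m * s ≤ level (V T)) :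
    ∃ j a b, FirstHit (L + j * s) a V ∧ FirstHit (L + (j + 1) * s) b V ∧ a < b ∧ b ≤ T ∧
      ∀ i, a < i → i ≤ b → StrictDesc (V a) (V i) := by
  by_contra hcon
  push Not at hcon
  have key : ∀ j ≤ m, ∃ k ≤ T, V ∈ failEvent d L s j k := by
    intro j
    induction j with
    | zero =>
      intro _
      obtain ⟨k, hk, h⟩ := IsPath.exists_firstHit hV (L := L) (j := T) (by omega)
      exact ⟨k, hk, h⟩
    | succ j ih =>
      intro hj
      obtain ⟨a, -, h1⟩ := ih (by omega)
      have h2 := firstHit_of_mem_failEvent h1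
      have h3 : (j + 1) * s ≤ m * s := Nat.mul_le_mul_right s hj
      obtain ⟨b, hb, h4⟩ := IsPath.exists_firstHit hV (L := L + (j + 1) * s) (j := T) (by omega)
      have h5 : a < b := IsPath.firstHit_lt hV h2 h4 (by rw [add_mul]; omega)
      obtain ⟨i, h6, h7, h8⟩ := hcon j a b h2 h4 h5 hb
      exact ⟨b, hb, h4, a, h5, h1, i, h6, h7, h8⟩
  obtain ⟨k, -, h⟩ := key m le_rfl
  exact hfail (Set.mem_iUnion.2 ⟨k, h⟩)

/-- The trajectories which regenerate regularly up to time `T`. -/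
structure IsGood (d T t : ℕ) (V : ℕ → Vertex d) : Prop where
  isPath : ∀ k, IsPath k V
  visits : ∀ k ≤ T, NewVertex k V → shiftPath k V ∉ returnEvent d t
  vertices : ∀ L ≤ T, V ∉ ⋃ k, newVertexEvent d L t k
  backtrack : ∀ L ≤ T, 0 < L → ∀ k, FirstHit L k V → shiftPath k V ∉ backtrackEvent d t
  attempts : ∀ L ≤ T, V ∉ ⋃ k, failEvent d (L + 1) t t k

/-- The t attempts start at level L + 1, strictly above anything seen up to time k, and occupy t²
levels; this is why a gain of t² + 1 levels is required. A successful attempt goes t levels down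
inside the strict descendants of V a. Not backtracking afterwards, the walk stays there forever, so
a is a regeneration time. -/
theorem IsGood.exists_regeneration {T t n k : ℕ} {V : ℕ → Vertex d} (hV : IsGood d T t V)
    (ht : 0 < t) (hn : (t * t + 1) * t * t < n) (hT : k + n ≤ T)
    (hpast : ∀ j ≤ k, level (V j) ≤ level (V k)) (hfut : ∀ j > k, level (V k) ≤ level (V j)) :
    ∃ a, k < a ∧ a ≤ k + n ∧ IsLevelRegeneration V a := by
  have hP := hV.isPath
  set L := level (V k) with hL
  obtain ⟨T', hT', h1⟩ := exists_level_ge hP hT hV.visits hV.vertices hfut hn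
  have hLk := IsPath.level_le hP k
  obtain ⟨j, a, b, h2, h3, hab, hb, h4⟩ := exists_successful_attempt hP ht
    (hV.attempts L (by omega)) (T := T') (by omega)
  have hka : k < a := by
    by_contra hle
    have := hpast a (not_lt.1 hle)
    rw [h2.1] at this
    omega
  -- The start at L + 1 also guarantees a positive level, as the backtracking bound requires.
  have h5 := hV.backtrack (L + 1 + j * t)
    (by rw [← h2.1]; exact (IsPath.level_le hP a).trans (by omega)) (by omega) a h2
  have h6 : ∀ i, a < i → StrictDesc (V a) (V i) := by
    intro i hi
    rcases le_or_gt i b with hib | hib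
    · exact h4 i hi hib
    · by_contra hns
      refine h5 ⟨b - a, fun j' hj' hjb => ?_, ?_, i - b, ?_⟩
      · simp only [shiftPath, Nat.zero_add]
        exact h4 _ (by omega) (by omega)
      · simp only [shiftPath, Nat.zero_add, Nat.sub_add_cancel hab.le, h2.1, h3.1]
        ring
      · have : i - b + (b - a) + a = i := by omega
        simpa only [shiftPath, Nat.zero_add, this] using hns
  refine ⟨a, hka, by omega, fun i hi => by rw [h2.1]; exact h2.2 i hi, ?_, fun i hi =>
    (h6 i hi).level_lt.ne'⟩
  have := (h6 (a + 1) (Nat.lt_succ_self a)).level_lt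
  have := (IsPath.level_succ_le hP a).1
  omega

theorem IsLevelRegeneration.level_le {V : ℕ → Vertex d} (hV : ∀ k, IsPath k V) {k : ℕ}
    (hk : IsLevelRegeneration V k) : ∀ j ≤ k, level (V j) ≤ level (V k) := by
  intro j hj
  by_contra hlt
  obtain ⟨i, hi, h⟩ := IsPath.exists_level_eq hV (not_le.1 hlt).le
  have hne : i ≠ j := fun he => by rw [he] at h; omega
  exact hk.1 i (by omega) h

theorem IsLevelRegeneration.le_level {V : ℕ → Vertex d} (hV : ∀ k, IsPath k V) {k : ℕ}
    (hk : IsLevelRegeneration V k) : ∀ j > k, level (V k) ≤ level (V j) := by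
  intro j hj
  induction j, hj using Nat.le_induction with
  | base => rw [hk.2.1]; omega
  | succ j hj ih =>
    have h1 := hk.2.2 j hj
    have := IsPath.level_succ_le hV j
    omega

/-- Time 0 and a regeneration time share the two properties needed to launch the search: the past
lies weakly below the current level and the future weakly above it. Two searches of n steps each fit
into the horizon 2n. -/
theorem IsGood.regenTime_le {t n : ℕ} {V : ℕ → Vertex d} (hV : IsGood d (2 * n) t V)
    (ht : 0 < t) (hn : (t * t + 1) * t * t < n) :
    regenTime V 1 ≤ n ∧ regenTime V 2 - regenTime V 1 ≤ n := by
  classical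
  have hP := hV.isPath
  have hle : ∀ (m k : ℕ), regenTime V m < k → IsLevelRegeneration V k →
      regenTime V (m + 1) ≤ k := fun m k h1 h2 => iInf₂_le k ⟨h1, h2⟩
  obtain ⟨a, ha, han, hreg⟩ := hV.exists_regeneration (k := 0) ht hn (by omega)
    (fun j hj => by obtain rfl : j = 0 := by omega
                    exact le_rfl)
    (fun j _ => by rw [IsPath.level_zero hP]; omega)
  have hex : ∃ k, 0 < k ∧ IsLevelRegeneration V k := ⟨a, ha, hreg⟩
  obtain ⟨hk1, hk2⟩ := Nat.find_spec hex
  have hkle : Nat.find hex ≤ n := (Nat.find_min' hex ⟨ha, hreg⟩).trans (by omega)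
  set k := Nat.find hex with hk
  have h1 : regenTime V 1 = k := by
    refine le_antisymm (hle 0 k (by simpa [regenTime] using hk1) hk2) ?_
    refine le_iInf₂ fun j hj => ?_
    have hj0 : 0 < j := by simpa [regenTime] using hj.1
    exact_mod_cast Nat.find_min' hex ⟨hj0, hj.2⟩
  refine ⟨by rw [h1]; exact_mod_cast hkle, ?_⟩
  obtain ⟨a', ha', han', hreg'⟩ := hV.exists_regeneration (k := k) ht hn (by omega)
    (hk2.level_le hP) (hk2.le_level hP)
  rw [tsub_le_iff_left, h1]
  refine (hle 1 a' (by rw [h1]; exact_mod_cast ha') hreg').trans ?_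
  exact_mod_cast han'

/-! ### The probability that a trajectory is not good -/

section Bounds

variable {h : AcceptanceFunction} {β₀ β K : ℝ} {μ : Measure ℝ} [IsProbabilityMeasure μ]

theorem setOf_not_isGood_subset (T t : ℕ) :
    {V : ℕ → Vertex d | ¬IsGood d T t V} ⊆ {V | ¬∀ k, IsPath k V} ∪
      ⋃ k ∈ Finset.range (T + 1), (({V | NewVertex k V} ∩ shiftPath k ⁻¹' returnEvent d t) ∪
        (⋃ i, newVertexEvent d k t i)) ∪
        ((⋃ i, {V | 0 < k ∧ FirstHit k i V} ∩ shiftPath i ⁻¹' backtrackEvent d t) ∪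
        ⋃ i, failEvent d (k + 1) t t i) := by
  intro V hV
  by_contra hcon
  simp only [Set.mem_union, not_or, Set.mem_iUnion₂, not_exists] at hcon
  obtain ⟨h1, h2⟩ := hcon
  have h2' := fun k (hk : k ≤ T) => h2 k (Finset.mem_range.2 (Nat.lt_succ_of_le hk))
  refine hV ⟨not_not.1 h1, fun k hk hn hr => (h2' k hk).1.1 ⟨hn, hr⟩,
    fun L hL => (h2' L hL).1.2, fun L hL hL0 k hk hb => (h2' L hL).2.1 ?_,
    fun L hL => (h2' L hL).2.2⟩
  exact Set.mem_iUnion.2 ⟨k, ⟨hL0, hk⟩, hb⟩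

theorem walkLaw_not_isGood_le (hd : 3 ≤ d) (e : EnvEstimates d μ β₀ h K) (hβ : |β| ≤ K)
    (T s : ℕ) {x : ℝ} (hx : 0 < x) :
    walkLaw d h β₀ β μ {V | ¬IsGood d T (s + 1) V} ≤ ∑ _k ∈ Finset.range (T + 1),
      ((ENNReal.ofReal (2 * Real.exp (-(e.c * ((s + 1 : ℕ) : ℝ) ^ e.a)))
        + ENNReal.ofReal e.ρ ^ (s + 1))
      + (ENNReal.ofReal (x + x⁻¹ ^ e.p * (d * (1 / 4) ^ s)) + ENNReal.ofReal e.ρ ^ (s + 1))) := by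
  have hd0 : 0 < d := by omega
  have : Nontrivial (Fin (d - 1)) := Fin.nontrivial_iff_two_le.2 (by omega)
  -- As d - 1 ≥ 2, every child has a sibling, along which the escape is estimated.
  choose σ hσ using fun i : Fin (d - 1) => exists_ne i
  have hpath : walkLaw d h β₀ β μ {V | ¬∀ k, IsPath k V} = 0 := walkLaw_ae_isPath
  refine (measure_mono (setOf_not_isGood_subset T (s + 1))).trans
    ((measure_union_le _ _).trans ?_)
  rw [hpath, zero_add]
  refine (measure_biUnion_finset_le _ _).trans (Finset.sum_le_sum fun k _ => ?_)
  refine (measure_union_le _ _).trans (add_le_add ((measure_union_le _ _).trans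
    (add_le_add ?_ ?_)) ((measure_union_le _ _).trans (add_le_add ?_ ?_)))
  · refine (walkLaw_inter_shiftPath_le (fun x y hxy hx => (newVertex_congr hxy).1 hx)
      (fun V hV => hV) (measurableSet_returnEvent (s + 1)) (returnFreshBound hd (s + 1))
      fun V _ => lintegral_returnFreshBound_le hd e hβ (Nat.succ_pos s) (V k)).trans ?_
    exact (mul_le_mul_left prob_le_one _).trans_eq (one_mul _)
  · exact walkLaw_chain_le (adapted_newVertexEvent k) (disjoint_newVertexEvent k)
      (fun j i V hV => hV.1) (fun j i V hV _ => newVertexEvent_succ hV) (exitFreshBound hd)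
      (lintegral_exitFreshBound_le hd e hβ) (s + 1)
  · refine (walkLaw_iUnion_inter_shiftPath_le (F := fun i => {V | 0 < k ∧ FirstHit k i V})
      (fun i x y hxy hx => ⟨hx.1, adapted_firstHit k i x y hxy hx.2⟩)
      (fun i j hij => Set.disjoint_left.2 fun V h1 h2 => hij (h1.2.unique h2.2))
      (fun i V hV => hV.2.newVertex) (measurableSet_backtrackEvent (s + 1))
      (backtrackFreshBound hd0 e.p σ hx s) fun i V hV =>
        lintegral_backtrackFreshBound_le hd0 e hβ hσ hx s fun hr => ?_).trans ?_
    · have h1 := hV.2.1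
      rw [hr] at h1
      exact hV.1.ne h1
    · exact (mul_le_mul_left prob_le_one _).trans_eq (one_mul _)
  · exact walkLaw_chain_le (adapted_failEvent (k + 1) (s + 1)) (disjoint_failEvent (k + 1) (s + 1))
      (fun j i V hV => (firstHit_of_mem_failEvent hV).newVertex)
      (fun j i V hV _ => failEvent_succ hV) (exitFreshBound hd)
      (lintegral_exitFreshBound_le hd e hβ) (s + 1)

/-- Taking x = y^s in the backtracking bound, the factor x^(-p) is at most 2^s, which the 4^(-s)
from the moment estimate absorbs. -/
theorem exists_backtrack_rate {p : ℕ} (hp : 0 < p) :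
    ∃ y : ℝ, 1 / 2 ≤ y ∧ y < 1 ∧ 1 / 2 ≤ y ^ p := by
  have hp' : (1 : ℝ) ≤ p := by exact_mod_cast hp
  refine ⟨1 + -(1 / (2 * p)), ?_, ?_, ?_⟩
  · have : 1 / (2 * (p : ℝ)) ≤ 1 / 2 := one_div_le_one_div_of_le two_pos (by linarith)
    linarith
  · have : 0 < 1 / (2 * (p : ℝ)) := by positivity
    linarith
  · have h1 : 1 / (2 * (p : ℝ)) ≤ 1 / 2 := one_div_le_one_div_of_le two_pos (by linarith)
    refine le_trans (le_of_eq ?_) (one_add_mul_le_pow (by linarith) p)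
    field_simp
    ring

theorem backtrack_rate_le {p : ℕ} {y : ℝ} (hy : 1 / 2 ≤ y) (hyp : 1 / 2 ≤ y ^ p) (d s : ℕ) :
    y ^ s + (y ^ s)⁻¹ ^ p * (d * (1 / 4) ^ s) ≤ (d + 1) * y ^ s := by
  have hy0 : 0 < y := by linarith
  have h1 : (y ^ s)⁻¹ ^ p ≤ 2 ^ s := by
    rw [inv_pow, ← pow_mul, mul_comm, pow_mul, ← inv_pow]
    refine pow_le_pow_left₀ (by positivity) ?_ s
    rw [inv_le_comm₀ (by linarith) two_pos]
    linarith
  have h2 : (2 : ℝ) ^ s * (1 / 4) ^ s ≤ y ^ s := by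
    rw [← mul_pow]
    exact pow_le_pow_left₀ (by norm_num) (by linarith) s
  have h3 : (y ^ s)⁻¹ ^ p * (d * (1 / 4) ^ s) ≤ 2 ^ s * (d * (1 / 4) ^ s) :=
    mul_le_mul_of_nonneg_right h1 (by positivity)
  have h4 : (d : ℝ) * (2 ^ s * (1 / 4) ^ s) ≤ d * y ^ s :=
    mul_le_mul_of_nonneg_left h2 (Nat.cast_nonneg d)
  linarith [mul_left_comm ((2 : ℝ) ^ s) d ((1 / 4) ^ s)]

theorem pow_le_exp_neg_mul_rpow {y a c : ℝ} (hy : 0 < y) (hc : c ≤ -Real.log y) (hc0 : 0 ≤ c)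
    (ha : a ≤ 1) {t : ℕ} (ht : 0 < t) : y ^ t ≤ Real.exp (-(c * (t : ℝ) ^ a)) := by
  have ht' : (1 : ℝ) ≤ t := by exact_mod_cast ht
  have h1 : (t : ℝ) ^ a ≤ t := by
    simpa using Real.rpow_le_rpow_of_exponent_le ht' ha
  rw [← Real.exp_log (pow_pos hy t), Real.log_pow, Real.exp_le_exp]
  nlinarith

/-- The three geometric terms also decay at least like exp(-c t^a) because a ≤ 1; the slowest decay
comes from the return probabilities. -/
theorem exists_walkLaw_not_isGood_le (hd : 3 ≤ d) (e : EnvEstimates d μ β₀ h K) :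
    ∃ C c : ℝ, 0 < C ∧ 0 < c ∧ ∀ β, |β| ≤ K → ∀ T t : ℕ, 0 < t →
      walkLaw d h β₀ β μ {V | ¬IsGood d T t V}
        ≤ ENNReal.ofReal ((T + 1) * (C * Real.exp (-(c * (t : ℝ) ^ e.a)))) := by
  obtain ⟨y, hy, hy1, hyp⟩ := exists_backtrack_rate e.p_pos
  have hy0 : 0 < y := by linarith
  have hlogρ := Real.log_neg e.ρ_pos e.ρ_lt_one
  have hlogy := Real.log_neg hy0 hy1
  set c := min e.c (min (-Real.log e.ρ) (-Real.log y)) with hcdef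
  have hc0 : 0 < c := lt_min e.c_pos (lt_min (by linarith) (by linarith))
  have hc1 : c ≤ e.c := min_le_left _ _
  have hc2 : c ≤ -Real.log e.ρ := (min_le_right _ _).trans (min_le_left _ _)
  have hc3 : c ≤ -Real.log y := (min_le_right _ _).trans (min_le_right _ _)
  -- 2 for the returns, 1 each for the new vertices and the failed attempts, and (d + 1)/y for
  -- backtracking, where 1/y shifts the exponent from s to s + 1 = t.
  refine ⟨4 + (d + 1) / y, c, by positivity, hc0, fun β hβ T t ht => ?_⟩
  obtain ⟨s, rfl⟩ := Nat.exists_eq_succ_of_ne_zero ht.ne'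
  set E := Real.exp (-(c * ((s + 1 : ℕ) : ℝ) ^ e.a)) with hE
  have h1 : 2 * Real.exp (-(e.c * ((s + 1 : ℕ) : ℝ) ^ e.a)) ≤ 2 * E := by
    refine mul_le_mul_of_nonneg_left (Real.exp_le_exp.2 (neg_le_neg ?_)) two_pos.le
    exact mul_le_mul_of_nonneg_right hc1 (by positivity)
  have h2 : e.ρ ^ (s + 1) ≤ E := pow_le_exp_neg_mul_rpow e.ρ_pos hc2 hc0.le e.a_le_one ht
  have h3 : y ^ (s + 1) ≤ E := pow_le_exp_neg_mul_rpow hy0 hc3 hc0.le e.a_le_one ht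
  have h4 : y ^ s + (y ^ s)⁻¹ ^ e.p * (d * (1 / 4) ^ s) ≤ (d + 1) / y * E := by
    refine (backtrack_rate_le hy hyp d s).trans ?_
    have : y ^ s = y ^ (s + 1) / y := by rw [pow_succ]; field_simp
    rw [this, ← mul_div_assoc, div_mul_eq_mul_div]
    gcongr
  refine (walkLaw_not_isGood_le hd e hβ T s (pow_pos hy0 s)).trans ?_
  rw [Finset.sum_const, Finset.card_range, nsmul_eq_mul,
    ENNReal.ofReal_mul (by positivity : (0 : ℝ) ≤ T + 1)]
  have hT : ENNReal.ofReal ((T : ℝ) + 1) = ((T + 1 : ℕ) : ENNReal) := by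
    rw [← ENNReal.ofReal_natCast]
    push_cast
    rfl
  rw [hT]
  refine mul_le_mul_right ?_ _
  have hρ : (0 : ℝ) ≤ e.ρ ^ (s + 1) := pow_nonneg e.ρ_pos.le _
  rw [← ENNReal.ofReal_pow e.ρ_pos.le, ← ENNReal.ofReal_add (by positivity) hρ,
    ← ENNReal.ofReal_add (by positivity) hρ, ← ENNReal.ofReal_add (by positivity) (by positivity)]
  refine ENNReal.ofReal_le_ofReal ?_
  linarith [add_mul 4 ((d + 1) / y) E]

end Bounds

/-! ### Choice of the parameters -/

-- With t the integer part of n^(1/5), one has (t² + 1) t² < t⁵ ≤ n as soon as t ≥ 2, which is the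
-- reason for n ≥ 32. Put z = n^(a/10): then t^a ≥ z² / 2, so c t^a ≥ 2z for large n. One factor
-- exp(-z) absorbs the union bound over 2n + 1 levels, and the other is the claimed estimate.
open Filter Topology in
theorem exists_parameter {C c a : ℝ} (hC : 0 < C) (hc : 0 < c) (ha : 0 < a) (ha1 : a ≤ 1) :
    ∃ N : ℕ, ∀ n : ℕ, N < n → ∃ t : ℕ, 0 < t ∧ (t * t + 1) * t * t < n ∧
      ((2 * n : ℕ) + 1) * (C * Real.exp (-(c * (t : ℝ) ^ a)))
        ≤ Real.exp (-((n : ℝ) ^ (a / 10))) := by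
  have hz : Tendsto (fun n : ℕ => (n : ℝ) ^ (a / 10)) atTop atTop :=
    (tendsto_rpow_atTop (by positivity)).comp tendsto_natCast_atTop_atTop
  have h1 : Tendsto (fun n : ℕ => (n : ℝ) * Real.exp (-((n : ℝ) ^ (a / 10)))) atTop (𝓝 0) := by
    have h2 := (tendsto_rpow_mul_exp_neg_mul_atTop_nhds_zero (10 / a) 1 one_pos).comp hz
    refine h2.congr fun n => ?_
    simp only [Function.comp_apply]
    rw [← Real.rpow_mul (Nat.cast_nonneg n), show a / 10 * (10 / a) = 1 by field_simp,
      Real.rpow_one, neg_one_mul]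
  have h2 : ∀ᶠ n : ℕ in atTop, (n : ℝ) * Real.exp (-((n : ℝ) ^ (a / 10))) < 1 / (3 * C) :=
    h1.eventually_lt_const (by positivity)
  obtain ⟨N, hN⟩ := eventually_atTop.1
    ((h2.and (hz.eventually_ge_atTop (4 / c))).and (eventually_ge_atTop 32))
  refine ⟨N, fun n hn => ?_⟩
  obtain ⟨⟨h3, h4⟩, h5⟩ := hN n hn.le
  set u : ℝ := (n : ℝ) ^ (1 / 5 : ℝ) with hu
  have hn5 : (32 : ℝ) ≤ n := by exact_mod_cast h5
  have hu5 : u ^ 5 = n := by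
    rw [hu, ← Real.rpow_natCast, ← Real.rpow_mul (Nat.cast_nonneg n)]
    norm_num
  have hu0 : 0 ≤ u := by positivity
  have hu2 : 2 ≤ u := by
    by_contra hlt
    have := pow_lt_pow_left₀ (not_le.1 hlt) hu0 (n := 5) (by norm_num)
    rw [hu5] at this
    linarith
  have ht2 : 2 ≤ ⌊u⌋₊ := Nat.le_floor (by exact_mod_cast hu2)
  have htu : (⌊u⌋₊ : ℝ) ≤ u := Nat.floor_le hu0
  have htu' : u / 2 ≤ (⌊u⌋₊ : ℝ) := by linarith [Nat.lt_floor_add_one u]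
  set t := ⌊u⌋₊ with ht
  have ht5 : t ^ 5 ≤ n := by
    have : (t : ℝ) ^ 5 ≤ n := hu5 ▸ pow_le_pow_left₀ (Nat.cast_nonneg t) htu 5
    exact_mod_cast this
  refine ⟨t, by omega, lt_of_lt_of_le ?_ ht5, ?_⟩
  · have h6 : t * t + 1 < t ^ 3 := by nlinarith
    calc (t * t + 1) * t * t = (t * t + 1) * (t * t) := mul_assoc _ _ _
      _ < t ^ 3 * (t * t) := Nat.mul_lt_mul_of_pos_right h6 (by positivity)
      _ = t ^ 5 := by ring
  · set z : ℝ := (n : ℝ) ^ (a / 10) with hzdef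
    have hz0 : 0 < z := lt_of_lt_of_le (by positivity) h4
    have h6 : z ^ 2 / 2 ≤ (t : ℝ) ^ a := by
      have h7 : u ^ a = z ^ 2 := by
        rw [hu, hzdef, ← Real.rpow_natCast, ← Real.rpow_mul (Nat.cast_nonneg n),
          ← Real.rpow_mul (Nat.cast_nonneg n)]
        congr 1
        push_cast
        ring
      have h8 : (2 : ℝ) ^ a ≤ 2 := by
        simpa using Real.rpow_le_rpow_of_exponent_le one_le_two ha1
      calc z ^ 2 / 2 ≤ u ^ a / 2 ^ a := by
            rw [h7]
            gcongr
        _ = (u / 2) ^ a := (Real.div_rpow hu0 two_pos.le a).symm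
        _ ≤ _ := Real.rpow_le_rpow (by positivity) htu' ha.le
    have h7 : z + z ≤ c * (t : ℝ) ^ a := by
      have h8 : 4 ≤ z * c := by rwa [div_le_iff₀ hc] at h4
      have h9 := mul_le_mul_of_nonneg_left h6 hc.le
      have h10 := mul_le_mul_of_nonneg_left h8 hz0.le
      nlinarith
    have h8 : Real.exp (-(c * (t : ℝ) ^ a)) ≤ Real.exp (-z) * Real.exp (-z) := by
      rw [← Real.exp_add, Real.exp_le_exp]
      linarith
    have h9 : (((2 * n : ℕ) : ℝ) + 1) * C ≤ n * (3 * C) := by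
      push_cast
      nlinarith
    rw [lt_div_iff₀ (by positivity)] at h3
    calc (((2 * n : ℕ) : ℝ) + 1) * (C * Real.exp (-(c * (t : ℝ) ^ a)))
        = (((2 * n : ℕ) : ℝ) + 1) * C * Real.exp (-(c * (t : ℝ) ^ a)) := (mul_assoc _ _ _).symm
      _ ≤ n * (3 * C) * (Real.exp (-z) * Real.exp (-z)) := by gcongr
      _ = n * Real.exp (-z) * (3 * C) * Real.exp (-z) := by ring
      _ ≤ 1 * Real.exp (-z) := by gcongr
      _ = _ := one_mul _

end MetropolisTree

/-! ### Conclusion: stretched exponential tails of the regeneration times -/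

theorem mainTheorem3 (d : ℕ) (hd : 3 ≤ d)
    (μ : MeasureTheory.Measure ℝ) [MeasureTheory.IsProbabilityMeasure μ]
    (hXS : MetropolisTree.EssBounded μ)
    (β₀ : ℝ) (hβ₀ : 0 < β₀) (hXR : MetropolisTree.ReversibleAt μ β₀)
    (hXM : ∃ c > 0, ∀ β : ℝ, 0 ≤ β → c ≤ MetropolisTree.logLaplace d μ β)
    (h : MetropolisTree.AcceptanceFunction) :
    ∀ K : ℝ, 0 < K → ∃ a : ℝ, 0 < a ∧ ∃ nₐ : ℕ, 0 < nₐ ∧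
      ∀ n : ℕ, nₐ < n → ∀ β : ℝ, |β| ≤ K →
        MetropolisTree.annealedLaw h β₀ β d μ
            {x | (n : ℕ∞) < MetropolisTree.regenTime x.2 1}
          ≤ ENNReal.ofReal (Real.exp (-((n : ℝ) ^ a))) ∧
        MetropolisTree.annealedLaw h β₀ β d μ
            {x | (n : ℕ∞) < MetropolisTree.regenTime x.2 2 - MetropolisTree.regenTime x.2 1}
          ≤ ENNReal.ofReal (Real.exp (-((n : ℝ) ^ a))) := by
  intro K _
  obtain ⟨e⟩ := MetropolisTree.exists_envEstimates hd μ hXS hβ₀ hXR hXM h K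
  obtain ⟨C, c, hC, hc, hgood⟩ := MetropolisTree.exists_walkLaw_not_isGood_le hd e
  obtain ⟨N, hN⟩ := MetropolisTree.exists_parameter hC hc e.a_pos e.a_le_one
  refine ⟨e.a / 10, div_pos e.a_pos (by norm_num), N + 1, Nat.succ_pos N, fun n hn β hβ => ?_⟩
  obtain ⟨t, ht, htn, hexp⟩ := hN n (by omega)
  -- Both tail events are contained in the same bad event with horizon 2n.
  have hbad := (hgood β hβ (2 * n) t ht).trans (ENNReal.ofReal_le_ofReal hexp)
  constructor
  · refine (MetropolisTree.annealedLaw_preimage_le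
      (A := {V | (n : ℕ∞) < MetropolisTree.regenTime V 1}) fun V hV hg => ?_).trans hbad
    exact not_le_of_gt hV (hg.regenTime_le ht htn).1
  · refine (MetropolisTree.annealedLaw_preimage_le
      (A := {V | (n : ℕ∞) < MetropolisTree.regenTime V 2 - MetropolisTree.regenTime V 1})
      fun V hV hg => ?_).trans hbad
    exact not_le_of_gt hV (hg.regenTime_le ht htn).2
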